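/- \textbf{Theorem.} Let $P\subset\mathbb{R}^d$ be a set of $n\ge 1$ distinct points. A \emph{sketchable family} on $P$ is a family $\mathcal F$ of subsets of $P$ that is upward closed (if $X\in\mathcal F$ and $X\subseteq Y\subseteq P$ then $Y\in\mathcal F$), such that every $S\subseteq P$ has a sketch $\mathrm{sk}(S)$, where for disjoint $S,T$ the sketch $\mathrm{sk}(S\cup T)$ is computed from $\mathrm{sk}(S)$ and $\mathrm{sk}(T)$, and a membership oracle decides from $\mathrm{sk}(S)$ whether $S\in\mathcal F$; combining two sketches, copying a sketch and querying the oracle each take constant time $\kappa\geq 1$. A \emph{clustering} is a partition of $P$ into sets of $\mathcal F$; assume that one exists. For nonempty $S\subseteq P$ let $r_{\min}(S)=\min_{c\in S}\max_{q\in S}\|q-c\|$ be the radius of the smallest ball that is centred at a point of $S$ and encloses $S$, and let $r_{\mathrm{opt}}$ be the minimum, over all clusterings, of the maximum of $r_{\min}(S)$ over the clusters $S$. For all $d$ and $\kappa$ there are a randomized algorithm (on a real RAM with floor function, square roots, uniform random integers and constant-time hash tables keyed by tuples of integers) and a constant $C$ such that the following holds. Given such a $P$, the sketches of the empty set and of the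 singletons of $P$, access to the combination procedure and the oracle of a sketchable family $\mathcal F$ on $P$, and $\varepsilon>0$, the algorithm halts with probability one, and whenever it halts it has computed a number $R\le(4+\varepsilon)\,r_{\mathrm{opt}}$ and an assignment of every point of $P$ to a ball of radius $R$ that contains it and is centred at a point of $P$, such that the points assigned to any ball that is used include its centre and form a set of $\mathcal F$. (Hence $r_{\mathrm{opt}}\le R\le(4+\varepsilon)\,r_{\mathrm{opt}}$.) Its expected running time is at most $C\,n\max(1,1/\varepsilon)^d$; that is, $O(n/\varepsilon^d)$ for $\varepsilon\le 1$. In particular (lower-bounded center clustering), if $\mathcal F$ consists of the subsets of $P$ with at least $k$ points, where $k\le n$, the sketch of a set being its cardinality, then the same algorithm computes, in expected time at most $C\,n\max(1,1/\varepsilon)^d$, such a $(4+\varepsilon)$-approximation of the minimum radius of a cover of $P$ by balls centred at input points, to each of which at least $k$ points (its centre among them) are assigned. -/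

import Mathlib

open scoped NNReal ENNReal

/-! ## Sketchable families and min-max clustering -/

/-- A sketchable family on the finite ground set `α`: an upward closed set system whose sets carry
a sketch in the type `σ`, such that the sketch of a disjoint union is computed from the two
sketches by `combine`, and membership of a set is decided from its sketch by `oracle`. The time
that these two procedures take (and the size of a sketch) enters through the cost model of the
machine below, where every operation on sketches is charged a fixed number `κ` of time units. -/
structure SketchableFamily (α : Type*) [DecidableEq α] (σ : Type*) where
  family : Set (Finset α)
  upwardClosed : ∀ X ∈ family, ∀ Y : Finset α, X ⊆ Y → Y ∈ family
  sketch : Finset α → σ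
  combine : σ → σ → σ
  combine_sketch : ∀ S T : Finset α, Disjoint S T →
    combine (sketch S) (sketch T) = sketch (S ∪ T)
  oracle : σ → Bool
  oracle_sketch : ∀ S : Finset α, oracle (sketch S) = true ↔ S ∈ family

/-- The family of the sets with at least `k` elements; the sketch of a set is its cardinality. -/
def lowerBoundFamily (n k : ℕ) : SketchableFamily (Fin n) ℕ where
  family := {S | k ≤ S.card}
  upwardClosed := fun _ hX _ hXY => le_trans hX (Finset.card_le_card hXY)
  sketch := Finset.card
  combine := fun a b => a + b
  combine_sketch := fun _ _ h => (Finset.card_union_of_disjoint h).symm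
  oracle := fun a => decide (k ≤ a)
  oracle_sketch := fun _ => decide_eq_true_iff

namespace MinMaxClustering

variable {d n : ℕ} {σ : Type*}

/-- The radius of the smallest ball centred at `x c` that encloses the points indexed by `S`. -/
noncomputable def enclosingRadius (x : Fin n → EuclideanSpace ℝ (Fin d)) (S : Finset (Fin n))
    (c : Fin n) : ℝ≥0 :=
  S.sup fun i => nndist (x i) (x c)

/-- The radius of the smallest ball that encloses the (nonempty) set of points indexed by `S` and
is centred at one of its points. -/
noncomputable def rmin (x : Fin n → EuclideanSpace ℝ (Fin d)) (S : Finset (Fin n)) : ℝ≥0 :=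
  sInf (enclosingRadius x S '' (S : Set (Fin n)))

/-- A partition of the whole point set all of whose clusters lie in the family. -/
def IsClustering (F : SketchableFamily (Fin n) σ)
    (P : Finpartition (Finset.univ : Finset (Fin n))) : Prop :=
  ∀ S ∈ P.parts, S ∈ F.family

/-- The price of a clustering: the maximum of `rmin` over its clusters. -/
noncomputable def price (x : Fin n → EuclideanSpace ℝ (Fin d))
    (P : Finpartition (Finset.univ : Finset (Fin n))) : ℝ≥0 :=
  P.parts.sup (rmin x)

/-- The minimum price of a clustering (there are finitely many of them, so that it is attained
as soon as there is a clustering at all). -/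
noncomputable def optRadius (F : SketchableFamily (Fin n) σ)
    (x : Fin n → EuclideanSpace ℝ (Fin d)) : ℝ≥0 :=
  sInf (price x '' {P | IsClustering F P})

/-- A cover by balls of radius `R` centred at input points, with an assignment of the points to
the balls: point `i` is assigned to the ball centred at point `center i`. The points assigned to a
ball include its centre, lie in the ball and form a set of the family, and `R` is at most
`(4 + ε)` times the minimum radius. -/
structure IsApproxClustering (F : SketchableFamily (Fin n) σ)
    (x : Fin n → EuclideanSpace ℝ (Fin d)) (ε : ℝ) (center : Fin n → Fin n) (R : ℝ) : Prop where
  center_center : ∀ i, center (center i) = center i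
  cluster_mem : ∀ i, (Finset.univ.filter fun j => center j = center i) ∈ F.family
  dist_le : ∀ i, dist (x i) (x (center i)) ≤ R
  radius_le : R ≤ (4 + ε) * (optRadius F x : ℝ)

end MinMaxClustering

/-! ## A randomized real RAM with floor function, hash tables and sketches

A program is a fixed finite object. The memory of the machine consists of hash tables, numbered by
natural numbers and keyed by tuples of integers (a tuple of length 0 gives a variable, a tuple of
length 1 indexes an array). There are three kinds of tables: for integers, for real numbers, and
for sketches. The tables that a program accesses are fixed in its text, and so are the lengths of
the tuples. -/

namespace SketchRAM

inductive Ty where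
  | int
  | real
  | prop

@[reducible] def Ty.Val : Ty → Type
  | .int => ℤ
  | .real => ℝ
  | .prop => Prop

inductive Expr : Ty → Type where
  | intLit (z : ℤ) : Expr .int
  | intGet (a : ℕ) {m : ℕ} (key : Fin m → Expr .int) : Expr .int
  | intAdd (p q : Expr .int) : Expr .int
  | intSub (p q : Expr .int) : Expr .int
  | intMul (p q : Expr .int) : Expr .int
  | floor (p : Expr .real) : Expr .int
  | ofInt (p : Expr .int) : Expr .real
  | realGet (a : ℕ) {m : ℕ} (key : Fin m → Expr .int) : Expr .real
  | realAdd (p q : Expr .real) : Expr .real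
  | realSub (p q : Expr .real) : Expr .real
  | realMul (p q : Expr .real) : Expr .real
  | realDiv (p q : Expr .real) : Expr .real
  | sqrt (p : Expr .real) : Expr .real
  | intLe (p q : Expr .int) : Expr .prop
  | realLe (p q : Expr .real) : Expr .prop
  | and (p q : Expr .prop) : Expr .prop
  | not (p : Expr .prop) : Expr .prop

/-- The contents of the memory. -/
structure Store (σ : Type*) where
  ints : ℕ → List ℤ → ℤ
  reals : ℕ → List ℤ → ℝ
  sketches : ℕ → List ℤ → σ

noncomputable def Expr.eval {σ : Type*} (s : Store σ) : {τ : Ty} → Expr τ → τ.Val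
  | _, .intLit z => z
  | _, .intGet a key => s.ints a (List.ofFn fun j => (key j).eval s)
  | _, .intAdd p q => (p.eval s + q.eval s : ℤ)
  | _, .intSub p q => (p.eval s - q.eval s : ℤ)
  | _, .intMul p q => (p.eval s * q.eval s : ℤ)
  | _, .floor p => ⌊(p.eval s : ℝ)⌋
  | _, .ofInt p => ((p.eval s : ℤ) : ℝ)
  | _, .realGet a key => s.reals a (List.ofFn fun j => (key j).eval s)
  | _, .realAdd p q => (p.eval s + q.eval s : ℝ)
  | _, .realSub p q => (p.eval s - q.eval s : ℝ)
  | _, .realMul p q => (p.eval s * q.eval s : ℝ)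
  | _, .realDiv p q => (p.eval s / q.eval s : ℝ)
  | _, .sqrt p => Real.sqrt (p.eval s)
  | _, .intLe p q => (p.eval s : ℤ) ≤ q.eval s
  | _, .realLe p q => (p.eval s : ℝ) ≤ q.eval s
  | _, .and p q => p.eval s ∧ q.eval s
  | _, .not p => ¬ p.eval s

/-- A memory cell: a table and an expression for each entry of the key. -/
structure Loc where
  table : ℕ
  {len : ℕ}
  key : Fin len → Expr .int

noncomputable def Loc.eval {σ : Type*} (s : Store σ) (l : Loc) : List ℤ :=
  List.ofFn fun j => (l.key j).eval s

inductive Cmd where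
  | skip : Cmd
  /-- `l := p` for integers -/
  | intSet (l : Loc) (p : Expr .int) : Cmd
  /-- `l := p` for real numbers -/
  | realSet (l : Loc) (p : Expr .real) : Cmd
  /-- `l :=` a uniformly random element of `{0, …, p - 1}` (and `0` if `p ≤ 0`) -/
  | draw (l : Loc) (p : Expr .int) : Cmd
  /-- copy a sketch -/
  | copy (l l₁ : Loc) : Cmd
  /-- `l := combine l₁ l₂` -/
  | combine (l l₁ l₂ : Loc) : Cmd
  /-- `l := 1` if the oracle accepts the sketch in `l₁`, and `l := 0` otherwise -/
  | query (l l₁ : Loc) : Cmd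
  | seq (c₁ c₂ : Cmd) : Cmd
  | ite (p : Expr .prop) (c₁ c₂ : Cmd) : Cmd
  | while (p : Expr .prop) (c : Cmd) : Cmd

/-- Overwrite one entry of one table. -/
def update {β : Type*} (f : ℕ → List ℤ → β) (a : ℕ) (key : List ℤ) (v : β) : ℕ → List ℤ → β :=
  Function.update f a (Function.update (f a) key v)

section Semantics

variable {α : Type*} [DecidableEq α] {σ : Type*}

noncomputable def Store.setInt (s : Store σ) (l : Loc) (v : ℤ) : Store σ :=
  { s with ints := update s.ints l.table (l.eval s) v }

noncomputable def Store.setReal (s : Store σ) (l : Loc) (v : ℝ) : Store σ :=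
  { s with reals := update s.reals l.table (l.eval s) v }

noncomputable def Store.setSketch (s : Store σ) (l : Loc) (v : σ) : Store σ :=
  { s with sketches := update s.sketches l.table (l.eval s) v }

noncomputable def Store.getSketch (s : Store σ) (l : Loc) : σ :=
  s.sketches l.table (l.eval s)

/-- A configuration: the commands that remain to be executed, and the memory. The machine has
halted when no command remains. -/
abbrev Config (σ : Type*) := List Cmd × Store σ

open Classical in
/-- One step of the machine. -/
noncomputable def step (F : SketchableFamily α σ) : Config σ → PMF (Config σ)
  | ([], s) => PMF.pure ([], s)
  | (.skip :: k, s) => PMF.pure (k, s)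
  | (.intSet l p :: k, s) => PMF.pure (k, s.setInt l (p.eval s))
  | (.realSet l p :: k, s) => PMF.pure (k, s.setReal l (p.eval s))
  | (.draw l p :: k, s) =>
      (PMF.uniformOfFintype (Fin ((p.eval s).toNat - 1 + 1))).map
        fun v => (k, s.setInt l ((v : ℕ) : ℤ))
  | (.copy l l₁ :: k, s) => PMF.pure (k, s.setSketch l (s.getSketch l₁))
  | (.combine l l₁ l₂ :: k, s) =>
      PMF.pure (k, s.setSketch l (F.combine (s.getSketch l₁) (s.getSketch l₂)))
  | (.query l l₁ :: k, s) =>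
      PMF.pure (k, s.setInt l (if F.oracle (s.getSketch l₁) = true then 1 else 0))
  | (.seq c₁ c₂ :: k, s) => PMF.pure (c₁ :: c₂ :: k, s)
  | (.ite p c₁ c₂ :: k, s) => PMF.pure (if p.eval s then (c₁ :: k, s) else (c₂ :: k, s))
  | (.while p c :: k, s) =>
      PMF.pure (if p.eval s then (c :: .while p c :: k, s) else (k, s))

/-- The time that the next step takes: `κ` units for an operation on sketches, one unit for every
other command, nothing after the machine has halted. (The number of elementary operations in one
command is bounded in terms of the text of the program.) -/
def stepCost (κ : ℕ) : Config σ → ℕ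
  | ([], _) => 0
  | (.copy _ _ :: _, _) => κ
  | (.combine _ _ _ :: _, _) => κ
  | (.query _ _ :: _, _) => κ
  | (_ :: _, _) => 1

/-- The distribution of the configuration after `t` steps. -/
noncomputable def runDist (F : SketchableFamily α σ) (cfg : Config σ) : ℕ → PMF (Config σ)
  | 0 => PMF.pure cfg
  | t + 1 => (runDist F cfg t).bind (step F)

/-- The expected total running time: the sum over all `t` of the expected time of the step number
`t`. It is infinite if the machine runs forever with positive probability. -/
noncomputable def expectedTime (κ : ℕ) (F : SketchableFamily α σ) (cfg : Config σ) : ℝ≥0∞ :=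
  ∑' t : ℕ, ∑' cfg' : Config σ, runDist F cfg t cfg' * (stepCost κ cfg' : ℝ≥0∞)

end Semantics

section InputOutput

variable {d n : ℕ} {σ : Type*}

/-- The input: integer variable `0` holds `n`, real variable `0` holds `ε`, entry `(i, j)` of the
real table `1` holds coordinate `j` of point `i`, and entry `i` of the sketch table `0` holds the
sketch of the singleton of point `i`. Everything else is `0`, or the sketch of the empty set. -/
noncomputable def input (F : SketchableFamily (Fin n) σ)
    (x : Fin n → EuclideanSpace ℝ (Fin d)) (ε : ℝ) : Store σ where
  ints := fun a key => if a = 0 ∧ key = [] then (n : ℤ) else 0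
  reals := fun a key =>
    match a, key with
    | 0, [] => ε
    | 1, [i, j] =>
        if h : (0 ≤ i ∧ i.toNat < n) ∧ (0 ≤ j ∧ j.toNat < d) then
          x ⟨i.toNat, h.1.2⟩ ⟨j.toNat, h.2.2⟩
        else 0
    | _, _ => 0
  sketches := fun a key =>
    match a, key with
    | 0, [i] =>
        if h : 0 ≤ i ∧ i.toNat < n then F.sketch {⟨i.toNat, h.2⟩} else F.sketch ∅
    | _, _ => F.sketch ∅

/-- The output: entry `i` of the integer table `1` holds the index of the centre of the ball that
point `i` is assigned to, and real variable `2` holds the radius of the balls. -/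
def Outputs (s : Store σ) (center : Fin n → Fin n) (R : ℝ) : Prop :=
  (∀ i : Fin n, s.ints 1 [((i : ℕ) : ℤ)] = ((center i : ℕ) : ℤ)) ∧ s.reals 2 [] = R

/-- On the given input, the program halts with a `(4 + ε)`-approximate min-max clustering whatever
the random choices (whenever it halts, the output is correct), and its expected running time is at
most `T`; in particular it halts with probability one if `T` is finite. -/
def ApproximatesWithin (prog : Cmd) (κ : ℕ) (F : SketchableFamily (Fin n) σ)
    (x : Fin n → EuclideanSpace ℝ (Fin d)) (ε : ℝ) (T : ℝ≥0∞) : Prop :=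
  (∀ (t : ℕ) (s : Store σ), ([], s) ∈ (runDist F ([prog], input F x ε) t).support →
    ∃ (center : Fin n → Fin n) (R : ℝ), Outputs s center R ∧
      MinMaxClustering.IsApproxClustering F x ε center R) ∧
  expectedTime κ F ([prog], input F x ε) ≤ T

end InputOutput

end SketchRAM

/-! The method is net and prune. At a scale `r` a greedy net with pairwise distances above `4 * r`
is chosen, every point is assigned to its nearest net point, and the oracle is asked about every
cluster. If all clusters are accepted, balls of radius `4 * r` suffice. If one is rejected, `r` is
below the optimum: an optimal cluster has diameter at most twice the optimal radius, so for larger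
`r` the optimal cluster of a net point lies within `2 * r` of that point, where no other net point
can be nearer. The net cluster would then contain a set of the family and belong to it, by upward
closure. A grid makes such a test take linear time (`agg_mem_of_optRadius_le`, `isNet_netCenter`,
`runs_clusterCmd`).

The scale is found by random sampling. Let `l` be the nearest-neighbour distance of a random point
of the current list. If the test at `l` fails, the list is replaced by its net, which drops at least
half as many points as have nearest-neighbour distance at most `l`. If `l` is far too large, the
points that form singleton clusters at scale `l / 8` are split off for good, among them all whose
nearest-neighbour distance is at least `l`. Otherwise `l` determines the optimum up to a constant
factor. Moving points to net points causes an error `δ`, which never accumulates beyond a constant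
times the optimum, because it stays comparable to the distances in the current net (`Reduced.net`,
`Reduced.prune`).

By counting sorted triples, the smaller of the two ranks of a random element of an `m`-element set
is at least `m / 6` on average (`sq_card_le_six_mul_sum_min`). Hence a round that continues shrinks
the list in expectation to at most `11 / 12` of its length, and the expected times of the rounds
form a geometric series (`wp_searchLoop`).

Starting from a lower bound that is tight up to the factor `6000`, the test is finally repeated on
all points, with the radius multiplied by `1 + ε / 4` until it succeeds. This overshoots the optimum
by at most that factor, which gives `4 * (1 + ε / 4) = 4 + ε`, in `O(max 1 (1 / ε))` linear passes.
Two degenerate cases are caught at the start by testing all singletons: optimum zero and dimension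
zero. -/

namespace SketchRAM

/-! ### Expected running time and a calculus for programs -/

section Framework

variable {α : Type*} [DecidableEq α] {σ : Type*}

theorem runDist_succ' (F : SketchableFamily α σ) (cfg : Config σ) (t : ℕ) :
    runDist F cfg (t + 1) = (step F cfg).bind fun c => runDist F c t := by
  induction t with
  | zero =>
    simp [runDist]
  | succ t ih =>
    rw [runDist, ih, PMF.bind_bind]
    rfl

/-- Markov property: splitting off the first step turns the sum over all times into the same sum
started after that step. All terms are nonnegative, so the sums may be exchanged. -/
theorem expectedTime_eq (κ : ℕ) (F : SketchableFamily α σ) (cfg : Config σ) :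
    expectedTime κ F cfg =
      stepCost κ cfg + ∑' c, step F cfg c * expectedTime κ F c := by
  classical
  have h0 : ∑' cfg' : Config σ, runDist F cfg 0 cfg' * (stepCost κ cfg' : ℝ≥0∞) =
      stepCost κ cfg := by
    rw [tsum_eq_single cfg]
    · simp [runDist]
    · intro c hc
      simp [runDist, hc]
  have h1 : ∀ t, ∑' cfg' : Config σ, runDist F cfg (t + 1) cfg' * (stepCost κ cfg' : ℝ≥0∞) =
      ∑' c, step F cfg c * ∑' cfg', runDist F c t cfg' * (stepCost κ cfg' : ℝ≥0∞) := by
    intro t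
    simp only [runDist_succ', PMF.bind_apply, ← ENNReal.tsum_mul_right, ← ENNReal.tsum_mul_left]
    rw [ENNReal.tsum_comm]
    simp only [mul_assoc]
  rw [expectedTime, tsum_eq_zero_add' ENNReal.summable, h0]
  simp only [h1]
  rw [ENNReal.tsum_comm]
  simp only [ENNReal.tsum_mul_left, expectedTime]

/-- Started in `cfg`, the machine can halt only in memories that satisfy `Q`, and its expected
running time is at most `T`. -/
def WP (F : SketchableFamily α σ) (κ : ℕ) (cfg : Config σ) (Q : Store σ → Prop) (T : ℝ≥0∞) :
    Prop :=
  (∀ (t : ℕ) (s : Store σ), ([], s) ∈ (runDist F cfg t).support → Q s) ∧ expectedTime κ F cfg ≤ T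

variable {F : SketchableFamily α σ} {κ : ℕ} {Q : Store σ → Prop}

theorem WP.mono {cfg : Config σ} {T T' : ℝ≥0∞} (h : WP F κ cfg Q T) (hT : T ≤ T') :
    WP F κ cfg Q T' :=
  ⟨h.1, h.2.trans hT⟩

theorem WP.nil {s : Store σ} (h : Q s) : WP F κ ([], s) Q 0 := by
  have hr : ∀ t, runDist F ([], s) t = PMF.pure ([], s) := by
    intro t
    induction t with
    | zero => rfl
    | succ t ih => rw [runDist, ih, PMF.pure_bind, step]
  refine ⟨fun t s' hs' => ?_, ?_⟩
  · rw [hr, PMF.support_pure] at hs'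
    obtain rfl : s' = s := by simpa using hs'
    exact h
  · refine le_of_eq ?_
    rw [expectedTime]
    simp only [hr]
    refine ENNReal.tsum_eq_zero.2 fun t => ENNReal.tsum_eq_zero.2 fun c => ?_
    by_cases hc : c = ([], s)
    · subst hc
      simp [stepCost]
    · simp [hc]

/-- Bounds on the remaining time are needed only for configurations that the step can reach; all
others have weight zero in the average. -/
theorem WP.of_step {c : Cmd} {k : List Cmd} {s : Store σ} {T : Config σ → ℝ≥0∞}
    (h : ∀ c' ∈ (step F (c :: k, s)).support, WP F κ c' Q (T c')) :
    WP F κ (c :: k, s) Q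
      (stepCost κ (c :: k, s) + ∑' c', step F (c :: k, s) c' * T c') := by
  refine ⟨fun t s' hs' => ?_, ?_⟩
  · cases t with
    | zero => simp [runDist] at hs'
    | succ t =>
      rw [runDist_succ', PMF.mem_support_bind_iff] at hs'
      obtain ⟨c', hc', hs'⟩ := hs'
      exact (h c' hc').1 t s' hs'
  · rw [expectedTime_eq]
    refine add_le_add le_rfl (ENNReal.tsum_le_tsum fun c' => ?_)
    by_cases hc : c' ∈ (step F (c :: k, s)).support
    · have := (h c' hc).2
      gcongr
    · rw [PMF.mem_support_iff, not_not] at hc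
      simp [hc]

theorem stepCost_le (hκ : 1 ≤ κ) (cfg : Config σ) : stepCost κ cfg ≤ κ := by
  obtain ⟨l, s⟩ := cfg
  cases l with
  | nil => simp [stepCost]
  | cons c k => cases c <;> simp [stepCost, hκ]

/-- Every command is charged `κ`, an upper bound for its cost, so that from here on only steps have
to be counted. -/
theorem WP.of_pure (hκ : 1 ≤ κ) {c : Cmd} {k : List Cmd} {s : Store σ} {c' : Config σ}
    {T : ℝ≥0∞} (hs : step F (c :: k, s) = PMF.pure c') (h : WP F κ c' Q T) :
    WP F κ (c :: k, s) Q (T + κ) := by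
  have := WP.of_step (F := F) (κ := κ) (Q := Q) (c := c) (k := k) (s := s) (T := fun _ => T)
    (by
      intro d hd
      rw [hs, PMF.support_pure] at hd
      obtain rfl : d = c' := by simpa using hd
      exact h)
  refine this.mono ?_
  rw [ENNReal.tsum_mul_right, PMF.tsum_coe, one_mul, add_comm]
  gcongr
  exact_mod_cast stepCost_le hκ _

/-- The only rule that averages: time bounds that depend on the drawn value are replaced by their
mean, while correctness must hold for every value. -/
theorem WP.draw (hκ : 1 ≤ κ) {l : Loc} {p : Expr .int} {k : List Cmd} {s : Store σ} {m : ℕ}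
    (hm : 0 < m) (hp : p.eval s = (m : ℤ)) {T : ℕ → ℝ≥0∞}
    (h : ∀ v < m, WP F κ (k, s.setInt l (v : ℤ)) Q (T v)) :
    WP F κ (.draw l p :: k, s) Q (κ + (∑ v ∈ Finset.range m, T v) / m) := by
  classical
  -- The machine draws from a type of size `toNat - 1 + 1`, which is never empty; for a positive
  -- bound this is the bound itself.
  have hm' : (p.eval s).toNat - 1 + 1 = m := by
    rw [hp, Int.toNat_natCast]; omega
  let E : Config σ → ℝ≥0∞ := fun c => expectedTime κ F c
  have hstep : step F (.draw l p :: k, s) =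
      (PMF.uniformOfFintype (Fin ((p.eval s).toNat - 1 + 1))).map
        fun v : Fin ((p.eval s).toNat - 1 + 1) => (k, s.setInt l ((v : ℕ) : ℤ)) := by
    -- In `step` the drawn element is first mapped to `ℕ` and then to a configuration; the two maps
    -- are fused.
    change PMF.map _ (PMF.map (fun v : Fin ((p.eval s).toNat - 1 + 1) => (v : ℕ)) _) = _
    rw [PMF.map_comp]
    rfl
  have key := WP.of_step (F := F) (κ := κ) (Q := Q) (c := .draw l p) (k := k) (s := s) (T := E)
    (by
      intro c' hc'
      rw [hstep, PMF.mem_support_map_iff] at hc'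
      obtain ⟨v, -, rfl⟩ := hc'
      exact ⟨(h v (by omega)).1, le_rfl⟩)
  refine key.mono ?_
  gcongr ?_ + ?_
  · exact_mod_cast stepCost_le hκ _
  · have hexp : ∑' c', step F (.draw l p :: k, s) c' * E c' =
        ∑' v : Fin ((p.eval s).toNat - 1 + 1),
          PMF.uniformOfFintype (Fin ((p.eval s).toNat - 1 + 1)) v *
            E (k, s.setInt l ((v : ℕ) : ℤ)) := by
      rw [hstep]
      simp only [PMF.map_apply, ← ENNReal.tsum_mul_right]
      rw [ENNReal.tsum_comm]
      refine tsum_congr fun v => ?_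
      rw [tsum_eq_single (k, s.setInt l ((v : ℕ) : ℤ))]
      · simp
      · intro c hc
        simp [hc]
    rw [hexp, tsum_fintype]
    simp only [PMF.uniformOfFintype_apply, Fintype.card_fin]
    rw [← Finset.mul_sum, Fin.sum_univ_eq_sum_range (fun v => E (k, s.setInt l (v : ℤ))), hm',
      ENNReal.div_eq_inv_mul]
    gcongr with v hv
    exact (h v (by simpa using hv)).2

/-! ### Framing, and deterministic execution of straight-line code and counting loops -/

/-- The command may write to the integer table `a`. -/
def Cmd.WritesInt (a : ℕ) : Cmd → Prop
  | .intSet l _ => a = l.table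
  | .draw l _ => a = l.table
  | .query l _ => a = l.table
  | .seq c₁ c₂ => c₁.WritesInt a ∨ c₂.WritesInt a
  | .ite _ c₁ c₂ => c₁.WritesInt a ∨ c₂.WritesInt a
  | .while _ c => c.WritesInt a
  | _ => False

/-- The command may write to the real table `a`. -/
def Cmd.WritesReal (a : ℕ) : Cmd → Prop
  | .realSet l _ => a = l.table
  | .seq c₁ c₂ => c₁.WritesReal a ∨ c₂.WritesReal a
  | .ite _ c₁ c₂ => c₁.WritesReal a ∨ c₂.WritesReal a
  | .while _ c => c.WritesReal a
  | _ => False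

/-- The command may write to the sketch table `a`. -/
def Cmd.WritesSketch (a : ℕ) : Cmd → Prop
  | .copy l _ => a = l.table
  | .combine l _ _ => a = l.table
  | .seq c₁ c₂ => c₁.WritesSketch a ∨ c₂.WritesSketch a
  | .ite _ c₁ c₂ => c₁.WritesSketch a ∨ c₂.WritesSketch a
  | .while _ c => c.WritesSketch a
  | _ => False

/-- The memories `s` and `s'` agree in the tables that `c` does not write to. -/
structure Keeps (c : Cmd) (s s' : Store σ) : Prop where
  ints : ∀ a, ¬ c.WritesInt a → s'.ints a = s.ints a
  reals : ∀ a, ¬ c.WritesReal a → s'.reals a = s.reals a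
  sketches : ∀ a, ¬ c.WritesSketch a → s'.sketches a = s.sketches a

theorem Keeps.refl (c : Cmd) (s : Store σ) : Keeps c s s :=
  ⟨fun _ _ => rfl, fun _ _ => rfl, fun _ _ => rfl⟩

theorem Keeps.trans {c : Cmd} {s s₁ s₂ : Store σ} (h₁ : Keeps c s s₁) (h₂ : Keeps c s₁ s₂) :
    Keeps c s s₂ :=
  ⟨fun a h => (h₂.ints a h).trans (h₁.ints a h), fun a h => (h₂.reals a h).trans (h₁.reals a h),
    fun a h => (h₂.sketches a h).trans (h₁.sketches a h)⟩

theorem Keeps.mono {c c' : Cmd} {s s' : Store σ} (h : Keeps c s s')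
    (h1 : ∀ a, c.WritesInt a → c'.WritesInt a) (h2 : ∀ a, c.WritesReal a → c'.WritesReal a)
    (h3 : ∀ a, c.WritesSketch a → c'.WritesSketch a) : Keeps c' s s' :=
  ⟨fun a ha => h.ints a fun h' => ha (h1 a h'), fun a ha => h.reals a fun h' => ha (h2 a h'),
    fun a ha => h.sketches a fun h' => ha (h3 a h')⟩

theorem keeps_setInt {c : Cmd} {s : Store σ} {l : Loc} {v : ℤ} (h : c.WritesInt l.table) :
    Keeps c s (s.setInt l v) := by
  refine ⟨fun a ha => ?_, fun a ha => rfl, fun a ha => rfl⟩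
  have hne : a ≠ l.table := by
    rintro rfl
    exact ha h
  simp [Store.setInt, update, hne]

theorem keeps_setReal {c : Cmd} {s : Store σ} {l : Loc} {v : ℝ} (h : c.WritesReal l.table) :
    Keeps c s (s.setReal l v) := by
  refine ⟨fun a ha => rfl, fun a ha => ?_, fun a ha => rfl⟩
  have hne : a ≠ l.table := by
    rintro rfl
    exact ha h
  simp [Store.setReal, update, hne]

theorem keeps_setSketch {c : Cmd} {s : Store σ} {l : Loc} {v : σ} (h : c.WritesSketch l.table) :
    Keeps c s (s.setSketch l v) := by
  refine ⟨fun a ha => rfl, fun a ha => rfl, fun a ha => ?_⟩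
  have hne : a ≠ l.table := by
    rintro rfl
    exact ha h
  simp [Store.setSketch, update, hne]

/-- Executing `c` in the memory `s` deterministically leads to `s'` within `T` steps. -/
structure Runs (F : SketchableFamily α σ) (κ : ℕ) (c : Cmd) (s s' : Store σ) (T : ℕ) : Prop where
  wp : ∀ (k : List Cmd) (Q : Store σ → Prop) (U : ℝ≥0∞), WP F κ (k, s') Q U →
    WP F κ (c :: k, s) Q (U + (κ * T : ℕ))
  keeps : Keeps c s s'

theorem Runs.mono {c : Cmd} {s s' : Store σ} {T T' : ℕ} (h : Runs F κ c s s' T) (hT : T ≤ T') :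
    Runs F κ c s s' T' := by
  refine ⟨fun k Q U hU => (h.wp k Q U hU).mono ?_, h.keeps⟩
  gcongr

theorem Runs.of_pure (hκ : 1 ≤ κ) {c : Cmd} {s s' : Store σ}
    (h : ∀ k, step F (c :: k, s) = PMF.pure (k, s')) (hk : Keeps c s s') : Runs F κ c s s' 1 := by
  refine ⟨fun k Q U hU => ?_, hk⟩
  simpa using WP.of_pure hκ (h k) hU

theorem Runs.seq (hκ : 1 ≤ κ) {c₁ c₂ : Cmd} {s s₁ s₂ : Store σ} {T₁ T₂ : ℕ}
    (h₁ : Runs F κ c₁ s s₁ T₁) (h₂ : Runs F κ c₂ s₁ s₂ T₂) :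
    Runs F κ (.seq c₁ c₂) s s₂ (T₁ + T₂ + 1) := by
  refine ⟨fun k Q U hU => ?_, Keeps.trans
    (h₁.keeps.mono (fun _ => Or.inl) (fun _ => Or.inl) (fun _ => Or.inl))
    (h₂.keeps.mono (fun _ => Or.inr) (fun _ => Or.inr) (fun _ => Or.inr))⟩
  refine (WP.of_pure hκ rfl (h₁.wp _ _ _ (h₂.wp _ _ _ hU))).mono (le_of_eq ?_)
  push_cast
  ring

theorem Runs.ite_pos (hκ : 1 ≤ κ) {p : Expr .prop} {c₁ c₂ : Cmd} {s s' : Store σ} {T : ℕ}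
    (hp : p.eval s) (h : Runs F κ c₁ s s' T) : Runs F κ (.ite p c₁ c₂) s s' (T + 1) := by
  refine ⟨fun k Q U hU => ?_,
    h.keeps.mono (fun _ => Or.inl) (fun _ => Or.inl) (fun _ => Or.inl)⟩
  refine (WP.of_pure hκ (c' := (c₁ :: k, s)) ?_ (h.wp _ _ _ hU)).mono (le_of_eq ?_)
  · rw [step, if_pos hp]
  · push_cast
    ring

theorem Runs.ite_neg (hκ : 1 ≤ κ) {p : Expr .prop} {c₁ c₂ : Cmd} {s s' : Store σ} {T : ℕ}
    (hp : ¬ p.eval s) (h : Runs F κ c₂ s s' T) : Runs F κ (.ite p c₁ c₂) s s' (T + 1) := by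
  refine ⟨fun k Q U hU => ?_,
    h.keeps.mono (fun _ => Or.inr) (fun _ => Or.inr) (fun _ => Or.inr)⟩
  refine (WP.of_pure hκ (c' := (c₂ :: k, s)) ?_ (h.wp _ _ _ hU)).mono (le_of_eq ?_)
  · rw [step, if_neg hp]
  · push_cast
    ring

theorem Runs.while_neg (hκ : 1 ≤ κ) {p : Expr .prop} {c : Cmd} {s : Store σ}
    (hp : ¬ p.eval s) : Runs F κ (.while p c) s s 1 := by
  refine Runs.of_pure hκ (fun k => ?_) (Keeps.refl _ _)
  rw [step, if_neg hp]

theorem Runs.while_pos (hκ : 1 ≤ κ) {p : Expr .prop} {c : Cmd} {s s₁ s₂ : Store σ} {T₁ T₂ : ℕ}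
    (hp : p.eval s) (h₁ : Runs F κ c s s₁ T₁) (h₂ : Runs F κ (.while p c) s₁ s₂ T₂) :
    Runs F κ (.while p c) s s₂ (T₁ + T₂ + 1) := by
  refine ⟨fun k Q U hU => ?_,
    Keeps.trans (h₁.keeps.mono (fun _ => id) (fun _ => id) (fun _ => id)) h₂.keeps⟩
  refine (WP.of_pure hκ (c' := (c :: .while p c :: k, s)) ?_
    (h₁.wp _ _ _ (h₂.wp _ _ _ hU))).mono (le_of_eq ?_)
  · rw [step, if_pos hp]
  · push_cast
    ring

/-- The commands without loops and random choices. -/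
def Cmd.LoopFree : Cmd → Prop
  | .seq c₁ c₂ => c₁.LoopFree ∧ c₂.LoopFree
  | .ite _ c₁ c₂ => c₁.LoopFree ∧ c₂.LoopFree
  | .while _ _ => False
  | .draw _ _ => False
  | _ => True

def Cmd.size : Cmd → ℕ
  | .seq c₁ c₂ => c₁.size + c₂.size + 1
  | .ite _ c₁ c₂ => c₁.size + c₂.size + 1
  | _ => 1

open Classical in
/-- The effect of a loop-free command on the memory. -/
noncomputable def run (F : SketchableFamily α σ) : Cmd → Store σ → Store σ
  | .intSet l p, s => s.setInt l (p.eval s)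
  | .realSet l p, s => s.setReal l (p.eval s)
  | .copy l l₁, s => s.setSketch l (s.getSketch l₁)
  | .combine l l₁ l₂, s => s.setSketch l (F.combine (s.getSketch l₁) (s.getSketch l₂))
  | .query l l₁, s => s.setInt l (if F.oracle (s.getSketch l₁) = true then 1 else 0)
  | .seq c₁ c₂, s => run F c₂ (run F c₁ s)
  | .ite p c₁ c₂, s => if p.eval s then run F c₁ s else run F c₂ s
  | _, s => s

theorem Runs.of_loopFree (hκ : 1 ≤ κ) {c : Cmd} (hc : c.LoopFree) (s : Store σ) :
    Runs F κ c s (run F c s) c.size := by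
  induction c generalizing s with
  | skip => exact Runs.of_pure hκ (fun k => rfl) (Keeps.refl _ _)
  | intSet l p => exact Runs.of_pure hκ (fun k => rfl) (keeps_setInt rfl)
  | realSet l p => exact Runs.of_pure hκ (fun k => rfl) (keeps_setReal rfl)
  | draw l p => exact hc.elim
  | copy l l₁ => exact Runs.of_pure hκ (fun k => rfl) (keeps_setSketch rfl)
  | combine l l₁ l₂ => exact Runs.of_pure hκ (fun k => rfl) (keeps_setSketch rfl)
  | query l l₁ => exact Runs.of_pure hκ (fun k => rfl) (keeps_setInt rfl)
  | seq c₁ c₂ ih₁ ih₂ => exact (ih₁ hc.1 s).seq hκ (ih₂ hc.2 _)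
  | ite p c₁ c₂ ih₁ ih₂ =>
    by_cases hp : p.eval s
    · rw [run, if_pos hp]
      refine (Runs.ite_pos hκ hp (ih₁ hc.1 s)).mono ?_
      simp only [Cmd.size]; omega
    · rw [run, if_neg hp]
      refine (Runs.ite_neg hκ hp (ih₂ hc.2 s)).mono ?_
      simp only [Cmd.size]; omega
  | _ => exact hc.elim

/-- The integer variable number `a`. -/
def V (a : ℕ) : Loc := ⟨a, (![] : Fin 0 → Expr .int)⟩

/-- The entry of table `a` at the index `e`. -/
def A (a : ℕ) (e : Expr .int) : Loc := ⟨a, ![e]⟩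

def iv (a : ℕ) : Expr .int := .intGet a ![]

def ia (a : ℕ) (e : Expr .int) : Expr .int := .intGet a ![e]

def rv (a : ℕ) : Expr .real := .realGet a ![]

@[simp] theorem iv_eval (s : Store σ) (a : ℕ) : (iv a).eval s = s.ints a [] := by
  simp [iv, Expr.eval]

@[simp] theorem ia_eval (s : Store σ) (a : ℕ) (e : Expr .int) :
    (ia a e).eval s = s.ints a [e.eval s] := by
  simp [ia, Expr.eval]

@[simp] theorem rv_eval (s : Store σ) (a : ℕ) : (rv a).eval s = s.reals a [] := by
  simp [rv, Expr.eval]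

@[simp] theorem V_eval (s : Store σ) (a : ℕ) : (V a).eval s = [] := by
  simp [V, Loc.eval]

@[simp] theorem A_eval (s : Store σ) (a : ℕ) (e : Expr .int) : (A a e).eval s = [e.eval s] := by
  simp [A, Loc.eval]

@[simp] theorem V_table (a : ℕ) : (V a).table = a := rfl

@[simp] theorem A_table (a : ℕ) (e : Expr .int) : (A a e).table = a := rfl

open Classical in
theorem update_apply {β : Type*} (f : ℕ → List ℤ → β) (a a' : ℕ) (k k' : List ℤ) (v : β) :
    update f a k v a' k' = if a' = a ∧ k' = k then v else f a' k' := by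
  by_cases h : a' = a
  · subst h
    by_cases h' : k' = k
    · subst h'; simp [update]
    · simp [update, h']
  · simp [update, h]

/-- Execute `body` for `v = 0, 1, …, m - 1`, where `m` is the value of the variable `b`. -/
def forLoop (v b : ℕ) (body : Cmd) : Cmd :=
  .seq (.intSet (V v) (.intLit 0))
    (.while (.not (.intLe (iv b) (iv v)))
      (.seq body (.intSet (V v) (.intAdd (iv v) (.intLit 1)))))

theorem setInt_V_ints (s : Store σ) (a b : ℕ) (k : List ℤ) (z : ℤ) :
    (s.setInt (V a) z).ints b k = if b = a ∧ k = [] then z else s.ints b k := by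
  simp [Store.setInt, update_apply]

/-- The frame condition is handed to the induction step, so `I` need only describe what the body
changes; `hI` is required because the counter is overwritten between rounds. A round costs the body
plus loop test, sequencing and increment; the final `3` is the outer sequencing, the initialisation
and the failing test. -/
theorem Runs.forLoop (hκ : 1 ≤ κ) {v b : ℕ} {body : Cmd} (hb : body.LoopFree)
    (hv : ¬ body.WritesInt v) (hbv : ¬ body.WritesInt b) (hne : b ≠ v) {m : ℕ}
    {s : Store σ} (hm : s.ints b [] = m) (I : ℕ → Store σ → Prop)
    (hI : ∀ i s z, I i s → I i (s.setInt (V v) z)) (h0 : I 0 s)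
    (hstep : ∀ i < m, ∀ s', Keeps (forLoop v b body) s s' → s'.ints v [] = i → I i s' →
      I (i + 1) (run F body s')) :
    ∃ s', Runs F κ (forLoop v b body) s s' ((body.size + 3) * m + 3) ∧ I m s' := by
  have hwv : (SketchRAM.forLoop v b body).WritesInt v := Or.inl rfl
  have hwb : ¬ (SketchRAM.forLoop v b body).WritesInt b := by
    simp [SketchRAM.forLoop, Cmd.WritesInt, hbv, hne]
  have key : ∀ j i s', i + j = m → Keeps (SketchRAM.forLoop v b body) s s' →
      s'.ints v [] = i → I i s' → ∃ s'', Runs F κ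
      (.while (.not (.intLe (iv b) (iv v)))
        (.seq body (.intSet (V v) (.intAdd (iv v) (.intLit 1))))) s' s''
          ((body.size + 3) * j + 1) ∧ I m s'' := by
    intro j
    induction j with
    | zero =>
      intro i s' hi hk h1 hI
      have h2 : s'.ints b [] = m := by rw [hk.ints b hwb, hm]
      obtain rfl : i = m := by simpa using hi
      refine ⟨s', Runs.mono (Runs.while_neg hκ ?_) (by omega), hI⟩
      simp [Expr.eval, h1, h2]
    | succ j ih =>
      intro i s' hi hk h1 hIi
      have h2 : s'.ints b [] = m := by rw [hk.ints b hwb, hm]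
      have hrb := Runs.of_loopFree (F := F) hκ hb s'
      have hk2 : Keeps (SketchRAM.forLoop v b body) s (run F body s') :=
        hk.trans (hrb.keeps.mono (fun a h => Or.inr (Or.inl h)) (fun a h => Or.inr (Or.inl h))
          (fun a h => Or.inr (Or.inl h)))
      have hv2 : (run F body s').ints v [] = i := by rw [hrb.keeps.ints v hv, h1]
      have hI' := hI _ _ ((i : ℤ) + 1) (hstep i (by omega) s' hk h1 hIi)
      obtain ⟨s'', hs'', hQ⟩ := ih (i + 1) _ (by omega) (hk2.trans (keeps_setInt hwv))
        (by simp [setInt_V_ints]) hI'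
      have hlf : (Cmd.seq body (.intSet (V v) (.intAdd (iv v) (.intLit 1)))).LoopFree :=
        ⟨hb, trivial⟩
      have hr := Runs.of_loopFree (F := F) hκ hlf s'
      have he : run F (Cmd.seq body (.intSet (V v) (.intAdd (iv v) (.intLit 1)))) s' =
          (run F body s').setInt (V v) ((i : ℤ) + 1) := by
        simp [run, Expr.eval, hv2]
      rw [he] at hr
      refine ⟨s'', Runs.mono (Runs.while_pos hκ ?_ hr hs'') ?_, hQ⟩
      · simp [Expr.eval, h1, h2]; omega
      · simp only [Cmd.size]; ring_nf; omega
  obtain ⟨s', hs', hQ⟩ := key m 0 (s.setInt (V v) 0) (by simp) (keeps_setInt hwv)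
    (by simp [setInt_V_ints]) (hI _ _ _ h0)
  refine ⟨s', Runs.mono (Runs.seq hκ (Runs.of_pure (s' := s.setInt (V v) 0) hκ (fun k => rfl)
    (keeps_setInt rfl)) hs') ?_, hQ⟩
  omega

end Framework

end SketchRAM

/-! ### Nets, and the invariants of the reduced instances -/

namespace MinMaxClustering

variable {d n : ℕ} {σ : Type*} {F : SketchableFamily (Fin n) σ}
  {x : Fin n → EuclideanSpace ℝ (Fin d)}

/-- The optimum is a minimum over finitely many partitions, hence attained; two points of a cluster
are compared through its centre. Optimal clusterings enter the rest of the argument only through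
this diameter bound. -/
theorem exists_optimal_cluster (hF : ∃ P, IsClustering F P) (i : Fin n) :
    ∃ S ∈ F.family, i ∈ S ∧ ∀ j ∈ S, dist (x i) (x j) ≤ 2 * (optRadius F x : ℝ) := by
  have hfin : (price x '' {P | IsClustering F P}).Finite := Set.toFinite _
  obtain ⟨P, hP, hPe⟩ := Set.Nonempty.csInf_mem (s := price x '' {P | IsClustering F P})
    (Set.Nonempty.image _ hF) hfin
  obtain ⟨S, hS, hiS⟩ := P.exists_mem (Finset.mem_univ i)
  have hr : rmin x S ≤ optRadius F x := by
    rw [optRadius, ← hPe]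
    exact Finset.le_sup (f := rmin x) hS
  obtain ⟨c, hc, hce⟩ := Set.Nonempty.csInf_mem (s := enclosingRadius x S '' (S : Set (Fin n)))
    ⟨_, i, hiS, rfl⟩ (Set.toFinite _)
  have hd : ∀ j ∈ S, dist (x j) (x c) ≤ optRadius F x := by
    intro j hj
    have h1 : nndist (x j) (x c) ≤ enclosingRadius x S c :=
      Finset.le_sup (f := fun i => nndist (x i) (x c)) hj
    have h2 : nndist (x j) (x c) ≤ optRadius F x := by
      refine h1.trans ?_
      rw [hce]
      exact hr
    exact_mod_cast h2
  refine ⟨S, hP S hS, hiS, fun j hj => ?_⟩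
  have := dist_triangle_right (x i) (x j) (x c)
  linarith [hd i hiS, hd j hj]

/-- The fibres of `cen` form a clustering. By `h1` each fibre contains its centre, so that `rmin`
may use it. -/
theorem optRadius_le {cen : Fin n → Fin n} {R : ℝ}
    (h1 : ∀ i, cen (cen i) = cen i)
    (h2 : ∀ i, (Finset.univ.filter fun j => cen j = cen i) ∈ F.family)
    (h3 : ∀ i, dist (x i) (x (cen i)) ≤ R) (hR : 0 ≤ R) :
    (optRadius F x : ℝ) ≤ R := by
  classical
  let st : Setoid (Fin n) := Setoid.ker cen
  let P : Finpartition (Finset.univ : Finset (Fin n)) := Finpartition.ofSetoid st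
  have hparts : ∀ S ∈ P.parts, ∃ i, S = Finset.univ.filter fun j => cen j = cen i := by
    intro S hS
    obtain ⟨i, hi⟩ := P.nonempty_of_mem_parts hS
    refine ⟨i, ?_⟩
    rw [← P.part_eq_of_mem hS hi]
    ext j
    rw [Finpartition.mem_part_ofSetoid_iff_rel]
    simp only [Finset.mem_filter, Finset.mem_univ, true_and, st, Setoid.ker_def]
    exact eq_comm
  have hP : IsClustering F P := by
    intro S hS
    obtain ⟨i, rfl⟩ := hparts S hS
    exact h2 i
  lift R to ℝ≥0 using hR
  have h4 : price x P ≤ R := by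
    refine Finset.sup_le fun S hS => ?_
    obtain ⟨i, rfl⟩ := hparts S hS
    have : enclosingRadius x (Finset.univ.filter fun j => cen j = cen i) (cen i) ≤ R := by
      refine Finset.sup_le fun j hj => ?_
      have hj' : cen j = cen i := by simpa using hj
      have := h3 j
      rw [hj'] at this
      exact_mod_cast this
    refine le_trans (csInf_le (OrderBot.bddBelow _) ⟨cen i, ?_, rfl⟩) this
    simp [h1]
  have h5 : optRadius F x ≤ price x P := csInf_le (OrderBot.bddBelow _) ⟨P, hP, rfl⟩
  exact_mod_cast h5.trans h4

/-- With optimum zero, the optimal cluster of `i` would have diameter zero, and so would be a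
singleton, as the points are distinct. -/
theorem optRadius_pos (hF : ∃ P, IsClustering F P) (hx : Function.Injective x) {i : Fin n}
    (hi : {i} ∉ F.family) : 0 < (optRadius F x : ℝ) := by
  refine lt_of_le_of_ne (NNReal.coe_nonneg _) fun h0 => hi ?_
  obtain ⟨S, hS, hiS, hd⟩ := exists_optimal_cluster (x := x) hF i
  refine F.upwardClosed S hS _ fun j hj => ?_
  have := hd j hj
  rw [← h0] at this
  have h : x i = x j := dist_le_zero.1 (by linarith)
  simp [hx h]

/-- `cen` assigns the elements of `W` to a net, in which different points have distance more than
`4 * r`, such that nobody is assigned further than `4 * r`, and whoever has distance at most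
`2 * r` from a net point is assigned to it. -/
structure IsNet (x : Fin n → EuclideanSpace ℝ (Fin d)) (W : List (Fin n)) (r : ℝ)
    (cen : Fin n → Fin n) : Prop where
  cen_mem : ∀ w ∈ W, cen w ∈ W
  cen_cen : ∀ w ∈ W, cen (cen w) = cen w
  dist_le : ∀ w ∈ W, dist (x w) (x (cen w)) ≤ 4 * r
  near : ∀ w ∈ W, ∀ v ∈ W, cen v = v → dist (x w) (x v) ≤ 2 * r → cen w = v
  sep : ∀ v ∈ W, ∀ w ∈ W, cen v = v → cen w = w → v ≠ w → 4 * r < dist (x v) (x w)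

/-- The points whose representative is in `W` and is assigned to `c`. -/
def agg (W : List (Fin n)) (rep cen : Fin n → Fin n) (c : Fin n) : Finset (Fin n) :=
  Finset.univ.filter fun q => rep q ∈ W ∧ cen (rep q) = c

/-- The reduced instances: every point is represented by a point at distance at most `δ`, and the
representatives that are not in `W` have been split off as clusters of their own. -/
structure Reduced (F : SketchableFamily (Fin n) σ) (x : Fin n → EuclideanSpace ℝ (Fin d))
    (W : List (Fin n)) (rep : Fin n → Fin n) (δ : ℝ) : Prop where
  nodup : W.Nodup
  nonneg : 0 ≤ δ
  rep_rep : ∀ q, rep (rep q) = rep q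
  rep_eq : ∀ w ∈ W, rep w = w
  dist_rep : ∀ q, dist (x q) (x (rep q)) ≤ δ
  removed_mem : ∀ q, rep q ∉ W → (Finset.univ.filter fun q' => rep q' = rep q) ∈ F.family
  removed_far : ∀ q, rep q ∉ W → ∀ w ∈ W, 2 * (optRadius F x : ℝ) < dist (x q) (x w)
  total : W ≠ [] → (Finset.univ.filter fun q => rep q ∈ W) ∈ F.family
  sep : ∀ v ∈ W, ∀ w ∈ W, v ≠ w → 3 * δ ≤ 4 * dist (x v) (x w)
  le_opt : δ ≤ 16 * (optRadius F x : ℝ)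

theorem reduced_initial (hn : (Finset.univ : Finset (Fin n)) ∈ F.family) :
    Reduced F x (List.finRange n) id 0 where
  nodup := List.nodup_finRange n
  nonneg := le_rfl
  rep_rep := fun _ => rfl
  rep_eq := fun _ _ => rfl
  dist_rep := fun q => by simp
  removed_mem := fun q hq => absurd (List.mem_finRange _) hq
  removed_far := fun q hq => absurd (List.mem_finRange _) hq
  total := fun _ => by simpa using hn
  sep := fun v _ w _ _ => by rw [mul_zero]; positivity
  le_opt := by positivity

variable {W : List (Fin n)} {rep cen : Fin n → Fin n} {r δ l : ℝ}

/-- Accepted clusters, together with those split off earlier, form a clustering of all points: a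
point reaches its representative within `δ` and then its net point within `4 * r`. -/
theorem optRadius_le_of_success (hW : Reduced F x W rep δ) (hN : IsNet x W r cen) (hr : 0 ≤ r)
    (h : ∀ w ∈ W, agg W rep cen (cen w) ∈ F.family) : (optRadius F x : ℝ) ≤ 4 * r + δ := by
  classical
  have hδ := hW.nonneg
  refine optRadius_le (cen := fun q => if rep q ∈ W then cen (rep q) else rep q) ?_ ?_ ?_
    (by positivity)
  · intro q
    by_cases hq : rep q ∈ W
    · have h1 := hN.cen_mem _ hq
      simp [hq, hW.rep_eq _ h1, h1, hN.cen_cen _ hq]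
    · simp [hq, hW.rep_rep]
  · intro q
    by_cases hq : rep q ∈ W
    · refine F.upwardClosed _ (h _ hq) _ fun q' hq' => ?_
      simp only [agg, Finset.mem_filter, Finset.mem_univ, true_and] at hq' ⊢
      simp [hq, hq'.1, hq'.2]
    · refine F.upwardClosed _ (hW.removed_mem q hq) _ fun q' hq' => ?_
      simp only [Finset.mem_filter, Finset.mem_univ, true_and] at hq' ⊢
      simp [hq, hq']
  · intro q
    have h1 := hW.dist_rep q
    by_cases hq : rep q ∈ W
    · have h2 := hN.dist_le _ hq
      simp only [hq, if_true]
      linarith [dist_triangle (x q) (x (rep q)) (x (cen (rep q)))]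
    · simp only [hq, if_false]
      linarith

/-- The optimal cluster of a net point contains no point split off earlier, since those are too far
away. Its points have representatives within `2 * opt + δ ≤ 2 * r` of the net point, and all of
these are assigned to it. So the net cluster contains a set of the family. -/
theorem agg_mem_of_optRadius_le (hF : ∃ P, IsClustering F P) (hW : Reduced F x W rep δ)
    (hN : IsNet x W r cen) (hr : 2 * (optRadius F x : ℝ) + δ ≤ 2 * r) {w : Fin n} (hw : w ∈ W) :
    agg W rep cen (cen w) ∈ F.family := by
  obtain ⟨S, hS, hcS, hd⟩ := exists_optimal_cluster (x := x) hF (cen w)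
  refine F.upwardClosed S hS _ fun q hq => ?_
  have h1 := hd q hq
  have hc := hN.cen_mem w hw
  have h2 : rep q ∈ W := by
    by_contra h
    have := hW.removed_far q h _ hc
    rw [dist_comm] at this
    linarith
  have h3 : dist (x (rep q)) (x (cen w)) ≤ 2 * r := by
    have := dist_triangle (x (rep q)) (x q) (x (cen w))
    linarith [hW.dist_rep q, dist_comm (x (rep q)) (x q), dist_comm (x q) (x (cen w))]
  simp only [agg, Finset.mem_filter, Finset.mem_univ, true_and]
  exact ⟨h2, hN.near _ h2 _ hc (hN.cen_cen w hw) h3⟩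

theorem lt_of_failure (hF : ∃ P, IsClustering F P) (hW : Reduced F x W rep δ)
    (hN : IsNet x W r cen) (h : ¬ ∀ w ∈ W, agg W rep cen (cen w) ∈ F.family) :
    2 * r < 2 * (optRadius F x : ℝ) + δ := by
  by_contra hr
  exact h fun w hw => agg_mem_of_optRadius_le hF hW hN (not_lt.1 hr) hw

/-- The points of the net. -/
def netList (W : List (Fin n)) (cen : Fin n → Fin n) : List (Fin n) :=
  W.filter fun w => decide (cen w = w)

theorem mem_netList {w : Fin n} : w ∈ netList W cen ↔ w ∈ W ∧ cen w = w := by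
  simp [netList]

open Classical in
-- The errors do not accumulate. From `δ ≤ 4 * l / 3` and `hopt` follows `l < 3 * opt`, so the new
-- error `δ + 4 * l ≤ 16 * l / 3` is below `16 * opt`. Net distances exceed `4 * l`, which is at
-- least `3 / 4` of the new error, so the separation invariant is restored as well.
theorem Reduced.net (hW : Reduced F x W rep δ) (hN : IsNet x W l cen) (hδ : 3 * δ ≤ 4 * l)
    (hl : 0 ≤ l) (hopt : 2 * l < 2 * (optRadius F x : ℝ) + δ) :
    Reduced F x (netList W cen) (fun q => if rep q ∈ W then cen (rep q) else rep q)
      (δ + 4 * l) := by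
  have hδ0 := hW.nonneg
  have hmem : ∀ q, (if rep q ∈ W then cen (rep q) else rep q) ∈ netList W cen ↔ rep q ∈ W := by
    intro q
    by_cases hq : rep q ∈ W
    · simp [hq, mem_netList, hN.cen_mem _ hq, hN.cen_cen _ hq]
    · simp [hq, mem_netList]
  refine ⟨hW.nodup.filter _, by positivity, ?_, ?_, ?_, ?_, ?_, ?_, ?_, ?_⟩
  · intro q
    by_cases hq : rep q ∈ W
    · have h1 := hN.cen_mem _ hq
      simp [hq, hW.rep_eq _ h1, h1, hN.cen_cen _ hq]
    · simp [hq, hW.rep_rep]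
  · intro w hw
    rw [mem_netList] at hw
    simp [hW.rep_eq w hw.1, hw.1, hw.2]
  · intro q
    have h1 := hW.dist_rep q
    by_cases hq : rep q ∈ W
    · have h2 := hN.dist_le _ hq
      simp only [hq, if_true]
      linarith [dist_triangle (x q) (x (rep q)) (x (cen (rep q)))]
    · simp only [hq, if_false]
      linarith
  · intro q hq
    rw [hmem] at hq
    refine F.upwardClosed _ (hW.removed_mem q hq) _ fun q' hq' => ?_
    simp only [Finset.mem_filter, Finset.mem_univ, true_and] at hq' ⊢
    simp [hq, hq']
  · intro q hq w hw
    rw [hmem] at hq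
    exact hW.removed_far q hq w (mem_netList.1 hw).1
  · intro hne
    have hne' : W ≠ [] := by
      rintro rfl
      exact hne rfl
    simpa only [hmem] using hW.total hne'
  · intro v hv w hw hvw
    rw [mem_netList] at hv hw
    linarith [hN.sep v hv.1 w hw.1 hv.2 hw.2 hvw]
  · linarith

theorem fiber_net [∀ q, Decidable (rep q ∈ W)]
    {w : Fin n} (hw : w ∈ netList W cen) :
    (Finset.univ.filter fun q => (if rep q ∈ W then cen (rep q) else rep q) = w) =
      agg W rep cen w := by
  ext q
  rw [mem_netList] at hw
  simp only [agg, Finset.mem_filter, Finset.mem_univ, true_and]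
  by_cases hq : rep q ∈ W
  · simp [hq]
  · simp only [hq, if_false, false_and, iff_false]
    rintro rfl
    exact hq hw.1

/-- The points whose cluster has at least two elements. -/
def pruned (W : List (Fin n)) (cen : Fin n → Fin n) : List (Fin n) :=
  W.filter fun w => decide (2 ≤ (W.filter fun v => decide (cen v = cen w)).length)

theorem two_le_length_filter (hW : W.Nodup) {p : Fin n → Bool} :
    2 ≤ (W.filter p).length ↔ ∃ u ∈ W, ∃ v ∈ W, u ≠ v ∧ p u ∧ p v := by
  have h : (W.filter p).length = (W.filter p).toFinset.card :=
    (List.toFinset_card_of_nodup (hW.filter _)).symm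
  rw [h, Nat.succ_le_iff, Finset.one_lt_card_iff]
  simp only [List.mem_toFinset, List.mem_filter]
  constructor
  · rintro ⟨u, v, ⟨hu, hu'⟩, ⟨hv, hv'⟩, huv⟩
    exact ⟨u, hu, v, hv, huv, hu', hv'⟩
  · rintro ⟨u, hu, v, hv, huv, hu', hv'⟩
    exact ⟨u, v, ⟨hu, hu'⟩, ⟨hv, hv'⟩, huv⟩

theorem mem_pruned (hW : W.Nodup) {w : Fin n} :
    w ∈ pruned W cen ↔ w ∈ W ∧ ∃ u ∈ W, ∃ v ∈ W, u ≠ v ∧ cen u = cen w ∧ cen v = cen w := by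
  simp only [pruned, List.mem_filter, decide_eq_true_eq, two_le_length_filter hW]

theorem eq_of_not_mem_pruned (hW : W.Nodup) {v w : Fin n} (hw : w ∈ W)
    (hw' : w ∉ pruned W cen) (hv : v ∈ W) (h : cen v = cen w) : v = w := by
  by_contra hvw
  exact hw' ((mem_pruned hW).2 ⟨hw, v, hv, w, hw, hvw, h, rfl⟩)

/-- Here `opt ≤ 5 * l / 64` and `δ ≤ l / 64`, so scale `l / 8` is safely above the optimum: `2 * opt
+ δ ≤ 11 * l / 64 < l / 4`. All clusters at that scale lie in the family, and a point alone in its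
cluster is so far from the other points of `W` that no optimal cluster joins what it represents to
them. -/
theorem Reduced.prune (hF : ∃ P, IsClustering F P) (hW : Reduced F x W rep δ)
    (hN : IsNet x W (l / 8) cen) (hδ : 64 * δ ≤ l) (hl : 0 < l)
    (hopt : (optRadius F x : ℝ) ≤ 4 * (l / 64) + δ) :
    Reduced F x (pruned W cen) rep δ := by
  have hsub : ∀ w ∈ pruned W cen, w ∈ W := fun w hw => ((mem_pruned hW.nodup).1 hw).1
  have hagg : ∀ w ∈ W, agg W rep cen (cen w) ∈ F.family := fun w hw =>
    agg_mem_of_optRadius_le hF hW hN (by linarith) hw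
  refine ⟨hW.nodup.filter _, hW.nonneg, hW.rep_rep, fun w hw => hW.rep_eq w (hsub w hw),
    hW.dist_rep, ?_, ?_, ?_, fun v hv w hw => hW.sep v (hsub v hv) w (hsub w hw), hW.le_opt⟩
  · intro q hq
    by_cases hqW : rep q ∈ W
    · refine F.upwardClosed _ (hagg _ hqW) _ fun q' hq' => ?_
      simp only [agg, Finset.mem_filter, Finset.mem_univ, true_and] at hq' ⊢
      exact eq_of_not_mem_pruned hW.nodup hqW hq hq'.1 hq'.2
    · exact hW.removed_mem q hqW
  · intro q hq w hw
    by_cases hqW : rep q ∈ W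
    · have hwW := hsub w hw
      -- The centre belongs to its own cluster, so a singleton cluster consists of its centre. If
      -- `w` had distance at most `l / 4` from it, `w` would be assigned to it.
      have hcq : cen (rep q) = rep q :=
        eq_of_not_mem_pruned hW.nodup hqW hq (hN.cen_mem _ hqW) (hN.cen_cen _ hqW)
      have h1 : ¬ dist (x w) (x (rep q)) ≤ 2 * (l / 8) := by
        intro h
        have h2 := hN.near w hwW _ hqW hcq h
        have h3 := eq_of_not_mem_pruned hW.nodup hqW hq hwW (h2.trans hcq.symm)
        exact hq (h3 ▸ hw)
      have h2 := dist_triangle (x w) (x q) (x (rep q))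
      rw [dist_comm (x w) (x q)] at h2
      linarith [hW.dist_rep q]
    · exact hW.removed_far q hqW w (hsub w hw)
  · intro hne
    obtain ⟨w, hw⟩ := List.exists_mem_of_ne_nil _ hne
    -- Pruning keeps or removes clusters as a whole; one that is kept lies in the family, hence so
    -- does the union of all that are kept.
    obtain ⟨hwW, u, hu, v, hv, huv, h1, h2⟩ := (mem_pruned hW.nodup).1 hw
    refine F.upwardClosed _ (hagg w hwW) _ fun q hq => ?_
    simp only [agg, Finset.mem_filter, Finset.mem_univ, true_and] at hq ⊢
    exact (mem_pruned hW.nodup).2 ⟨hq.1, u, hu, v, hv, huv, h1.trans hq.2.symm, h2.trans hq.2.symm⟩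

/-- With at most one representative left in `W`, the fibres of `rep` are already a clustering. This
is where the field `total` is used. -/
theorem Reduced.optRadius_le_of_length_le_one (hW : Reduced F x W rep δ) (h : W.length ≤ 1) :
    (optRadius F x : ℝ) ≤ δ := by
  refine optRadius_le hW.rep_rep (fun q => ?_) hW.dist_rep hW.nonneg
  by_cases hq : rep q ∈ W
  · refine F.upwardClosed _ (hW.total (List.ne_nil_of_mem hq)) _ fun q' hq' => ?_
    simp only [Finset.mem_filter, Finset.mem_univ, true_and] at hq' ⊢
    obtain ⟨a, rfl⟩ | rfl : (∃ a, W = [a]) ∨ W = [] := by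
      match W, h with
      | [], _ => exact Or.inr rfl
      | [a], _ => exact Or.inl ⟨a, rfl⟩
    · simp only [List.mem_singleton] at hq hq'
      rw [hq, hq']
    · simp at hq
  · exact hW.removed_mem q hq

/-! ### How much a round shrinks the list -/

/-- `nn w` is the distance of `w` from its nearest neighbour in `W`. -/
def IsNearest (x : Fin n → EuclideanSpace ℝ (Fin d)) (W : List (Fin n)) (nn : Fin n → ℝ) : Prop :=
  ∀ w ∈ W, (∀ v ∈ W, v ≠ w → nn w ≤ dist (x w) (x v)) ∧ ∃ v ∈ W, v ≠ w ∧ dist (x w) (x v) = nn w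

theorem exists_isNearest (x : Fin n → EuclideanSpace ℝ (Fin d)) (hW : W.Nodup)
    (h : 2 ≤ W.length) : ∃ nn, IsNearest x W nn := by
  classical
  have : ∀ w : Fin n, ∃ a : ℝ, w ∈ W → (∀ v ∈ W, v ≠ w → a ≤ dist (x w) (x v)) ∧
      ∃ v ∈ W, v ≠ w ∧ dist (x w) (x v) = a := by
    intro w
    by_cases hw : w ∈ W
    · have hne : (W.toFinset.erase w).Nonempty := by
        rw [← Finset.card_pos, Finset.card_erase_of_mem (by simpa using hw),
          List.toFinset_card_of_nodup hW]
        omega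
      obtain ⟨v, hv, hmin⟩ := Finset.exists_min_image _ (fun v => dist (x w) (x v)) hne
      simp only [Finset.mem_erase, List.mem_toFinset] at hv hmin
      exact ⟨_, fun _ => ⟨fun u hu huw => hmin u ⟨huw, hu⟩, v, hv.2, hv.1, rfl⟩⟩
    · exact ⟨0, fun h => absurd h hw⟩
  choose nn hnn using this
  exact ⟨nn, hnn⟩

theorem IsNearest.pos (hx : Function.Injective x) {nn : Fin n → ℝ} (h : IsNearest x W nn)
    {w : Fin n} (hw : w ∈ W) : 0 < nn w := by
  obtain ⟨v, -, hvw, hd⟩ := (h w hw).2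
  rw [← hd]
  exact dist_pos.2 fun h => hvw (hx h).symm

/-- At least half of the points with a neighbour within `l` lie outside the net: such a net point
has its nearest neighbour assigned to it, and that neighbour is not in the net. So `cen` maps the
points outside the net onto these net points. -/
theorem card_add_length_netList (hW : W.Nodup) {nn : Fin n → ℝ} (hnn : IsNearest x W nn)
    (hl : 0 ≤ l) (hN : IsNet x W l cen) :
    (W.toFinset.filter fun q => nn q ≤ l).card + 2 * (netList W cen).length ≤ 2 * W.length := by
  classical
  have h1 : (netList W cen).length = (W.toFinset.filter fun w => cen w = w).card := by
    rw [netList, ← List.toFinset_card_of_nodup (hW.filter _)]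
    congr 1
    ext w
    simp
  have h2 : W.length = W.toFinset.card := (List.toFinset_card_of_nodup hW).symm
  have h3 := Finset.card_filter_add_card_filter_not (s := W.toFinset) (fun w => cen w = w)
  set S := W.toFinset.filter fun q => nn q ≤ l
  have h4 := Finset.card_filter_add_card_filter_not (s := S) (fun w => cen w = w)
  have h5 : (S.filter fun w => ¬ cen w = w).card ≤
      (W.toFinset.filter fun w => ¬ cen w = w).card :=
    Finset.card_le_card (Finset.filter_subset_filter _ (Finset.filter_subset _ _))
  have h6 : (S.filter fun w => cen w = w).card ≤
      (W.toFinset.filter fun w => ¬ cen w = w).card := by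
    refine Finset.card_le_card_of_surjOn cen fun w hw => ?_
    simp only [S, Finset.coe_filter, Finset.mem_filter, List.mem_toFinset, Set.mem_ofPred_eq] at hw
    obtain ⟨⟨hwW, hnw⟩, hcw⟩ := hw
    obtain ⟨v, hv, hvw, hd⟩ := (hnn w hwW).2
    have hcv : cen v = w := hN.near v hv w hwW hcw (by rw [dist_comm]; linarith)
    refine ⟨v, ?_, hcv⟩
    simp only [Finset.coe_filter, List.mem_toFinset, Set.mem_ofPred_eq]
    exact ⟨hv, fun h => hvw (h.symm.trans hcv)⟩
  omega

/-- A point that survives shares its cluster with another point. At scale `l / 8` everyone is within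
`l / 2` of the centre, so either the centre, or another member if the point is itself the centre, is
a neighbour closer than `l`. -/
theorem card_add_length_pruned (hW : W.Nodup) {nn : Fin n → ℝ} (hnn : IsNearest x W nn)
    (hl : 0 < l) (hN : IsNet x W (l / 8) cen) :
    (W.toFinset.filter fun q => l ≤ nn q).card + (pruned W cen).length ≤ W.length := by
  classical
  have hW' : (pruned W cen).Nodup := hW.filter _
  rw [← List.toFinset_card_of_nodup hW', ← List.toFinset_card_of_nodup hW,
    ← Finset.card_union_of_disjoint]
  · refine Finset.card_le_card (Finset.union_subset (Finset.filter_subset _ _) fun w hw => ?_)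
    rw [List.mem_toFinset] at hw ⊢
    exact ((mem_pruned hW).1 hw).1
  · rw [Finset.disjoint_left]
    intro w hw hw'
    simp only [Finset.mem_filter, List.mem_toFinset] at hw
    replace hw' : w ∈ pruned W cen := by simpa using hw'
    obtain ⟨hwW, u, hu, v, hv, huv, h1, h2⟩ := (mem_pruned hW).1 hw'
    have hmin := (hnn w hwW).1
    have key : ∀ v ∈ W, v ≠ w → cen v = cen w → False := by
      intro v hv hvw hc
      by_cases hcw : cen w = w
      · have h3 := hN.dist_le v hv
        rw [hc, hcw, dist_comm] at h3
        linarith [hmin v hv hvw]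
      · linarith [hmin _ (hN.cen_mem w hwW) hcw, hN.dist_le w hwW]
    by_cases huw : u = w
    · exact key v hv (fun h => huv (huw.trans h.symm)) h2
    · exact key u hu huw h1

/-- Every triple has an ordering in which it is sorted by `f`, so at least a sixth of all ordered
triples have their first entry as a median. Counted by this entry, there are as many of them as the
sum of the products of the two ranks, and each product is at most `S.card` times the minimum. Ties
do no harm, as both ranks include equal values. -/
theorem sq_card_le_six_mul_sum_min {ι : Type*} (S : Finset ι) (f : ι → ℝ) :
    S.card ^ 2 ≤ 6 * ∑ p ∈ S, min (S.filter fun q => f q ≤ f p).card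
      (S.filter fun q => f p ≤ f q).card := by
  classical
  rcases S.eq_empty_or_nonempty with rfl | hS
  · simp
  -- Indicator that `p` lies between `a` and `b`; permuting its arguments leaves the total sum
  -- unchanged.
  set g : ι → ι → ι → ℕ := fun p a b => if f a ≤ f p ∧ f p ≤ f b then 1 else 0 with hg
  have hG : ∑ p ∈ S, ∑ a ∈ S, ∑ b ∈ S, g p a b = ∑ p ∈ S,
      (S.filter fun q => f q ≤ f p).card * (S.filter fun q => f p ≤ f q).card := by
    refine Finset.sum_congr rfl fun p _ => ?_
    rw [Finset.card_filter, Finset.card_filter, Finset.sum_mul_sum]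
    refine Finset.sum_congr rfl fun a _ => Finset.sum_congr rfl fun b _ => ?_
    simp only [hg, ite_and, ite_mul, one_mul, zero_mul]
  set T := ∑ p ∈ S, ∑ a ∈ S, ∑ b ∈ S, g p a b with hT
  have e1 : ∑ p ∈ S, ∑ a ∈ S, ∑ b ∈ S, g p b a = T :=
    Finset.sum_congr rfl fun p _ => Finset.sum_comm
  have e2 : ∑ p ∈ S, ∑ a ∈ S, ∑ b ∈ S, g a p b = T := Finset.sum_comm
  have e3 : ∑ p ∈ S, ∑ a ∈ S, ∑ b ∈ S, g a b p = T := by rw [Finset.sum_comm]; exact e1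
  have e4 : ∑ p ∈ S, ∑ a ∈ S, ∑ b ∈ S, g b p a = T := by
    rw [← e2]
    exact Finset.sum_congr rfl fun p _ => Finset.sum_comm
  have e5 : ∑ p ∈ S, ∑ a ∈ S, ∑ b ∈ S, g b a p = T := by
    rw [← e3]
    exact Finset.sum_congr rfl fun p _ => Finset.sum_comm
  have h3 : S.card ^ 3 ≤ 6 * T := by
    have : S.card ^ 3 = ∑ p ∈ S, ∑ a ∈ S, ∑ b ∈ S, 1 := by
      simp only [Finset.sum_const, smul_eq_mul]; ring
    rw [this]
    have h6 : 6 * T = ∑ p ∈ S, ∑ a ∈ S, ∑ b ∈ S,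
        (g p a b + g p b a + g a p b + g a b p + g b p a + g b a p) := by
      simp only [Finset.sum_add_distrib]
      rw [e1, e2, e3, e4, e5, ← hT]; ring
    rw [h6]
    refine Finset.sum_le_sum fun p _ => Finset.sum_le_sum fun a _ => Finset.sum_le_sum fun b _ => ?_
    simp only [hg]
    rcases le_total (f p) (f a) with h1 | h1 <;> rcases le_total (f a) (f b) with h2 | h2 <;>
      rcases le_total (f p) (f b) with h3 | h3 <;> simp [h1, h2, h3] <;> omega
  have h4 : T ≤ S.card * ∑ p ∈ S, min (S.filter fun q => f q ≤ f p).card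
      (S.filter fun q => f p ≤ f q).card := by
    rw [hG, Finset.mul_sum]
    refine Finset.sum_le_sum fun p _ => ?_
    have ha : (S.filter fun q => f q ≤ f p).card ≤ S.card := Finset.card_filter_le _ _
    have hb : (S.filter fun q => f p ≤ f q).card ≤ S.card := Finset.card_filter_le _ _
    rcases le_total (S.filter fun q => f q ≤ f p).card (S.filter fun q => f p ≤ f q).card with h | h
    · rw [min_eq_left h, mul_comm]
      exact Nat.mul_le_mul_right _ hb
    · rw [min_eq_right h]
      exact Nat.mul_le_mul_right _ ha
  have h5 : S.card * S.card ^ 2 ≤ S.card * (6 * ∑ p ∈ S,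
      min (S.filter fun q => f q ≤ f p).card (S.filter fun q => f p ≤ f q).card) := by
    calc S.card * S.card ^ 2 = S.card ^ 3 := by ring
      _ ≤ 6 * T := h3
      _ ≤ _ := by
        refine (Nat.mul_le_mul_left 6 h4).trans (le_of_eq ?_)
        ring
  exact Nat.le_of_mul_le_mul_left h5 (Finset.card_pos.2 hS)

end MinMaxClustering

/-! ### Computing the net with a grid -/

namespace MinMaxClustering

variable {d n : ℕ} {x : Fin n → EuclideanSpace ℝ (Fin d)} {r : ℝ}

/-- The grid cell of a point, for the grid of side length `4 * r / d`. -/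
noncomputable def cell (x : Fin n → EuclideanSpace ℝ (Fin d)) (r : ℝ) (w : Fin n) : Fin d → ℤ :=
  fun j => ⌊x w j / (4 * r / d)⌋

noncomputable def offsets (d : ℕ) : List (Fin d → ℤ) :=
  (Fintype.piFinset fun _ : Fin d => Finset.Icc (-(d : ℤ)) d).toList

/-- The diameter of a cell is at most `√d * (4 * r / d) ≤ 4 * r`. So a cell holds at most one net
point, and one table entry per cell suffices. -/
theorem dist_le_of_cell_eq (hd : 0 < d) (hr : 0 < r) {v w : Fin n}
    (h : cell x r v = cell x r w) : dist (x v) (x w) ≤ 4 * r := by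
  have hd' : (0 : ℝ) < d := by exact_mod_cast hd
  have hd1 : (1 : ℝ) ≤ d := by exact_mod_cast hd
  set a : ℝ := 4 * r / d with ha
  have ha0 : 0 < a := by positivity
  have h1 : ∀ j, dist (x v j) (x w j) ^ 2 ≤ a ^ 2 := by
    intro j
    have h2 := Int.abs_sub_lt_one_of_floor_eq_floor (congrFun h j)
    rw [← sub_div, abs_div, abs_of_pos ha0, div_lt_one ha0] at h2
    rw [Real.dist_eq]
    exact pow_le_pow_left₀ (abs_nonneg _) h2.le 2
  rw [EuclideanSpace.dist_eq]
  refine Real.sqrt_le_iff.2 ⟨by positivity, ?_⟩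
  calc ∑ j, dist (x v j) (x w j) ^ 2 ≤ ∑ _j : Fin d, a ^ 2 := Finset.sum_le_sum fun j _ => h1 j
    _ = d * a ^ 2 := by simp
    _ ≤ d * a ^ 2 * d := le_mul_of_one_le_right (by positivity) hd1
    _ = (4 * r) ^ 2 := by rw [ha]; field_simp

/-- A distance of `4 * r` is `d` side lengths, so cell indices differ by at most `d` in each
coordinate. The number of cells to be searched depends on `d` only. -/
theorem sub_cell_mem_offsets (hd : 0 < d) (hr : 0 < r) {v w : Fin n}
    (h : dist (x w) (x v) ≤ 4 * r) : cell x r v - cell x r w ∈ offsets d := by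
  have hd' : (0 : ℝ) < d := by exact_mod_cast hd
  set a : ℝ := 4 * r / d with ha
  have ha0 : 0 < a := by positivity
  have had : d * a = 4 * r := by rw [ha]; field_simp
  have key : ∀ u u' : Fin n, dist (x u) (x u') ≤ 4 * r → ∀ j,
      cell x r u j - cell x r u' j ≤ d := by
    intro u u' hu j
    have h1 : x u j - x u' j ≤ 4 * r := by
      have := PiLp.norm_apply_le (x u - x u') j
      rw [← dist_eq_norm] at this
      exact (le_abs_self _).trans (this.trans hu)
    have h2 : x u j / a ≤ x u' j / a + (d : ℤ) := by
      rw [div_add' _ _ _ ha0.ne']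
      gcongr
      push_cast
      linarith
    have h3 := Int.floor_mono h2
    rw [Int.floor_add_intCast] at h3
    simp only [cell]
    linarith
  simp only [offsets, Finset.mem_toList, Fintype.mem_piFinset, Finset.mem_Icc, Pi.sub_apply]
  intro j
  have h1 := key w v h j
  have h2 := key v w (by rwa [dist_comm]) j
  omega

/-- One step of the search for the nearest net point. -/
noncomputable def scanStep (x : Fin n → EuclideanSpace ℝ (Fin d)) (r : ℝ)
    (G : (Fin d → ℤ) → Option (Fin n)) (w : Fin n) (acc : Option (Fin n) × ℝ) (o : Fin d → ℤ) :
    Option (Fin n) × ℝ :=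
  match G (cell x r w + o) with
  | none => acc
  | some v => if dist (x w) (x v) ≤ acc.2 then (some v, dist (x w) (x v)) else acc

/-- The nearest among the net points stored in the grid `G` at distance at most `4 * r`. -/
noncomputable def scan (x : Fin n → EuclideanSpace ℝ (Fin d)) (r : ℝ)
    (G : (Fin d → ℤ) → Option (Fin n)) (w : Fin n) : Option (Fin n) :=
  ((offsets d).foldl (scanStep x r G w) (none, 4 * r)).1

/-- Invariant of the search: either no visited cell stores a point within `4 * r`, or the
accumulator holds a nearest one. The initial threshold `4 * r` lets a single comparison serve for
both cases. -/
theorem foldl_scanStep (G : (Fin d → ℤ) → Option (Fin n)) (w : Fin n) (L : List (Fin d → ℤ)) :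
    (L.foldl (scanStep x r G w) (none, 4 * r) = (none, 4 * r) ∧
      ∀ o ∈ L, ∀ u, G (cell x r w + o) = some u → 4 * r < dist (x w) (x u)) ∨
    ∃ v, L.foldl (scanStep x r G w) (none, 4 * r) = (some v, dist (x w) (x v)) ∧
      (∃ z, G z = some v) ∧ dist (x w) (x v) ≤ 4 * r ∧
      ∀ o ∈ L, ∀ u, G (cell x r w + o) = some u → dist (x w) (x v) ≤ dist (x w) (x u) := by
  induction L using List.reverseRecOn with
  | nil => left; simp
  | append_singleton L o ih =>
    simp only [List.foldl_append, List.foldl_cons, List.foldl_nil, List.mem_append,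
      List.mem_singleton]
    rcases ih with ⟨h, hL⟩ | ⟨v, h, hz, hv, hL⟩
    · rw [h]
      rcases hG : G (cell x r w + o) with _ | u
      · left
        refine ⟨by simp [scanStep, hG], ?_⟩
        rintro o' (ho' | rfl) u hu
        · exact hL o' ho' u hu
        · simp [hG] at hu
      · by_cases hd : dist (x w) (x u) ≤ 4 * r
        · right
          refine ⟨u, by simp [scanStep, hG, hd], ⟨_, hG⟩, hd, ?_⟩
          rintro o' (ho' | rfl) u' hu'
          · exact hd.trans (hL o' ho' u' hu').le
          · rw [hG] at hu'
            cases hu'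
            exact le_rfl
        · left
          refine ⟨by simp [scanStep, hG, hd], ?_⟩
          rintro o' (ho' | rfl) u' hu'
          · exact hL o' ho' u' hu'
          · rw [hG] at hu'
            cases hu'
            exact not_le.1 hd
    · rw [h]
      right
      rcases hG : G (cell x r w + o) with _ | u
      · refine ⟨v, by simp [scanStep, hG], hz, hv, ?_⟩
        rintro o' (ho' | rfl) u hu
        · exact hL o' ho' u hu
        · simp [hG] at hu
      · by_cases hd : dist (x w) (x u) ≤ dist (x w) (x v)
        · refine ⟨u, by simp [scanStep, hG, hd], ⟨_, hG⟩, hd.trans hv, ?_⟩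
          rintro o' (ho' | rfl) u' hu'
          · exact hd.trans (hL o' ho' u' hu')
          · rw [hG] at hu'
            cases hu'
            exact le_rfl
        · refine ⟨v, by simp [scanStep, hG, hd], hz, hv, ?_⟩
          rintro o' (ho' | rfl) u' hu'
          · exact hL o' ho' u' hu'
          · rw [hG] at hu'
            cases hu'
            exact (not_le.1 hd).le

/-- Every net point is stored in its cell. -/
def IsGrid (x : Fin n → EuclideanSpace ℝ (Fin d)) (r : ℝ)
    (G : (Fin d → ℤ) → Option (Fin n)) : Prop :=
  ∀ z v, G z = some v → cell x r v = z

variable {G : (Fin d → ℤ) → Option (Fin n)}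

theorem lt_dist_of_scan_eq_none (hd : 0 < d) (hr : 0 < r) (hG : IsGrid x r G) {w : Fin n}
    (h : scan x r G w = none) {u : Fin n} {z : Fin d → ℤ} (hu : G z = some u) :
    4 * r < dist (x w) (x u) := by
  by_contra hle
  have hz := hG z u hu
  rcases foldl_scanStep (x := x) (r := r) G w (offsets d) with ⟨-, h2⟩ | ⟨v, h1, -⟩
  · exact hle (h2 _ (sub_cell_mem_offsets hd hr (not_lt.1 hle)) u
      (by rw [add_sub_cancel, hz, hu]))
  · rw [scan, h1] at h
    simp at h

theorem scan_eq_some (hd : 0 < d) (hr : 0 < r) (hG : IsGrid x r G) {w v : Fin n}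
    (h : scan x r G w = some v) : (∃ z, G z = some v) ∧ dist (x w) (x v) ≤ 4 * r ∧
      ∀ u z, G z = some u → dist (x w) (x v) ≤ dist (x w) (x u) := by
  rcases foldl_scanStep (x := x) (r := r) G w (offsets d) with ⟨h1, -⟩ | ⟨v', h1, h2, h3, h4⟩
  · rw [scan, h1] at h
    simp at h
  · rw [scan, h1] at h
    cases h
    refine ⟨h2, h3, fun u z hu => ?_⟩
    by_contra hlt
    refine hlt (h4 _ (sub_cell_mem_offsets hd hr ((not_le.1 hlt).le.trans h3)) u ?_)
    rw [add_sub_cancel, hG z u hu, hu]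

open Classical in
/-- Insert a point into the net unless it is close to a net point. -/
noncomputable def gridStep (x : Fin n → EuclideanSpace ℝ (Fin d)) (r : ℝ)
    (G : (Fin d → ℤ) → Option (Fin n)) (w : Fin n) : (Fin d → ℤ) → Option (Fin n) :=
  if scan x r G w = none then Function.update G (cell x r w) (some w) else G

/-- The greedily chosen net. -/
noncomputable def netGrid (x : Fin n → EuclideanSpace ℝ (Fin d)) (r : ℝ) (W : List (Fin n)) :
    (Fin d → ℤ) → Option (Fin n) :=
  W.foldl (gridStep x r) fun _ => none

/-- A point is inserted only if no stored point is within `4 * r`. Its cell is then empty, as cells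
have small diameter, so insertion never overwrites a net point. -/
theorem netGrid_spec (hd : 0 < d) (hr : 0 < r) (W : List (Fin n)) :
    IsGrid x r (netGrid x r W) ∧ (∀ z v, netGrid x r W z = some v → v ∈ W) ∧
    (∀ z v z' v', netGrid x r W z = some v → netGrid x r W z' = some v' → v ≠ v' →
      4 * r < dist (x v) (x v')) ∧
    ∀ w ∈ W, ∃ z v, netGrid x r W z = some v ∧ dist (x w) (x v) ≤ 4 * r := by
  classical
  induction W using List.reverseRecOn with
  | nil => simp [netGrid, IsGrid]
  | append_singleton W w ih =>
    obtain ⟨h1, h2, h3, h4⟩ := ih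
    have hstep : netGrid x r (W ++ [w]) = gridStep x r (netGrid x r W) w := by
      simp [netGrid]
    rw [hstep]
    set G := netGrid x r W
    by_cases hs : scan x r G w = none
    · have hfar := fun u z => lt_dist_of_scan_eq_none hd hr h1 (w := w) hs (u := u) (z := z)
      have hG : gridStep x r G w = Function.update G (cell x r w) (some w) := by
        rw [gridStep, if_pos hs]
      have hcell : G (cell x r w) = none := by
        rcases h : G (cell x r w) with _ | u
        · rfl
        · have h5 := hfar u _ h
          have h6 := dist_le_of_cell_eq hd hr (h1 _ _ h)
          rw [dist_comm] at h6
          linarith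
      have hval : ∀ z v, gridStep x r G w z = some v → (z = cell x r w ∧ v = w) ∨ G z = some v := by
        intro z v hv
        rw [hG, Function.update_apply] at hv
        split_ifs at hv with hz
        · left; exact ⟨hz, by cases hv; rfl⟩
        · exact Or.inr hv
      have hkeep : ∀ z v, G z = some v → gridStep x r G w z = some v := by
        intro z v hv
        rw [hG, Function.update_of_ne]
        · exact hv
        · rintro rfl
          rw [hcell] at hv
          cases hv
      refine ⟨?_, ?_, ?_, ?_⟩
      · intro z v hv
        rcases hval z v hv with ⟨rfl, rfl⟩ | h
        · rfl
        · exact h1 z v h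
      · intro z v hv
        rcases hval z v hv with ⟨rfl, rfl⟩ | h
        · simp
        · simp [h2 z v h]
      · intro z v z' v' hv hv' hne
        rcases hval z v hv with ⟨rfl, rfl⟩ | h <;> rcases hval z' v' hv' with ⟨rfl, rfl⟩ | h'
        · exact absurd rfl hne
        · exact hfar _ _ h'
        · rw [dist_comm]; exact hfar _ _ h
        · exact h3 z v z' v' h h' hne
      · intro u hu
        rcases List.mem_append.1 hu with hu | hu
        · obtain ⟨z, v, hv, hd⟩ := h4 u hu
          exact ⟨z, v, hkeep z v hv, hd⟩
        · obtain rfl : u = w := by simpa using hu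
          exact ⟨cell x r u, u, by rw [hG, Function.update_self], by simp; positivity⟩
    · have hG : gridStep x r G w = G := by rw [gridStep, if_neg hs]
      rw [hG]
      refine ⟨h1, fun z v hv => by simp [h2 z v hv], h3, fun u hu => ?_⟩
      rcases List.mem_append.1 hu with hu | hu
      · exact h4 u hu
      · obtain rfl : u = w := by simpa using hu
        obtain ⟨v, hv⟩ := Option.ne_none_iff_exists'.1 hs
        obtain ⟨⟨z, hz⟩, hd', -⟩ := scan_eq_some hd hr h1 hv
        exact ⟨z, v, hz, hd'⟩

/-- The net point that `w` is assigned to. -/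
noncomputable def netCenter (x : Fin n → EuclideanSpace ℝ (Fin d)) (r : ℝ) (W : List (Fin n))
    (w : Fin n) : Fin n :=
  (scan x r (netGrid x r W) w).getD w

theorem scan_netGrid (hd : 0 < d) (hr : 0 < r) {W : List (Fin n)} {w : Fin n} (hw : w ∈ W) :
    scan x r (netGrid x r W) w = some (netCenter x r W w) := by
  obtain ⟨h1, -, -, h4⟩ := netGrid_spec (x := x) hd hr W
  rcases h : scan x r (netGrid x r W) w with _ | v
  · obtain ⟨z, v, hv, hd'⟩ := h4 w hw
    have := lt_dist_of_scan_eq_none hd hr h1 h hv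
    linarith
  · simp [netCenter, h]

/-- Separation makes the nearest net point unambiguous where it matters: if `w` is within `2 * r` of
the net point `v` but has another nearest one, these two would be within `4 * r` of each other. -/
theorem isNet_netCenter (hd : 0 < d) (hr : 0 < r) (W : List (Fin n)) :
    IsNet x W r (netCenter x r W) := by
  obtain ⟨h1, h2, h3, h4⟩ := netGrid_spec (x := x) hd hr W
  have hs := fun w (hw : w ∈ W) => scan_eq_some hd hr h1 (scan_netGrid (x := x) hd hr hw)
  have hself : ∀ z v, netGrid x r W z = some v → netCenter x r W v = v := by
    intro z v hv
    obtain ⟨⟨z', hz'⟩, -, hmin⟩ := hs v (h2 z v hv)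
    by_contra hne
    have h5 := h3 z v z' _ hv hz' (Ne.symm hne)
    have h6 := hmin v z hv
    rw [dist_self] at h6
    linarith
  have hstored : ∀ v ∈ W, netCenter x r W v = v → ∃ z, netGrid x r W z = some v := by
    intro v hv h
    obtain ⟨hz, -⟩ := hs v hv
    rwa [h] at hz
  refine ⟨?_, ?_, ?_, ?_, ?_⟩
  · intro w hw
    obtain ⟨⟨z, hz⟩, -⟩ := hs w hw
    exact h2 z _ hz
  · intro w hw
    obtain ⟨⟨z, hz⟩, -⟩ := hs w hw
    exact hself z _ hz
  · intro w hw
    exact (hs w hw).2.1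
  · intro w hw v hv hcv hdist
    obtain ⟨z', hz'⟩ := hstored v hv hcv
    obtain ⟨⟨z, hz⟩, -, hmin⟩ := hs w hw
    by_contra hne
    have h5 := h3 z _ z' v hz hz' hne
    have h6 := hmin v z' hz'
    have := dist_triangle_left (x (netCenter x r W w)) (x v) (x w)
    linarith
  · intro v hv w hw hcv hcw hne
    obtain ⟨z, hz⟩ := hstored v hv hcv
    obtain ⟨z', hz'⟩ := hstored w hw hcw
    exact h3 z v z' w hz hz' hne

end MinMaxClustering

/-! ### The clustering procedure as a program -/

namespace SketchRAM

open MinMaxClustering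

section Store

variable {α : Type*} [DecidableEq α] {σ : Type*}

@[simp] theorem setInt_ints (s : Store σ) (l : Loc) (v : ℤ) (a : ℕ) (k : List ℤ) :
    (s.setInt l v).ints a k = if a = l.table ∧ k = l.eval s then v else s.ints a k := by
  simp [Store.setInt, update_apply]

@[simp] theorem setInt_reals (s : Store σ) (l : Loc) (v : ℤ) : (s.setInt l v).reals = s.reals := rfl

@[simp] theorem setInt_sketches (s : Store σ) (l : Loc) (v : ℤ) :
    (s.setInt l v).sketches = s.sketches := rfl

@[simp] theorem setReal_reals (s : Store σ) (l : Loc) (v : ℝ) (a : ℕ) (k : List ℤ) :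
    (s.setReal l v).reals a k = if a = l.table ∧ k = l.eval s then v else s.reals a k := by
  simp [Store.setReal, update_apply]

@[simp] theorem setReal_ints (s : Store σ) (l : Loc) (v : ℝ) : (s.setReal l v).ints = s.ints := rfl

@[simp] theorem setReal_sketches (s : Store σ) (l : Loc) (v : ℝ) :
    (s.setReal l v).sketches = s.sketches := rfl

@[simp] theorem setSketch_sketches (s : Store σ) (l : Loc) (v : σ) (a : ℕ) (k : List ℤ) :
    (s.setSketch l v).sketches a k =
      if a = l.table ∧ k = l.eval s then v else s.sketches a k := by
  simp [Store.setSketch, update_apply]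

@[simp] theorem setSketch_ints (s : Store σ) (l : Loc) (v : σ) :
    (s.setSketch l v).ints = s.ints := rfl

@[simp] theorem setSketch_reals (s : Store σ) (l : Loc) (v : σ) :
    (s.setSketch l v).reals = s.reals := rfl

@[simp] theorem getSketch_eq (s : Store σ) (l : Loc) :
    s.getSketch l = s.sketches l.table (l.eval s) := rfl

theorem keeps_run (F : SketchableFamily α σ) {c : Cmd} (hc : c.LoopFree) (s : Store σ) :
    Keeps c s (run F c s) :=
  (Runs.of_loopFree (κ := 1) le_rfl hc s).keeps

theorem Runs.intSet {F : SketchableFamily α σ} {κ : ℕ} (hκ : 1 ≤ κ) {s : Store σ} {l : Loc}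
    {p : Expr .int} {v : ℤ} (h : p.eval s = v) :
    Runs F κ (.intSet l p) s (s.setInt l v) 1 := by
  subst h
  exact Runs.of_loopFree hκ (c := .intSet l p) trivial s

theorem Runs.realSet {F : SketchableFamily α σ} {κ : ℕ} (hκ : 1 ≤ κ) {s : Store σ} {l : Loc}
    {p : Expr .real} {v : ℝ} (h : p.eval s = v) :
    Runs F κ (.realSet l p) s (s.setReal l v) 1 := by
  subst h
  exact Runs.of_loopFree hκ (c := .realSet l p) trivial s

end Store

variable {d n : ℕ} {σ : Type*} {F : SketchableFamily (Fin n) σ}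
  {x : Fin n → EuclideanSpace ℝ (Fin d)} {ε r : ℝ}

/-- The integer that represents a point. -/
def pt (i : Fin n) : ℤ := ((i : ℕ) : ℤ)

@[simp] theorem pt_inj {i j : Fin n} : pt i = pt j ↔ i = j := by
  simp [pt, Fin.ext_iff]

theorem pt_nonneg (i : Fin n) : 0 ≤ pt i := by simp [pt]

/-- The integer that represents an optional point. -/
def enc : Option (Fin n) → ℤ
  | none => 0
  | some i => pt i + 1

/-! ### The program -/

/-- Use of the memory. Integers: `1` centres, `2` loop counter, `3` current point, `4` best net
point, `5` content of the inspected cell, `6` stamp, `7` and `8` length and entries of the current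
list, `9` grid, `10` cluster sizes, `11` success flag, `12` oracle answer, `13` write position, `14`
random point, `15` flag for the end of the search. Reals: `3` the scale `r`, `4` best distance, `5`
the nearest-neighbour distance `l`, `6` the error `δ`, `7` the scale found, `8` side length.
Sketches: `1` represented sets, `2` clusters, `3` the empty set. Optional points are stored shifted
by one, so that the default content `0` of the grid means an empty cell. Each clustering uses a new
stamp as the first entry of the grid keys, so the grid never has to be cleared. -/
def coordE (q : Expr .int) (j : ℕ) : Expr .real := .realGet 1 ![q, .intLit j]

/-- The distance of two points. -/
def distE (d : ℕ) (a b : Expr .int) : Expr .real :=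
  .sqrt ((List.finRange d).foldr (fun (j : Fin d) e => .realAdd
    (.realMul (.realSub (coordE a j) (coordE b j)) (.realSub (coordE a j) (coordE b j))) e)
    (.ofInt (.intLit 0)))

/-- The key of the cell at offset `o` from the cell of the current point. -/
def keyE (d : ℕ) (o : Fin d → ℤ) : Fin (d + 1) → Expr .int :=
  Fin.cons (iv 6) fun j =>
    .intAdd (.floor (.realDiv (coordE (iv 3) j) (rv 8))) (.intLit (o j))

def scanOffset (d : ℕ) (o : Fin d → ℤ) : Cmd :=
  .seq (.intSet (V 5) (.intGet 9 (keyE d o)))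
    (.ite (.and (.intLe (.intLit 1) (iv 5))
        (.realLe (distE d (iv 3) (.intSub (iv 5) (.intLit 1))) (rv 4)))
      (.seq (.realSet (V 4) (distE d (iv 3) (.intSub (iv 5) (.intLit 1))))
        (.intSet (V 4) (iv 5)))
      .skip)

/-- The search over the offsets is unrolled into the program text; this keeps the loop bodies
loop-free, with a size that depends on `d` alone. -/
def scanOffsets (d : ℕ) (L : List (Fin d → ℤ)) : Cmd :=
  L.foldr (fun o c => .seq (scanOffset d o) c) .skip

/-- Search for the net point that is nearest to the current point. -/
noncomputable def scanCmd (d : ℕ) : Cmd :=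
  .seq (.intSet (V 4) (.intLit 0))
    (.seq (.realSet (V 4) (.realMul (.ofInt (.intLit 4)) (rv 3))) (scanOffsets d (offsets d)))

/-- Choose the net. -/
noncomputable def netBody (d : ℕ) : Cmd :=
  .seq (.intSet (V 3) (ia 8 (iv 2)))
    (.seq (.intSet (A 10 (iv 3)) (.intLit 0))
      (.seq (.copy (A 2 (iv 3)) (V 3))
        (.seq (scanCmd d)
          (.ite (.intLe (iv 4) (.intLit 0))
            (.intSet ⟨9, keyE d 0⟩ (.intAdd (iv 3) (.intLit 1))) .skip))))

/-- Assign the points to the net points. -/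
noncomputable def assignBody (d : ℕ) : Cmd :=
  .seq (.intSet (V 3) (ia 8 (iv 2)))
    (.seq (scanCmd d)
      (.seq (.intSet (V 4) (.intSub (iv 4) (.intLit 1)))
        (.seq (.intSet (A 1 (iv 3)) (iv 4))
          (.seq (.combine (A 2 (iv 4)) (A 2 (iv 4)) (A 1 (iv 3)))
            (.intSet (A 10 (iv 4)) (.intAdd (ia 10 (iv 4)) (.intLit 1)))))))

/-- Query the oracle for the clusters. -/
def queryBody : Cmd :=
  .seq (.query (V 12) (A 2 (ia 1 (ia 8 (iv 2)))))
    (.ite (.intLe (iv 12) (.intLit 0)) (.intSet (V 11) (.intLit 0)) .skip)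

/-- Cluster the current points with the radius in the real variable `3`. -/
noncomputable def clusterCmd (d : ℕ) : Cmd :=
  .seq (.intSet (V 6) (.intAdd (iv 6) (.intLit 1)))
    (.seq (.realSet (V 8) (.realDiv (.realMul (.ofInt (.intLit 4)) (rv 3)) (.ofInt (.intLit d))))
      (.seq (forLoop 2 7 (netBody d))
        (.seq (forLoop 2 7 (assignBody d))
          (.seq (.intSet (V 11) (.intLit 1)) (forLoop 2 7 queryBody)))))

/-! ### Correctness of the procedure for clustering -/

@[simp] theorem coordE_eval (s : Store σ) (q : Expr .int) (j : ℕ) :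
    (coordE q j).eval s = s.reals 1 [q.eval s, (j : ℤ)] := by
  simp [coordE, Expr.eval]

theorem distE_eval {s : Store σ}
    (hc : ∀ (i : Fin n) (j : Fin d), s.reals 1 [pt i, ((j : ℕ) : ℤ)] = x i j)
    {a b : Expr .int} {v w : Fin n} (ha : a.eval s = pt v) (hb : b.eval s = pt w) :
    (distE d a b).eval s = dist (x v) (x w) := by
  have h : ∀ L : List (Fin d), (L.foldr (fun (j : Fin d) e => Expr.realAdd
      (.realMul (.realSub (coordE a j) (coordE b j)) (.realSub (coordE a j) (coordE b j))) e)
      (.ofInt (.intLit 0))).eval s = (L.map fun j => dist (x v j) (x w j) ^ 2).sum := by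
    intro L
    induction L with
    | nil => simp [Expr.eval]
    | cons j L ih =>
      simp only [List.foldr_cons, Expr.eval, coordE_eval, ha, hb, hc, List.map_cons,
        List.sum_cons, ih]
      rw [Real.dist_eq, sq_abs]
      ring
  rw [distE, Expr.eval, h, EuclideanSpace.dist_eq, ← Fin.sum_univ_def]

/-- The current point is `q`, and the net is stored in the grid `G`. -/
structure ScanEnv (x : Fin n → EuclideanSpace ℝ (Fin d)) (r : ℝ)
    (G : (Fin d → ℤ) → Option (Fin n)) (q : Fin n) (s : Store σ) : Prop where
  coord : ∀ (i : Fin n) (j : Fin d), s.reals 1 [pt i, ((j : ℕ) : ℤ)] = x i j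
  point : s.ints 3 [] = pt q
  radius : s.reals 3 [] = r
  side : s.reals 8 [] = 4 * r / d
  grid : ∀ z, s.ints 9 (s.ints 6 [] :: List.ofFn z) = enc (G z)

theorem ScanEnv.of_keeps {c : Cmd} {G : (Fin d → ℤ) → Option (Fin n)} {q : Fin n}
    {s s' : Store σ} (h : ScanEnv x r G q s) (hk : Keeps c s s') (h3 : ¬ c.WritesInt 3)
    (h6 : ¬ c.WritesInt 6) (h9 : ¬ c.WritesInt 9) (k1 : ¬ c.WritesReal 1)
    (k3 : ¬ c.WritesReal 3) (k8 : ¬ c.WritesReal 8) : ScanEnv x r G q s' := by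
  refine ⟨?_, ?_, ?_, ?_, ?_⟩
  · rw [hk.reals 1 k1]; exact h.coord
  · rw [hk.ints 3 h3]; exact h.point
  · rw [hk.reals 3 k3]; exact h.radius
  · rw [hk.reals 8 k8]; exact h.side
  · rw [hk.ints 9 h9, hk.ints 6 h6]; exact h.grid

theorem ScanEnv.key_eval {G : (Fin d → ℤ) → Option (Fin n)} {q : Fin n}
    {s : Store σ} (h : ScanEnv x r G q s) (o : Fin d → ℤ) :
    (List.ofFn fun j => (keyE d o j).eval s) = s.ints 6 [] :: List.ofFn (cell x r q + o) := by
  rw [List.ofFn_succ]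
  simp only [keyE, Fin.cons_zero, Fin.cons_succ, iv_eval, Expr.eval, coordE_eval, rv_eval, h.point,
    h.side, h.coord]
  rfl

theorem scanOffset_loopFree (o : Fin d → ℤ) : (scanOffset d o).LoopFree := by
  simp [scanOffset, Cmd.LoopFree]

/-- The program simulates `scanStep`: integer variable `4` and real variable `4` together hold the
accumulator. -/
theorem run_scanOffset {G : (Fin d → ℤ) → Option (Fin n)} {q : Fin n} {s : Store σ}
    (h : ScanEnv x r G q s) (o : Fin d → ℤ) {acc : Option (Fin n) × ℝ}
    (h1 : s.ints 4 [] = enc acc.1) (h2 : s.reals 4 [] = acc.2) :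
    ScanEnv x r G q (run F (scanOffset d o) s) ∧
      (run F (scanOffset d o) s).ints 4 [] = enc (scanStep x r G q acc o).1 ∧
      (run F (scanOffset d o) s).reals 4 [] = (scanStep x r G q acc o).2 := by
  constructor
  · refine h.of_keeps (keeps_run F (scanOffset_loopFree o) s) ?_ ?_ ?_ ?_ ?_ ?_ <;>
      simp [scanOffset, Cmd.WritesInt, Cmd.WritesReal]
  set s1 := s.setInt (V 5) (enc (G (cell x r q + o))) with hs1
  have hk1 : ScanEnv x r G q s1 := by
    refine h.of_keeps (c := scanOffset d o) (keeps_setInt ?_) ?_ ?_ ?_ ?_ ?_ ?_ <;>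
      simp [scanOffset, Cmd.WritesInt, Cmd.WritesReal]
  have hrun : run F (scanOffset d o) s = run F
      (.ite (.and (.intLe (.intLit 1) (iv 5))
        (.realLe (distE d (iv 3) (.intSub (iv 5) (.intLit 1))) (rv 4)))
      (.seq (.realSet (V 4) (distE d (iv 3) (.intSub (iv 5) (.intLit 1))))
        (.intSet (V 4) (iv 5)))
      .skip) s1 := by
    rw [hs1, scanOffset, run, run, Expr.eval, h.key_eval, h.grid]
  have e4 : s1.ints 4 [] = enc acc.1 := by simp [hs1, h1]
  have e4' : s1.reals 4 [] = acc.2 := by simp [hs1, h2]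
  have e5 : s1.ints 5 [] = enc (G (cell x r q + o)) := by simp [hs1]
  rw [hrun]
  rcases hG : G (cell x r q + o) with _ | v
  · rw [hG] at e5
    simp [run, Expr.eval, scanStep, hG, e5, enc, e4, e4']
  · rw [hG] at e5
    have hd : (distE d (iv 3) (.intSub (iv 5) (.intLit 1))).eval s1 = dist (x q) (x v) := by
      refine distE_eval hk1.coord (by simpa using hk1.point) ?_
      simp [Expr.eval, e5, enc]
    have hv := pt_nonneg v
    by_cases hle : dist (x q) (x v) ≤ acc.2
    · simp [run, Expr.eval, scanStep, hG, e5, enc, e4', hle, hd, hv]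
    · simp [run, Expr.eval, scanStep, hG, enc, e4, e4', hle, hd]

theorem run_scanOffsets {G : (Fin d → ℤ) → Option (Fin n)} {q : Fin n} (L : List (Fin d → ℤ))
    {s : Store σ} (h : ScanEnv x r G q s) {acc : Option (Fin n) × ℝ}
    (h1 : s.ints 4 [] = enc acc.1) (h2 : s.reals 4 [] = acc.2) :
    (run F (scanOffsets d L) s).ints 4 [] = enc (L.foldl (scanStep x r G q) acc).1 := by
  induction L generalizing s acc with
  | nil => simpa [scanOffsets, run] using h1
  | cons o L ih =>
    obtain ⟨h3, h4, h5⟩ := run_scanOffset (F := F) h o h1 h2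
    exact ih h3 h4 h5

@[simp] theorem scanCmd_loopFree (d : ℕ) : (scanCmd d).LoopFree := by
  have : ∀ L, (scanOffsets d L).LoopFree := by
    intro L
    induction L with
    | nil => trivial
    | cons o L ih => exact ⟨scanOffset_loopFree o, ih⟩
  exact ⟨trivial, trivial, this _⟩

@[simp] theorem scanCmd_not_writesInt (d : ℕ) {a : ℕ} (h4 : a ≠ 4) (h5 : a ≠ 5) :
    ¬ (scanCmd d).WritesInt a := by
  have : ∀ L, ¬ (scanOffsets d L).WritesInt a := by
    intro L
    induction L with
    | nil => exact id
    | cons o L ih =>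
      rintro (h | h)
      · simp [scanOffset, Cmd.WritesInt, h4, h5] at h
      · exact ih h
  simp [scanCmd, Cmd.WritesInt, h4, this]

@[simp] theorem scanCmd_not_writesReal (d : ℕ) {a : ℕ} (h4 : a ≠ 4) :
    ¬ (scanCmd d).WritesReal a := by
  have : ∀ L, ¬ (scanOffsets d L).WritesReal a := by
    intro L
    induction L with
    | nil => exact id
    | cons o L ih =>
      rintro (h | h)
      · simp [scanOffset, Cmd.WritesReal, h4] at h
      · exact ih h
  simp [scanCmd, Cmd.WritesReal, h4, this]

@[simp] theorem scanCmd_not_writesSketch (d : ℕ) (a : ℕ) : ¬ (scanCmd d).WritesSketch a := by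
  have : ∀ L, ¬ (scanOffsets d L).WritesSketch a := by
    intro L
    induction L with
    | nil => exact id
    | cons o L ih =>
      rintro (h | h)
      · simp [scanOffset, Cmd.WritesSketch] at h
      · exact ih h
  simp [scanCmd, Cmd.WritesSketch, this]

theorem run_scanCmd {G : (Fin d → ℤ) → Option (Fin n)} {q : Fin n} {s : Store σ}
    (h : ScanEnv x r G q s) :
    (run F (scanCmd d) s).ints 4 [] = enc (scan x r G q) := by
  have hr : run F (scanCmd d) s =
      run F (scanOffsets d (offsets d)) ((s.setInt (V 4) 0).setReal (V 4) (4 * r)) := by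
    simp [scanCmd, run, Expr.eval, h.radius]
  rw [hr]
  refine run_scanOffsets (acc := (none, 4 * r)) (offsets d) ?_ (by simp [enc]) (by simp)
  have h4 : Keeps (scanCmd d) s ((s.setInt (V 4) 0).setReal (V 4) (4 * r)) :=
    (keeps_setInt (c := scanCmd d) (Or.inl rfl)).trans
      (keeps_setReal (c := scanCmd d) (Or.inr (Or.inl rfl)))
  exact h.of_keeps h4 (by simp) (by simp) (by simp) (by simp) (by simp) (by simp)

end SketchRAM

/-! ### Correctness and running time of the clustering loops -/

namespace SketchRAM

open MinMaxClustering

variable {d n : ℕ} {σ : Type*} {F : SketchableFamily (Fin n) σ}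
  {x : Fin n → EuclideanSpace ℝ (Fin d)} {ε r : ℝ} {κ : ℕ}

/-- The tables that hold the input. -/
structure HasInput (F : SketchableFamily (Fin n) σ) (x : Fin n → EuclideanSpace ℝ (Fin d)) (ε : ℝ)
    (s : Store σ) : Prop where
  card : s.ints 0 [] = n
  eps : s.reals 0 [] = ε
  coord : ∀ (i : Fin n) (j : Fin d), s.reals 1 [pt i, ((j : ℕ) : ℤ)] = x i j
  sketch : ∀ i : Fin n, s.sketches 0 [pt i] = F.sketch {i}
  empty : s.sketches 3 [] = F.sketch ∅

/-- The memory holds the list `W` of points, together with the sketches of the sets of the points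
that they represent. -/
structure HoldsList (F : SketchableFamily (Fin n) σ) (W : List (Fin n)) (rep : Fin n → Fin n)
    (s : Store σ) : Prop where
  len : s.ints 7 [] = W.length
  idx : ∀ (i : ℕ) (h : i < W.length), s.ints 8 [(i : ℤ)] = pt W[i]
  sketch : ∀ w ∈ W, s.sketches 1 [pt w] = F.sketch (Finset.univ.filter fun q => rep q = w)

/-- The hash tables for future stamps are empty. -/
def Fresh (s : Store σ) : Prop := ∀ t, s.ints 6 [] < t → ∀ k, s.ints 9 (t :: k) = 0

variable {W : List (Fin n)} {rep : Fin n → Fin n}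

theorem HasInput.of_keeps {c : Cmd} {s s' : Store σ} (h : HasInput F x ε s) (hk : Keeps c s s')
    (h0 : ¬ c.WritesInt 0) (k0 : ¬ c.WritesReal 0) (k1 : ¬ c.WritesReal 1)
    (l0 : ¬ c.WritesSketch 0) (l3 : ¬ c.WritesSketch 3) : HasInput F x ε s' := by
  refine ⟨?_, ?_, ?_, ?_, ?_⟩
  · rw [hk.ints 0 h0]; exact h.card
  · rw [hk.reals 0 k0]; exact h.eps
  · rw [hk.reals 1 k1]; exact h.coord
  · rw [hk.sketches 0 l0]; exact h.sketch
  · rw [hk.sketches 3 l3]; exact h.empty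

theorem HoldsList.of_keeps {c : Cmd} {s s' : Store σ} (h : HoldsList F W rep s)
    (hk : Keeps c s s') (h7 : ¬ c.WritesInt 7) (h8 : ¬ c.WritesInt 8) (l1 : ¬ c.WritesSketch 1) :
    HoldsList F W rep s' := by
  refine ⟨?_, ?_, ?_⟩
  · rw [hk.ints 7 h7]; exact h.len
  · rw [hk.ints 8 h8]; exact h.idx
  · rw [hk.sketches 1 l1]; exact h.sketch

@[simp] theorem netBody_loopFree (d : ℕ) : (netBody d).LoopFree := by
  simp [netBody, Cmd.LoopFree]

@[simp] theorem assignBody_loopFree (d : ℕ) : (assignBody d).LoopFree := by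
  simp [assignBody, Cmd.LoopFree]

@[simp] theorem queryBody_loopFree : queryBody.LoopFree := by
  simp [queryBody, Cmd.LoopFree]

theorem enc_nonpos_iff {o : Option (Fin n)} : enc o ≤ 0 ↔ o = none := by
  rcases o with _ | v
  · simp [enc]
  · have := pt_nonneg v
    simp [enc]; omega

/-- The first pass builds the greedy net under the current stamp. It also resets the size and the
sketch of every potential cluster; the empty sketch comes from sketch variable `3`, which is never
written. -/
theorem runs_netLoop (hκ : 1 ≤ κ) {s : Store σ} (hin : HasInput F x ε s)
    (hW : HoldsList F W rep s) (hr : s.reals 3 [] = r) (hside : s.reals 8 [] = 4 * r / d)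
    (hfresh : Fresh s) (hcur : ∀ k, s.ints 9 (s.ints 6 [] :: k) = 0) :
    ∃ s', Runs F κ (forLoop 2 7 (netBody d)) s s' (((netBody d).size + 3) * W.length + 3) ∧
      (∀ z, s'.ints 9 (s'.ints 6 [] :: List.ofFn z) = enc (netGrid x r W z)) ∧ Fresh s' ∧
      ∀ w ∈ W, s'.ints 10 [pt w] = 0 ∧ s'.sketches 2 [pt w] = F.sketch ∅ := by
  obtain ⟨s', h1, h2⟩ := Runs.forLoop (F := F) hκ (body := netBody d) (v := 2) (b := 7)
    (netBody_loopFree d) (by simp [netBody, Cmd.WritesInt]) (by simp [netBody, Cmd.WritesInt])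
    (by norm_num) hW.len
    (fun i s' => (∀ z, s'.ints 9 (s'.ints 6 [] :: List.ofFn z) = enc (netGrid x r (W.take i) z)) ∧
      Fresh s' ∧
      ∀ w ∈ W.take i, s'.ints 10 [pt w] = 0 ∧ s'.sketches 2 [pt w] = F.sketch ∅)
    (by
      intro i s' z h
      simpa [Fresh] using h)
    ⟨by simp [netGrid, hcur, enc], hfresh, by simp⟩
    (by
      rintro i hi s' hk hv ⟨hg, hf, hz⟩
      have hin' : HasInput F x ε s' := hin.of_keeps hk
        (by simp [forLoop, netBody, Cmd.WritesInt]) (by simp [forLoop, netBody, Cmd.WritesReal])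
        (by simp [forLoop, netBody, Cmd.WritesReal]) (by simp [forLoop, netBody, Cmd.WritesSketch])
        (by simp [forLoop, netBody, Cmd.WritesSketch])
      have hW' : HoldsList F W rep s' := hW.of_keeps hk
        (by simp [forLoop, netBody, Cmd.WritesInt]) (by simp [forLoop, netBody, Cmd.WritesInt])
        (by simp [forLoop, netBody, Cmd.WritesSketch])
      have hr' : s'.reals 3 [] = r := by
        rw [hk.reals 3 (by simp [forLoop, netBody, Cmd.WritesReal]), hr]
      have hs' : s'.reals 8 [] = 4 * r / d := by
        rw [hk.reals 8 (by simp [forLoop, netBody, Cmd.WritesReal]), hside]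
      set w := W[i] with hw
      have hidx : s'.ints 8 [(i : ℤ)] = pt w := hW'.idx i hi
      have htake : W.take (i + 1) = W.take i ++ [w] := by simp [hw]
      -- Literal keys replace the computed ones, so that the addresses no longer depend on the
      -- memory in which they are evaluated.
      set s1 := ((s'.setInt (V 3) (pt w)).setInt ⟨10, ![.intLit (pt w)]⟩ 0).setSketch
        ⟨2, ![.intLit (pt w)]⟩ (F.sketch ∅) with hs1
      have hkey : (⟨10, ![.intLit (pt w)]⟩ : Loc).eval (s'.setInt (V 3) (pt w)) = [pt w] := by
        simp [Loc.eval, Expr.eval]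
      have hkey' : ∀ s : Store σ, (⟨2, ![.intLit (pt w)]⟩ : Loc).eval s = [pt w] := by
        simp [Loc.eval, Expr.eval]
      have hrun : run F (netBody d) s' = run F (.ite (.intLe (iv 4) (.intLit 0))
          (.intSet ⟨9, keyE d 0⟩ (.intAdd (iv 3) (.intLit 1))) .skip) (run F (scanCmd d) s1) := by
        have : s1 = run F (.seq (.intSet (V 3) (ia 8 (iv 2)))
            (.seq (.intSet (A 10 (iv 3)) (.intLit 0)) (.copy (A 2 (iv 3)) (V 3)))) s' := by
          rw [hs1]
          simp only [run, Expr.eval, ia_eval, iv_eval, hv, hidx, getSketch_eq, V_table, V_eval,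
            setInt_sketches, hin'.empty]
          simp [Store.setInt, Store.setSketch, Loc.eval, A, Expr.eval, V, update]
        rw [this]
        rfl
      have he1 : ScanEnv x r (netGrid x r (W.take i)) w s1 := by
        refine ⟨hin'.coord, ?_, hr', hs', ?_⟩
        · simp [hs1]
        · simpa [hs1] using hg
      have hk2 := keeps_run F (scanCmd_loopFree d) s1
      have hscan := run_scanCmd (F := F) he1
      have he2 : ScanEnv x r (netGrid x r (W.take i)) w (run F (scanCmd d) s1) :=
        he1.of_keeps hk2 (by simp) (by simp) (by simp) (by simp) (by simp) (by simp)
      have hgrid : netGrid x r (W.take (i + 1)) = gridStep x r (netGrid x r (W.take i)) w := by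
        rw [htake]; simp [netGrid]
      set s2 := run F (scanCmd d) s1 with hs2
      have e6 : s2.ints 6 = s1.ints 6 := hk2.ints 6 (by simp)
      have e9 : s2.ints 9 = s1.ints 9 := hk2.ints 9 (by simp)
      have e10 : s2.ints 10 = s1.ints 10 := hk2.ints 10 (by simp)
      have e2 : s2.sketches 2 = s1.sketches 2 := hk2.sketches 2 (by simp)
      have hf2 : Fresh s2 := by
        intro t ht k
        rw [e6] at ht
        rw [e9]
        simpa [hs1] using hf t (by simpa [hs1] using ht) k
      have hz2 : ∀ u ∈ W.take (i + 1),
          s2.ints 10 [pt u] = 0 ∧ s2.sketches 2 [pt u] = F.sketch ∅ := by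
        intro u hu
        rw [e10, e2]
        simp only [hs1, setSketch_ints, setInt_ints, hkey, hkey', setSketch_sketches,
          setInt_sketches, List.cons.injEq, pt_inj, and_true, true_and, V_eval, V_table]
        by_cases huw : u = w
        · simp [huw]
        · have : u ∈ W.take i := by
            rw [htake] at hu
            simpa [huw] using hu
          simpa [huw] using hz u this
      rw [hrun, run]
      by_cases hn : scan x r (netGrid x r (W.take i)) w = none
      · rw [if_pos (by simp [Expr.eval, hscan, hn, enc])]
        have hkey9 : (⟨9, keyE d 0⟩ : Loc).eval s2 =
            s2.ints 6 [] :: List.ofFn (cell x r w) := by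
          have := he2.key_eval 0
          rwa [add_zero] at this
        refine ⟨?_, ?_, ?_⟩
        · intro z
          rw [hgrid, gridStep, if_pos hn]
          simp only [run, setInt_ints, hkey9, Expr.eval, iv_eval, he2.point, Function.update_apply]
          by_cases hzc : z = cell x r w
          · simp [hzc, enc]
          · have : List.ofFn z ≠ List.ofFn (cell x r w) := fun h => hzc (List.ofFn_injective h)
            simpa [hzc, this] using he2.grid z
        · intro t ht k
          simp only [run, setInt_ints, hkey9] at ht ⊢
          have hlt : s2.ints 6 [] < t := by simpa using ht
          rw [if_neg, hf2 t hlt k]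
          -- Insertion uses the current stamp only, so keys with later stamps remain empty.
          rintro ⟨-, h⟩
          have := List.cons.inj h
          omega
        · intro u hu
          simpa [run] using hz2 u hu
      · rw [if_neg (by simpa [Expr.eval, hscan, enc_nonpos_iff] using hn)]
        refine ⟨?_, hf2, hz2⟩
        intro z
        rw [hgrid, gridStep, if_neg hn]
        exact he2.grid z)
  exact ⟨s', h1, by simpa using h2⟩

theorem agg_append {cen : Fin n → Fin n} {w : Fin n} (L : List (Fin n)) (c : Fin n) :
    agg (L ++ [w]) rep cen c =
      if cen w = c then agg L rep cen c ∪ Finset.univ.filter fun q => rep q = w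
      else agg L rep cen c := by
  ext q
  split_ifs with h
  · simp only [agg, List.mem_append, List.mem_singleton, Finset.mem_filter, Finset.mem_univ,
      true_and, Finset.mem_union]
    constructor
    · rintro ⟨h1 | h1, h2⟩
      · exact Or.inl ⟨h1, h2⟩
      · exact Or.inr h1
    · rintro (⟨h1, h2⟩ | h1)
      · exact ⟨Or.inl h1, h2⟩
      · exact ⟨Or.inr h1, by rw [h1, h]⟩
  · simp only [agg, List.mem_append, List.mem_singleton, Finset.mem_filter, Finset.mem_univ,
      true_and]
    constructor
    · rintro ⟨h1 | h1, h2⟩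
      · exact ⟨h1, h2⟩
      · exact absurd (by rw [← h1, h2]) h
    · rintro ⟨h1, h2⟩
      exact ⟨Or.inl h1, h2⟩

theorem disjoint_agg {cen : Fin n → Fin n} {L : List (Fin n)} {w c : Fin n} (hw : w ∉ L) :
    Disjoint (agg L rep cen c) (Finset.univ.filter fun q => rep q = w) := by
  rw [Finset.disjoint_left]
  intro q h1 h2
  simp only [agg, Finset.mem_filter, Finset.mem_univ, true_and] at h1 h2
  exact hw (h2 ▸ h1.1)

/-- A second pass is needed because a nearer net point may have been inserted after a point was
first scanned. Cluster sketches are built by adding one represented set at a time. -/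
theorem runs_assignLoop (hκ : 1 ≤ κ) {s : Store σ} (hnd : W.Nodup) (hin : HasInput F x ε s)
    (hW : HoldsList F W rep s) (hr : s.reals 3 [] = r) (hside : s.reals 8 [] = 4 * r / d)
    (hgrid : ∀ z, s.ints 9 (s.ints 6 [] :: List.ofFn z) = enc (netGrid x r W z))
    (hscan : ∀ w ∈ W, scan x r (netGrid x r W) w = some (netCenter x r W w))
    (hzero : ∀ w ∈ W, s.ints 10 [pt w] = 0 ∧ s.sketches 2 [pt w] = F.sketch ∅) :
    ∃ s', Runs F κ (forLoop 2 7 (assignBody d)) s s'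
        (((assignBody d).size + 3) * W.length + 3) ∧
      (∀ w ∈ W, s'.ints 1 [pt w] = pt (netCenter x r W w)) ∧
      ∀ c ∈ W, s'.ints 10 [pt c] =
          (W.filter fun v => decide (netCenter x r W v = c)).length ∧
        s'.sketches 2 [pt c] = F.sketch (agg W rep (netCenter x r W) c) := by
  set cen := netCenter x r W with hcendef
  obtain ⟨s', h1, h2⟩ := Runs.forLoop (F := F) hκ (body := assignBody d) (v := 2) (b := 7)
    (assignBody_loopFree d) (by simp [assignBody, Cmd.WritesInt])
    (by simp [assignBody, Cmd.WritesInt]) (by norm_num) hW.len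
    (fun i s' => (∀ w ∈ W.take i, s'.ints 1 [pt w] = pt (cen w)) ∧
      ∀ c ∈ W, s'.ints 10 [pt c] = ((W.take i).filter fun v => decide (cen v = c)).length ∧
        s'.sketches 2 [pt c] = F.sketch (agg (W.take i) rep cen c))
    (by
      intro i s' z h
      simpa using h)
    ⟨by simp, by simpa [agg] using hzero⟩
    (by
      rintro i hi s' hk hv ⟨hc, ha⟩
      have hin' : HasInput F x ε s' := hin.of_keeps hk
        (by simp [forLoop, assignBody, Cmd.WritesInt])
        (by simp [forLoop, assignBody, Cmd.WritesReal])
        (by simp [forLoop, assignBody, Cmd.WritesReal])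
        (by simp [forLoop, assignBody, Cmd.WritesSketch])
        (by simp [forLoop, assignBody, Cmd.WritesSketch])
      have hW' : HoldsList F W rep s' := hW.of_keeps hk
        (by simp [forLoop, assignBody, Cmd.WritesInt])
        (by simp [forLoop, assignBody, Cmd.WritesInt])
        (by simp [forLoop, assignBody, Cmd.WritesSketch])
      have hr' : s'.reals 3 [] = r := by
        rw [hk.reals 3 (by simp [forLoop, assignBody, Cmd.WritesReal]), hr]
      have hs' : s'.reals 8 [] = 4 * r / d := by
        rw [hk.reals 8 (by simp [forLoop, assignBody, Cmd.WritesReal]), hside]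
      have hg' : ∀ z, s'.ints 9 (s'.ints 6 [] :: List.ofFn z) = enc (netGrid x r W z) := by
        rw [hk.ints 9 (by simp [forLoop, assignBody, Cmd.WritesInt]),
          hk.ints 6 (by simp [forLoop, assignBody, Cmd.WritesInt])]
        exact hgrid
      set w := W[i] with hw
      have hwW : w ∈ W := List.getElem_mem hi
      have hidx : s'.ints 8 [(i : ℤ)] = pt w := hW'.idx i hi
      have htake : W.take (i + 1) = W.take i ++ [w] := by simp [hw]
      -- Sketches can be combined only for disjoint sets; absence of repetitions in `W` guarantees
      -- this.
      have hwt : w ∉ W.take i := by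
        have h3 : (W.take (i + 1)).Nodup := hnd.sublist (List.take_sublist _ _)
        rw [htake] at h3
        intro h4
        exact (List.disjoint_of_nodup_append h3) h4 (by simp)
      have he1 : ScanEnv x r (netGrid x r W) w (s'.setInt (V 3) (pt w)) := by
        refine ⟨hin'.coord, by simp, hr', hs', ?_⟩
        simpa using hg'
      have hk2 := keeps_run F (scanCmd_loopFree d) (s'.setInt (V 3) (pt w))
      have hsc := run_scanCmd (F := F) he1
      rw [hscan w hwW] at hsc
      have hrun : run F (assignBody d) s' = run F (.seq (.intSet (V 4) (.intSub (iv 4) (.intLit 1)))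
        (.seq (.intSet (A 1 (iv 3)) (iv 4))
          (.seq (.combine (A 2 (iv 4)) (A 2 (iv 4)) (A 1 (iv 3)))
            (.intSet (A 10 (iv 4)) (.intAdd (ia 10 (iv 4)) (.intLit 1))))))
          (run F (scanCmd d) (s'.setInt (V 3) (pt w))) := by
        have : s'.setInt (V 3) (pt w) = run F (.intSet (V 3) (ia 8 (iv 2))) s' := by
          simp [run, hv, hidx]
        rw [this]
        rfl
      set s2 := run F (scanCmd d) (s'.setInt (V 3) (pt w)) with hs2
      have e3 : s2.ints 3 [] = pt w := by rw [hk2.ints 3 (by simp)]; simp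
      have e1 : ∀ k, s2.ints 1 k = s'.ints 1 k := by
        intro k; rw [hk2.ints 1 (by simp)]; simp
      have e10 : ∀ k, s2.ints 10 k = s'.ints 10 k := by
        intro k; rw [hk2.ints 10 (by simp)]; simp
      have f1 : ∀ k, s2.sketches 1 k = s'.sketches 1 k := by
        intro k; rw [hk2.sketches 1 (by simp)]; simp
      have f2 : ∀ k, s2.sketches 2 k = s'.sketches 2 k := by
        intro k; rw [hk2.sketches 2 (by simp)]; simp
      have e4 : s2.ints 4 [] = pt (cen w) + 1 := by rw [hsc]; rfl
      rw [hrun]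
      constructor
      · intro u hu
        simp only [run, Expr.eval, setInt_ints, setSketch_ints, A_table, A_eval, iv_eval, V_eval,
          V_table, e3, e4, e1]
        by_cases huw : u = w
        · simp [huw]
        · have : u ∈ W.take i := by
            rw [htake] at hu
            simpa [huw] using hu
          simpa [huw] using hc u this
      · intro c hcW
        obtain ⟨ha1, ha2⟩ := ha c hcW
        rw [htake, agg_append]
        constructor
        · simp only [run, Expr.eval, setInt_ints, setSketch_ints, A_table, A_eval, iv_eval, V_eval,
            V_table, e3, e4, e10, ia_eval]
          by_cases hcc : cen w = c
          · simp [hcc, ha1]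
          · have : c ≠ cen w := fun h => hcc h.symm
            simp [hcc, ha1, this]
        · simp only [run, Expr.eval, setInt_ints, setSketch_sketches, setInt_sketches, getSketch_eq,
            A_table, A_eval, iv_eval, V_eval, V_table, e3, e4, f1, f2]
          by_cases hcc : cen w = c
          · simp only [hcc]
            simp [ha2, hW'.sketch w hwW, F.combine_sketch _ _ (disjoint_agg hwt)]
          · have : c ≠ cen w := fun h => hcc h.symm
            simp [hcc, ha2, this])
  exact ⟨s', h1, by simpa using h2⟩

open Classical in
-- Queries are made once per point rather than once per cluster, which is redundant but still
-- linear.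
theorem runs_queryLoop (hκ : 1 ≤ κ) {s : Store σ} {cen : Fin n → Fin n}
    (hW : HoldsList F W rep s) (hc : ∀ w ∈ W, s.ints 1 [pt w] = pt (cen w))
    (hcen : ∀ w ∈ W, cen w ∈ W)
    (ha : ∀ c ∈ W, s.sketches 2 [pt c] = F.sketch (agg W rep cen c)) (hok : s.ints 11 [] = 1) :
    ∃ s', Runs F κ (forLoop 2 7 queryBody) s s' ((queryBody.size + 3) * W.length + 3) ∧
      s'.ints 11 [] = if ∀ w ∈ W, agg W rep cen (cen w) ∈ F.family then 1 else 0 := by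
  obtain ⟨s', h1, h2⟩ := Runs.forLoop (F := F) hκ (body := queryBody) (v := 2) (b := 7)
    queryBody_loopFree (by simp [queryBody, Cmd.WritesInt])
    (by simp [queryBody, Cmd.WritesInt]) (by norm_num) hW.len
    (fun i s' => s'.ints 11 [] =
      if ∀ w ∈ W.take i, agg W rep cen (cen w) ∈ F.family then 1 else 0)
    (by
      intro i s' z h
      simpa using h)
    (by simpa using hok)
    (by
      intro i hi s' hk hv h
      have hW' : HoldsList F W rep s' := hW.of_keeps hk
        (by simp [forLoop, queryBody, Cmd.WritesInt])
        (by simp [forLoop, queryBody, Cmd.WritesInt])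
        (by simp [forLoop, queryBody, Cmd.WritesSketch])
      set w := W[i] with hw
      have hwW : w ∈ W := List.getElem_mem hi
      have hidx : s'.ints 8 [(i : ℤ)] = pt w := hW'.idx i hi
      have htake : W.take (i + 1) = W.take i ++ [w] := by simp [hw]
      have h1 : s'.ints 1 [pt w] = pt (cen w) := by
        rw [hk.ints 1 (by simp [forLoop, queryBody, Cmd.WritesInt]), hc w hwW]
      have h2 : s'.sketches 2 [pt (cen w)] = F.sketch (agg W rep cen (cen w)) := by
        rw [hk.sketches 2 (by simp [forLoop, queryBody, Cmd.WritesSketch]), ha _ (hcen w hwW)]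
      have h3 := F.oracle_sketch (agg W rep cen (cen w))
      rw [htake]
      simp only [List.mem_append, List.mem_singleton, or_imp, forall_and, forall_eq]
      by_cases hm : agg W rep cen (cen w) ∈ F.family
      · simp [queryBody, run, Expr.eval, hv, hidx, h1, h2, h3.2 hm, h, hm]
      · have h4 : ¬ F.oracle (F.sketch (agg W rep cen (cen w))) = true := fun h' => hm (h3.1 h')
        simp [queryBody, run, Expr.eval, hv, hidx, h1, h2, h4, hm])
  exact ⟨s', h1, by simpa using h2⟩

/-- The time that the clustering procedure takes is at most this number times the number of
points plus one. -/
noncomputable def clusterTime (d : ℕ) : ℕ :=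
  (netBody d).size + (assignBody d).size + queryBody.size + 30

@[simp] theorem clusterCmd_writesInt (d : ℕ) {a : ℕ} (ha : a ∉ [1, 2, 3, 4, 5, 6, 9, 10, 11, 12]) :
    ¬ (clusterCmd d).WritesInt a := by
  simp only [List.mem_cons, not_or] at ha
  obtain ⟨h1, h2, h3, h4, h5, h6, h9, h10, h11, h12, -⟩ := ha
  simp [clusterCmd, forLoop, netBody, assignBody, queryBody, Cmd.WritesInt, *]

@[simp] theorem clusterCmd_writesReal (d : ℕ) {a : ℕ} (ha : a ∉ [4, 8]) :
    ¬ (clusterCmd d).WritesReal a := by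
  simp only [List.mem_cons, not_or] at ha
  obtain ⟨h4, h8, -⟩ := ha
  simp [clusterCmd, forLoop, netBody, assignBody, queryBody, Cmd.WritesReal, *]

@[simp] theorem clusterCmd_writesSketch (d : ℕ) {a : ℕ} (ha : a ≠ 2) :
    ¬ (clusterCmd d).WritesSketch a := by
  simp [clusterCmd, forLoop, netBody, assignBody, queryBody, Cmd.WritesSketch, *]

open Classical in
theorem runs_clusterCmd (hκ : 1 ≤ κ) (hd : 0 < d) (hr0 : 0 < r) {s : Store σ} (hnd : W.Nodup)
    (hin : HasInput F x ε s) (hW : HoldsList F W rep s) (hr : s.reals 3 [] = r)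
    (hfresh : Fresh s) :
    ∃ s', Runs F κ (clusterCmd d) s s' (clusterTime d * (W.length + 1)) ∧ Fresh s' ∧
      (∀ w ∈ W, s'.ints 1 [pt w] = pt (netCenter x r W w)) ∧
      (∀ c ∈ W, s'.ints 10 [pt c] =
          (W.filter fun v => decide (netCenter x r W v = c)).length ∧
        s'.sketches 2 [pt c] = F.sketch (agg W rep (netCenter x r W) c)) ∧
      s'.ints 11 [] =
        if ∀ w ∈ W, agg W rep (netCenter x r W) (netCenter x r W w) ∈ F.family then 1 else 0 := by
  have hnet := isNet_netCenter (x := x) hd hr0 W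
  set s1 := (s.setInt (V 6) (s.ints 6 [] + 1)).setReal (V 8) (4 * r / d) with hs1
  have hr1 : Runs F κ (.intSet (V 6) (.intAdd (iv 6) (.intLit 1))) s
      (s.setInt (V 6) (s.ints 6 [] + 1)) 1 :=
    Runs.intSet hκ (by simp [Expr.eval])
  have hr2 : Runs F κ (.realSet (V 8)
      (.realDiv (.realMul (.ofInt (.intLit 4)) (rv 3)) (.ofInt (.intLit d))))
      (s.setInt (V 6) (s.ints 6 [] + 1)) s1 1 :=
    Runs.realSet hκ (by simp [Expr.eval, hr])
  have hin1 : HasInput F x ε s1 := (hin.of_keeps hr1.keeps (by simp [Cmd.WritesInt])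
    (by simp [Cmd.WritesReal]) (by simp [Cmd.WritesReal]) (by simp [Cmd.WritesSketch])
    (by simp [Cmd.WritesSketch])).of_keeps hr2.keeps (by simp [Cmd.WritesInt])
    (by simp [Cmd.WritesReal]) (by simp [Cmd.WritesReal]) (by simp [Cmd.WritesSketch])
    (by simp [Cmd.WritesSketch])
  have hW1 : HoldsList F W rep s1 := (hW.of_keeps hr1.keeps (by simp [Cmd.WritesInt])
    (by simp [Cmd.WritesInt]) (by simp [Cmd.WritesSketch])).of_keeps hr2.keeps
    (by simp [Cmd.WritesInt]) (by simp [Cmd.WritesInt]) (by simp [Cmd.WritesSketch])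
  obtain ⟨s2, hr3, hg2, hf2, hz2⟩ := runs_netLoop (x := x) (r := r) hκ hin1 hW1
    (by simp [hs1, hr]) (by simp [hs1])
    (by
      intro t ht k
      have ht' : s.ints 6 [] + 1 < t := by simpa [hs1] using ht
      simpa [hs1] using hfresh t (by omega) k)
    -- The stamp has just been increased, so by freshness the grid is empty both at the new stamp
    -- and at all later ones.
    (by
      intro k
      simpa [hs1] using hfresh (s.ints 6 [] + 1) (by omega) k)
  have hin2 : HasInput F x ε s2 := hin1.of_keeps hr3.keeps
    (by simp [forLoop, netBody, Cmd.WritesInt]) (by simp [forLoop, netBody, Cmd.WritesReal])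
    (by simp [forLoop, netBody, Cmd.WritesReal]) (by simp [forLoop, netBody, Cmd.WritesSketch])
    (by simp [forLoop, netBody, Cmd.WritesSketch])
  have hW2 : HoldsList F W rep s2 := hW1.of_keeps hr3.keeps
    (by simp [forLoop, netBody, Cmd.WritesInt]) (by simp [forLoop, netBody, Cmd.WritesInt])
    (by simp [forLoop, netBody, Cmd.WritesSketch])
  obtain ⟨s3, hr4, hc3, ha3⟩ := runs_assignLoop (x := x) (r := r) hκ hnd hin2 hW2
    (by rw [hr3.keeps.reals 3 (by simp [forLoop, netBody, Cmd.WritesReal])]; simp [hs1, hr])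
    (by rw [hr3.keeps.reals 8 (by simp [forLoop, netBody, Cmd.WritesReal])]; simp [hs1])
    hg2 (fun w hw => scan_netGrid hd hr0 hw) hz2
  have hW3 : HoldsList F W rep s3 := hW2.of_keeps hr4.keeps
    (by simp [forLoop, assignBody, Cmd.WritesInt]) (by simp [forLoop, assignBody, Cmd.WritesInt])
    (by simp [forLoop, assignBody, Cmd.WritesSketch])
  have hf3 : Fresh s3 := by
    intro t ht k
    rw [hr4.keeps.ints 9 (by simp [forLoop, assignBody, Cmd.WritesInt])]
    rw [hr4.keeps.ints 6 (by simp [forLoop, assignBody, Cmd.WritesInt])] at ht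
    exact hf2 t ht k
  have hr5 : Runs F κ (.intSet (V 11) (.intLit 1)) s3 (s3.setInt (V 11) 1) 1 :=
    Runs.intSet hκ (by simp [Expr.eval])
  have hW4 : HoldsList F W rep (s3.setInt (V 11) 1) := hW3.of_keeps hr5.keeps
    (by simp [Cmd.WritesInt]) (by simp [Cmd.WritesInt]) (by simp [Cmd.WritesSketch])
  obtain ⟨s5, hr6, hok⟩ := runs_queryLoop (cen := netCenter x r W) hκ hW4
    (by simpa using hc3) hnet.cen_mem (by simpa using fun c hc => (ha3 c hc).2) (by simp)
  have hq : ∀ a, a ∉ [2, 11, 12] → s5.ints a = (s3.setInt (V 11) 1).ints a := by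
    intro a ha
    simp only [List.mem_cons, not_or] at ha
    obtain ⟨h2, h11, h12, -⟩ := ha
    exact hr6.keeps.ints a (by simp [forLoop, queryBody, Cmd.WritesInt, *])
  refine ⟨s5, Runs.mono (hr1.seq hκ (hr2.seq hκ (hr3.seq hκ (hr4.seq hκ (hr5.seq hκ hr6))))) ?_,
    ?_, ?_, ?_, hok⟩
  · rw [clusterTime]
    nlinarith
  · intro t ht k
    rw [hq 6 (by simp)] at ht
    rw [hq 9 (by simp)]
    simpa using hf3 t (by simpa using ht) k
  · intro w hw
    rw [hq 1 (by simp)]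
    simpa using hc3 w hw
  · intro c hc
    rw [hq 10 (by simp), hr6.keeps.sketches 2 (by simp [forLoop, queryBody, Cmd.WritesSketch])]
    simpa using ha3 c hc

end SketchRAM

namespace SketchRAM

open MinMaxClustering

variable {d n : ℕ} {σ : Type*} {F : SketchableFamily (Fin n) σ}
  {x : Fin n → EuclideanSpace ℝ (Fin d)} {ε r : ℝ} {κ : ℕ}
  {W : List (Fin n)} {rep : Fin n → Fin n}

/-! ### Nearest neighbours -/

/-- Update the distance in the real variable `5` between the point in the integer variable `14`
and the nearest of the points seen so far; it is `-1` if there are none. -/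
def nearestBody (d : ℕ) : Cmd :=
  .seq (.intSet (V 3) (ia 8 (iv 2)))
    (.ite (.and (.not (.and (.intLe (iv 3) (iv 14)) (.intLe (iv 14) (iv 3))))
        (.not (.and (.realLe (.ofInt (.intLit 0)) (rv 5))
          (.realLe (rv 5) (distE d (iv 3) (iv 14))))))
      (.realSet (V 5) (distE d (iv 3) (iv 14))) .skip)

def nearestCmd (d : ℕ) : Cmd :=
  .seq (.intSet (V 14) (ia 8 (iv 14)))
    (.seq (.realSet (V 5) (.ofInt (.intLit (-1)))) (forLoop 2 7 (nearestBody d)))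

/-- Variable `14` first holds a position in the list and is then replaced by the point there. The
sentinel `-1` marks that no other point has been seen; it cannot be confused with a distance. -/
theorem runs_nearestCmd (hκ : 1 ≤ κ) {s : Store σ} (hin : HasInput F x ε s)
    (hW : HoldsList F W rep s) {nn : Fin n → ℝ} (hnn : IsNearest x W nn) {v : ℕ}
    (hv : v < W.length) (hs : s.ints 14 [] = v) :
    ∃ s', Runs F κ (nearestCmd d) s s' (8 * W.length + 7) ∧ s'.reals 5 [] = nn W[v] := by
  set p := W[v] with hp
  have hpW : p ∈ W := List.getElem_mem hv
  have hr1 : Runs F κ (.intSet (V 14) (ia 8 (iv 14))) s (s.setInt (V 14) (pt p)) 1 :=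
    Runs.intSet hκ (by simp [hs, hW.idx v hv, hp])
  have hr2 : Runs F κ (.realSet (V 5) (.ofInt (.intLit (-1)))) (s.setInt (V 14) (pt p))
      ((s.setInt (V 14) (pt p)).setReal (V 5) (-1)) 1 := Runs.realSet hκ (by simp [Expr.eval])
  set s1 := (s.setInt (V 14) (pt p)).setReal (V 5) (-1) with hs1
  have hin1 : HasInput F x ε s1 := (hin.of_keeps hr1.keeps (by simp [Cmd.WritesInt])
    (by simp [Cmd.WritesReal]) (by simp [Cmd.WritesReal]) (by simp [Cmd.WritesSketch])
    (by simp [Cmd.WritesSketch])).of_keeps hr2.keeps (by simp [Cmd.WritesInt])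
    (by simp [Cmd.WritesReal]) (by simp [Cmd.WritesReal]) (by simp [Cmd.WritesSketch])
    (by simp [Cmd.WritesSketch])
  have hW1 : HoldsList F W rep s1 := (hW.of_keeps hr1.keeps (by simp [Cmd.WritesInt])
    (by simp [Cmd.WritesInt]) (by simp [Cmd.WritesSketch])).of_keeps hr2.keeps
    (by simp [Cmd.WritesInt]) (by simp [Cmd.WritesInt]) (by simp [Cmd.WritesSketch])
  obtain ⟨s2, hr3, h2⟩ := Runs.forLoop (F := F) hκ (body := nearestBody d) (v := 2) (b := 7)
    (by simp [nearestBody, Cmd.LoopFree]) (by simp [nearestBody, Cmd.WritesInt])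
    (by simp [nearestBody, Cmd.WritesInt]) (by norm_num) hW1.len
    (fun i s' => (s'.reals 5 [] = -1 ∧ ∀ w ∈ W.take i, w = p) ∨
      ((∃ u ∈ W.take i, u ≠ p ∧ s'.reals 5 [] = dist (x u) (x p)) ∧
        ∀ w ∈ W.take i, w ≠ p → s'.reals 5 [] ≤ dist (x w) (x p)))
    (by
      intro i s' z h
      simpa using h)
    (by left; simp [hs1])
    (by
      intro i hi s' hk hv' h
      have hin' : HasInput F x ε s' := hin1.of_keeps hk
        (by simp [forLoop, nearestBody, Cmd.WritesInt])
        (by simp [forLoop, nearestBody, Cmd.WritesReal])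
        (by simp [forLoop, nearestBody, Cmd.WritesReal])
        (by simp [forLoop, nearestBody, Cmd.WritesSketch])
        (by simp [forLoop, nearestBody, Cmd.WritesSketch])
      have hW' : HoldsList F W rep s' := hW1.of_keeps hk
        (by simp [forLoop, nearestBody, Cmd.WritesInt])
        (by simp [forLoop, nearestBody, Cmd.WritesInt])
        (by simp [forLoop, nearestBody, Cmd.WritesSketch])
      have h14 : s'.ints 14 [] = pt p := by
        rw [hk.ints 14 (by simp [forLoop, nearestBody, Cmd.WritesInt])]; simp [hs1]
      set w := W[i] with hw
      have hidx : s'.ints 8 [(i : ℤ)] = pt w := hW'.idx i hi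
      have htake : W.take (i + 1) = W.take i ++ [w] := by simp [hw]
      have hdist : (distE d (iv 3) (iv 14)).eval (s'.setInt (V 3) (pt w)) =
          dist (x w) (x p) := by
        refine distE_eval ?_ (by simp) (by simp [h14])
        simpa using hin'.coord
      have heq : (pt w ≤ pt p ∧ pt p ≤ pt w) ↔ w = p := by
        rw [← pt_inj]; omega
      rw [htake]
      simp only [List.mem_append, List.mem_singleton]
      by_cases hwp : w = p
      · have hrun : (run F (nearestBody d) s').reals = s'.reals := by
          rw [nearestBody, run, run, run, ia_eval, iv_eval, hv', hidx]
          simp [Expr.eval, h14, hwp, run]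
        rw [hrun]
        rcases h with ⟨h5, h6⟩ | ⟨⟨u, hu, hup, h5⟩, h6⟩
        · left
          refine ⟨h5, ?_⟩
          rintro u (hu | rfl)
          · exact h6 u hu
          · exact hwp
        · right
          refine ⟨⟨u, Or.inl hu, hup, h5⟩, ?_⟩
          rintro u' (hu' | rfl) hne
          · exact h6 u' hu' hne
          · exact absurd hwp hne
      · have hne : ¬ (pt w ≤ pt p ∧ pt p ≤ pt w) := fun h' => hwp (heq.1 h')
        by_cases hc : 0 ≤ s'.reals 5 [] ∧ s'.reals 5 [] ≤ dist (x w) (x p)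
        · have hrun : (run F (nearestBody d) s').reals = s'.reals := by
            rw [nearestBody, run, run, run, ia_eval, iv_eval, hv', hidx, if_neg]
            · simp [run]
            · simp only [Expr.eval, hdist]
              simp [hc.1, hc.2]
          rw [hrun]
          rcases h with ⟨h5, h6⟩ | ⟨⟨u, hu, hup, h5⟩, h6⟩
          · rw [h5] at hc
            norm_num at hc
          · right
            refine ⟨⟨u, Or.inl hu, hup, h5⟩, ?_⟩
            rintro u' (hu' | rfl) hne
            · exact h6 u' hu' hne
            · exact hc.2
        · have hrun : (run F (nearestBody d) s').reals 5 [] = dist (x w) (x p) := by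
            rw [nearestBody, run, run, run, ia_eval, iv_eval, hv', hidx, if_pos]
            · simp [run, hdist]
            · simp only [Expr.eval, hdist]
              refine ⟨?_, ?_⟩
              · simpa [h14] using hne
              · simpa using hc
          rw [hrun]
          right
          refine ⟨⟨w, Or.inr rfl, hwp, rfl⟩, ?_⟩
          rintro u' (hu' | rfl) hne'
          · rcases h with ⟨h5, h6⟩ | ⟨⟨u, hu, hup, h5⟩, h6⟩
            · exact absurd (h6 u' hu') hne'
            · have h7 := h6 u' hu' hne'
              have h8 : 0 ≤ s'.reals 5 [] := by rw [h5]; exact dist_nonneg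
              have h9 : dist (x w) (x p) < s'.reals 5 [] := not_le.1 fun h => hc ⟨h8, h⟩
              linarith
          · exact le_rfl)
  have hsize : (nearestBody d).size = 5 := rfl
  refine ⟨s2, Runs.mono (hr1.seq hκ (hr2.seq hκ hr3)) (by rw [hsize]; omega), ?_⟩
  obtain ⟨hmin, u, hu, hup, hd⟩ := hnn p hpW
  rw [List.take_length] at h2
  rcases h2 with ⟨-, h6⟩ | ⟨⟨u', hu', hup', h5⟩, h6⟩
  · exact absurd (h6 u hu) hup
  · have h7 := h6 u hu hup
    have h8 := hmin u' hu' hup'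
    rw [dist_comm] at h7 h8
    rw [hd] at h7
    linarith

/-! ### Shrinking the list of points -/

def copyBody : Cmd :=
  .seq (.intSet (V 3) (ia 8 (iv 2))) (.copy (A 1 (iv 3)) (A 2 (iv 3)))

/-- Keep the current point if it satisfies `p`. -/
def filterBody (p : Expr .prop) : Cmd :=
  .seq (.intSet (V 3) (ia 8 (iv 2)))
    (.ite p (.seq (.intSet (A 8 (iv 13)) (iv 3))
      (.intSet (V 13) (.intAdd (iv 13) (.intLit 1)))) .skip)

def filterCmd (p : Expr .prop) : Cmd :=
  .seq (.intSet (V 13) (.intLit 0))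
    (.seq (forLoop 2 7 (filterBody p)) (.intSet (V 7) (iv 13)))

theorem runs_copyLoop (hκ : 1 ≤ κ) {s : Store σ} {g : Fin n → σ} (hW : HoldsList F W rep s)
    (hg : ∀ w ∈ W, s.sketches 2 [pt w] = g w) :
    ∃ s', Runs F κ (forLoop 2 7 copyBody) s s' (6 * W.length + 3) ∧
      ∀ w ∈ W, s'.sketches 1 [pt w] = g w := by
  obtain ⟨s', h1, h2⟩ := Runs.forLoop (F := F) hκ (body := copyBody) (v := 2) (b := 7)
    (by simp [copyBody, Cmd.LoopFree]) (by simp [copyBody, Cmd.WritesInt])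
    (by simp [copyBody, Cmd.WritesInt]) (by norm_num) hW.len
    (fun i s' => ∀ w ∈ W.take i, s'.sketches 1 [pt w] = g w)
    (by
      intro i s' z h
      simpa using h)
    (by simp)
    (by
      intro i hi s' hk hv h
      set w := W[i] with hw
      have hwW : w ∈ W := List.getElem_mem hi
      have hidx : s'.ints 8 [(i : ℤ)] = pt w := by
        rw [hk.ints 8 (by simp [forLoop, copyBody, Cmd.WritesInt])]
        exact hW.idx i hi
      have htake : W.take (i + 1) = W.take i ++ [w] := by simp [hw]
      have h2 : s'.sketches 2 [pt w] = g w := by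
        rw [hk.sketches 2 (by simp [forLoop, copyBody, Cmd.WritesSketch]), hg w hwW]
      intro u hu
      by_cases huw : u = w
      · simp [copyBody, run, hv, hidx, huw, h2]
      · have : u ∈ W.take i := by
          rw [htake] at hu
          simpa [huw] using hu
        simpa [copyBody, run, hv, hidx, huw] using h u this)
  have hsize : copyBody.size = 3 := rfl
  rw [hsize] at h1
  exact ⟨s', h1, by simpa using h2⟩

/-- The array is compacted in place. The write position never overtakes the read position, so the
unread entries are intact; the invariant therefore describes the written prefix and the unread
suffix separately. -/
theorem runs_filterCmd (hκ : 1 ≤ κ) {s : Store σ} {keep : Fin n → Bool} {p : Expr .prop}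
    (hW : HoldsList F W rep s)
    (hp : ∀ s', Keeps (filterCmd p) s s' → ∀ w ∈ W, s'.ints 3 [] = pt w →
      (p.eval s' ↔ keep w = true)) :
    ∃ s', Runs F κ (filterCmd p) s s' (10 * W.length + 7) ∧
      s'.ints 7 [] = (W.filter keep).length ∧
      ∀ (i : ℕ) (h : i < (W.filter keep).length), s'.ints 8 [(i : ℤ)] = pt (W.filter keep)[i] := by
  have hr1 : Runs F κ (.intSet (V 13) (.intLit 0)) s (s.setInt (V 13) 0) 1 :=
    Runs.intSet hκ (by simp [Expr.eval])
  set s1 := s.setInt (V 13) 0 with hs1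
  have hk1 : Keeps (filterCmd p) s s1 := keeps_setInt (Or.inl rfl)
  have hW1 : HoldsList F W rep s1 := hW.of_keeps hr1.keeps (by simp [Cmd.WritesInt])
    (by simp [Cmd.WritesInt]) (by simp [Cmd.WritesSketch])
  obtain ⟨s2, hr2, h13, hpre, -⟩ := Runs.forLoop (F := F) hκ (body := filterBody p) (v := 2) (b := 7)
    (by simp [filterBody, Cmd.LoopFree]) (by simp [filterBody, Cmd.WritesInt])
    (by simp [filterBody, Cmd.WritesInt]) (by norm_num) hW1.len
    (fun i s' => s'.ints 13 [] = ((W.take i).filter keep).length ∧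
      (∀ (j : ℕ) (w : Fin n), ((W.take i).filter keep)[j]? = some w → s'.ints 8 [(j : ℤ)] = pt w) ∧
      ∀ (j : ℕ) (h : j < W.length), i ≤ j → s'.ints 8 [(j : ℤ)] = pt W[j])
    (by
      intro i s' z h
      simpa using h)
    (by
      refine ⟨by simp [hs1], by simp, fun j h _ => ?_⟩
      exact hW1.idx j h)
    (by
      rintro i hi s' hk hv ⟨h13, hpre, hpost⟩
      set w := W[i] with hw
      have hwW : w ∈ W := List.getElem_mem hi
      have hidx : s'.ints 8 [(i : ℤ)] = pt w := hpost i hi le_rfl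
      have htake : (W.take (i + 1)).filter keep =
          (W.take i).filter keep ++ if keep w then [w] else [] := by
        have : W.take (i + 1) = W.take i ++ [w] := by simp [hw]
        rw [this, List.filter_append]
        congr 1
        by_cases h : keep w <;> simp [h]
      have hev : p.eval (s'.setInt (V 3) (pt w)) ↔ keep w = true := by
        refine hp _ ?_ w hwW (by simp)
        have hk2 : Keeps (filterCmd p) s1 s' := hk.mono (fun a h => Or.inr (Or.inl h))
          (fun a h => Or.inr (Or.inl h)) (fun a h => Or.inr (Or.inl h))
        refine hk1.trans (hk2.trans (keeps_setInt ?_))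
        simp [filterCmd, forLoop, filterBody, Cmd.WritesInt]
      have hlen : ((W.take i).filter keep).length ≤ i :=
        (List.length_filter_le _ _).trans (by simp)
      have hrun : run F (filterBody p) s' = if keep w = true then
          ((s'.setInt (V 3) (pt w)).setInt ⟨8, ![.intLit ((W.take i).filter keep).length]⟩
            (pt w)).setInt (V 13) (((W.take i).filter keep).length + 1)
          else s'.setInt (V 3) (pt w) := by
        rw [filterBody, run, run, run, ia_eval, iv_eval, hv, hidx]
        simp only [hev]
        split_ifs with h
        · simp only [run, Expr.eval, iv_eval, setInt_ints]
          simp [h13, Store.setInt, Loc.eval, A, Expr.eval, V, update]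
        · simp [run]
      have hkey : ∀ s : Store σ, (⟨8, ![.intLit ((W.take i).filter keep).length]⟩ : Loc).eval s =
          [(((W.take i).filter keep).length : ℤ)] := by
        simp [Loc.eval, Expr.eval]
      rw [hrun, htake]
      by_cases hkw : keep w = true
      · simp only [hkw, if_true]
        refine ⟨by simp, fun j u hj => ?_, fun j h hij => ?_⟩
        · rw [List.getElem?_append] at hj
          simp only [setInt_ints, hkey, V_table, V_eval]
          split_ifs at hj with hlt
          · have hne : j ≠ ((W.take i).filter keep).length := hlt.ne
            simpa [hne] using hpre j u hj
          · have hj0 : j - ((W.take i).filter keep).length = 0 := by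
              by_contra h0
              rw [List.getElem?_eq_none (by simp; omega)] at hj
              cases hj
            have hje : j = ((W.take i).filter keep).length := by omega
            rw [hj0] at hj
            have huw : w = u := by simpa using hj
            simp [hje, huw]
        · simp only [setInt_ints, hkey, V_table, V_eval]
          have hne : j ≠ ((W.take i).filter keep).length := by omega
          simpa [hne] using hpost j h (by omega)
      · rw [if_neg hkw, if_neg hkw, List.append_nil]
        refine ⟨by simpa using h13, fun j u hj => by simpa using hpre j u hj, fun j h hij => ?_⟩
        simpa using hpost j h (by omega))
  rw [List.take_length] at h13 hpre
  have hr3 : Runs F κ (.intSet (V 7) (iv 13)) s2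
      (s2.setInt (V 7) ((W.filter keep).length : ℤ)) 1 := Runs.intSet hκ (by simp [h13])
  have hsize : (filterBody p).size = 7 := rfl
  refine ⟨_, Runs.mono (hr1.seq hκ (hr2.seq hκ hr3)) (by rw [hsize]; omega), by simp, ?_⟩
  intro i h
  simpa using hpre i _ (List.getElem?_eq_getElem h)

end SketchRAM

/-! ### One round of net and prune -/

namespace SketchRAM

open MinMaxClustering

variable {d n : ℕ} {σ : Type*} {F : SketchableFamily (Fin n) σ}
  {x : Fin n → EuclideanSpace ℝ (Fin d)} {ε r δ l : ℝ} {κ : ℕ}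
  {W : List (Fin n)} {rep : Fin n → Fin n}

/-- The oracle accepts all clusters of the net. -/
def Succeeds (F : SketchableFamily (Fin n) σ) (x : Fin n → EuclideanSpace ℝ (Fin d))
    (W : List (Fin n)) (rep : Fin n → Fin n) (r : ℝ) : Prop :=
  ∀ w ∈ W, agg W rep (netCenter x r W) (netCenter x r W w) ∈ F.family

/-- The memory after the clustering procedure. -/
structure Clustered (F : SketchableFamily (Fin n) σ) (x : Fin n → EuclideanSpace ℝ (Fin d))
    (ε : ℝ) (W : List (Fin n)) (rep : Fin n → Fin n) (r : ℝ) (s : Store σ) : Prop where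
  input : HasInput F x ε s
  fresh : Fresh s
  holds : HoldsList F W rep s
  cen : ∀ w ∈ W, s.ints 1 [pt w] = pt (netCenter x r W w)
  count : ∀ c ∈ W, s.ints 10 [pt c] =
    (W.filter fun v => decide (netCenter x r W v = c)).length
  sketch : ∀ c ∈ W, s.sketches 2 [pt c] = F.sketch (agg W rep (netCenter x r W) c)
  ok : 0 < s.ints 11 [] ↔ Succeeds F x W rep r

theorem Fresh.of_keeps {c : Cmd} {s s' : Store σ} (h : Fresh s) (hk : Keeps c s s')
    (h6 : ¬ c.WritesInt 6) (h9 : ¬ c.WritesInt 9) : Fresh s' := by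
  intro t ht k
  rw [hk.ints 6 h6] at ht
  rw [hk.ints 9 h9]
  exact h t ht k

/-- Set the radius and cluster. -/
noncomputable def clusterAt (d : ℕ) (e : Expr .real) : Cmd :=
  .seq (.realSet (V 3) e) (clusterCmd d)

@[simp] theorem clusterAt_writesInt (d : ℕ) (e : Expr .real) {a : ℕ}
    (ha : a ∉ [1, 2, 3, 4, 5, 6, 9, 10, 11, 12]) : ¬ (clusterAt d e).WritesInt a := by
  rintro (h | h)
  · exact h
  · exact clusterCmd_writesInt d ha h

@[simp] theorem clusterAt_writesReal (d : ℕ) (e : Expr .real) {a : ℕ} (ha : a ∉ [3, 4, 8]) :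
    ¬ (clusterAt d e).WritesReal a := by
  simp only [List.mem_cons, not_or] at ha
  rintro (h | h)
  · exact ha.1 h
  · exact clusterCmd_writesReal d (by simp [ha.2]) h

theorem runs_clusterAt (hκ : 1 ≤ κ) (hd : 0 < d) (hr0 : 0 < r) {s : Store σ} (hnd : W.Nodup)
    (hin : HasInput F x ε s) (hW : HoldsList F W rep s) (hfresh : Fresh s) {e : Expr .real}
    (he : e.eval s = r) :
    ∃ s', Runs F κ (clusterAt d e) s s' (clusterTime d * (W.length + 1) + 2) ∧
      Clustered F x ε W rep r s' ∧ s'.reals 3 [] = r := by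
  have hr1 : Runs F κ (.realSet (V 3) e) s (s.setReal (V 3) r) 1 := Runs.realSet hκ he
  have hin1 : HasInput F x ε (s.setReal (V 3) r) := hin.of_keeps hr1.keeps
    (by simp [Cmd.WritesInt]) (by simp [Cmd.WritesReal]) (by simp [Cmd.WritesReal])
    (by simp [Cmd.WritesSketch]) (by simp [Cmd.WritesSketch])
  have hW1 : HoldsList F W rep (s.setReal (V 3) r) := hW.of_keeps hr1.keeps
    (by simp [Cmd.WritesInt]) (by simp [Cmd.WritesInt]) (by simp [Cmd.WritesSketch])
  obtain ⟨s', hr2, hf, hc, ha, hok⟩ := runs_clusterCmd hκ hd hr0 hnd hin1 hW1 (by simp)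
    (hfresh.of_keeps hr1.keeps (by simp [Cmd.WritesInt]) (by simp [Cmd.WritesInt]))
  refine ⟨s', Runs.mono (hr1.seq hκ hr2) (by omega), ⟨?_, hf, ?_, hc, fun c hc => (ha c hc).1,
    fun c hc => (ha c hc).2, ?_⟩, ?_⟩
  · exact hin1.of_keeps hr2.keeps (by simp) (by simp) (by simp) (by simp) (by simp)
  · exact hW1.of_keeps hr2.keeps (by simp) (by simp) (by simp)
  · rw [hok, Succeeds]
    split_ifs with h
    · exact iff_of_true one_pos h
    · exact iff_of_false (lt_irrefl 0) h
  · rw [hr2.keeps.reals 3 (by simp)]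
    simp

/-- The current point is a net point. -/
def netTest : Expr .prop := .and (.intLe (ia 1 (iv 3)) (iv 3)) (.intLe (iv 3) (ia 1 (iv 3)))

/-- The cluster of the current point has at least two elements. -/
def pruneTest : Expr .prop := .intLe (.intLit 2) (ia 10 (ia 1 (iv 3)))

/-- Replace the points by the net points. -/
def toNet : Cmd :=
  .seq (filterCmd netTest) (.seq (forLoop 2 7 copyBody)
    (.realSet (V 6) (.realAdd (rv 6) (.realMul (.ofInt (.intLit 4)) (rv 5)))))

/-- The state of the search: `W` is the current list of points. -/
structure Searching (F : SketchableFamily (Fin n) σ) (x : Fin n → EuclideanSpace ℝ (Fin d))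
    (ε : ℝ) (W : List (Fin n)) (rep : Fin n → Fin n) (δ : ℝ) (s : Store σ) : Prop where
  input : HasInput F x ε s
  fresh : Fresh s
  holds : HoldsList F W rep s
  reduced : Reduced F x W rep δ
  drift : s.reals 6 [] = δ
  going : s.ints 15 [] = 0

theorem runs_filter (hκ : 1 ≤ κ) {s : Store σ} {keep : Fin n → Bool} {p : Expr .prop}
    (hs : HasInput F x ε s) (hf : Fresh s) (hW : HoldsList F W rep s)
    (hp : ∀ s', Keeps (filterCmd p) s s' → ∀ w ∈ W, s'.ints 3 [] = pt w →
      (p.eval s' ↔ keep w = true)) :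
    ∃ s', Runs F κ (filterCmd p) s s' (10 * W.length + 7) ∧ HasInput F x ε s' ∧ Fresh s' ∧
      HoldsList F (W.filter keep) rep s' := by
  obtain ⟨s', h1, h2, h3⟩ := runs_filterCmd hκ hW hp
  refine ⟨s', h1, ?_, ?_, h2, h3, ?_⟩
  · exact hs.of_keeps h1.keeps (by simp [filterCmd, forLoop, filterBody, Cmd.WritesInt])
      (by simp [filterCmd, forLoop, filterBody, Cmd.WritesReal])
      (by simp [filterCmd, forLoop, filterBody, Cmd.WritesReal])
      (by simp [filterCmd, forLoop, filterBody, Cmd.WritesSketch])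
      (by simp [filterCmd, forLoop, filterBody, Cmd.WritesSketch])
  · exact hf.of_keeps h1.keeps (by simp [filterCmd, forLoop, filterBody, Cmd.WritesInt])
      (by simp [filterCmd, forLoop, filterBody, Cmd.WritesInt])
  · rw [h1.keeps.sketches 1 (by simp [filterCmd, forLoop, filterBody, Cmd.WritesSketch])]
    exact fun w hw => hW.sketch w (List.mem_of_mem_filter hw)

/-- After filtering, the cluster sketches of the net points become the sketches of the sets that
they now represent (`fiber_net`). -/
theorem runs_toNet (hκ : 1 ≤ κ) (hd : 0 < d) (hl : 0 < l) {s : Store σ}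
    (hF : ∃ P, IsClustering F P) (hred : Reduced F x W rep δ) (hs : Clustered F x ε W rep l s)
    (hfail : ¬ Succeeds F x W rep l) (hδl : 3 * δ ≤ 4 * l) (h5 : s.reals 5 [] = l)
    (h6 : s.reals 6 [] = δ) (h15 : s.ints 15 [] = 0) :
    ∃ s', Runs F κ toNet s s' (16 * W.length + 13) ∧
      ∃ rep' δ', Searching F x ε (netList W (netCenter x l W)) rep' δ' s' := by
  classical
  have hnet := isNet_netCenter (x := x) hd hl W
  obtain ⟨s1, hr1, hin1, hf1, hW1⟩ := runs_filter (p := netTest)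
    (keep := fun w => decide (netCenter x l W w = w)) hκ hs.input hs.fresh hs.holds
    (by
      intro s' hk w hw h3
      have h1 : s'.ints 1 [pt w] = pt (netCenter x l W w) := by
        rw [hk.ints 1 (by simp [filterCmd, forLoop, filterBody, Cmd.WritesInt]), hs.cen w hw]
      simp only [netTest, Expr.eval, ia_eval, iv_eval, h3, h1, decide_eq_true_eq]
      rw [← pt_inj, le_antisymm_iff])
  change HoldsList F (netList W (netCenter x l W)) rep s1 at hW1
  have hlen : (netList W (netCenter x l W)).length ≤ W.length := List.length_filter_le _ _
  obtain ⟨s2, hr2, hsk⟩ := runs_copyLoop hκ hW1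
    (g := fun w => F.sketch (agg W rep (netCenter x l W) w))
    (by
      intro w hw
      rw [hr1.keeps.sketches 2 (by simp [filterCmd, forLoop, filterBody, Cmd.WritesSketch])]
      exact hs.sketch w (mem_netList.1 hw).1)
  have e5 : s2.reals 5 [] = l := by
    rw [hr2.keeps.reals 5 (by simp [forLoop, copyBody, Cmd.WritesReal]),
      hr1.keeps.reals 5 (by simp [filterCmd, forLoop, filterBody, Cmd.WritesReal]), h5]
  have e6 : s2.reals 6 [] = δ := by
    rw [hr2.keeps.reals 6 (by simp [forLoop, copyBody, Cmd.WritesReal]),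
      hr1.keeps.reals 6 (by simp [filterCmd, forLoop, filterBody, Cmd.WritesReal]), h6]
  have e15 : s2.ints 15 [] = 0 := by
    rw [hr2.keeps.ints 15 (by simp [forLoop, copyBody, Cmd.WritesInt]),
      hr1.keeps.ints 15 (by simp [filterCmd, forLoop, filterBody, Cmd.WritesInt]), h15]
  have hr3 : Runs F κ (.realSet (V 6) (.realAdd (rv 6) (.realMul (.ofInt (.intLit 4)) (rv 5)))) s2
      (s2.setReal (V 6) (δ + 4 * l)) 1 := Runs.realSet hκ (by simp [Expr.eval, e5, e6])
  refine ⟨_, Runs.mono (hr1.seq hκ (hr2.seq hκ hr3)) (by omega),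
    fun q => if rep q ∈ W then netCenter x l W (rep q) else rep q, δ + 4 * l, ?_, ?_, ?_, ?_, ?_, ?_⟩
  · exact (hin1.of_keeps hr2.keeps (by simp [forLoop, copyBody, Cmd.WritesInt])
      (by simp [forLoop, copyBody, Cmd.WritesReal]) (by simp [forLoop, copyBody, Cmd.WritesReal])
      (by simp [forLoop, copyBody, Cmd.WritesSketch])
      (by simp [forLoop, copyBody, Cmd.WritesSketch])).of_keeps hr3.keeps
      (by simp [Cmd.WritesInt]) (by simp [Cmd.WritesReal]) (by simp [Cmd.WritesReal])
      (by simp [Cmd.WritesSketch]) (by simp [Cmd.WritesSketch])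
  · exact (hf1.of_keeps hr2.keeps (by simp [forLoop, copyBody, Cmd.WritesInt])
      (by simp [forLoop, copyBody, Cmd.WritesInt])).of_keeps hr3.keeps (by simp [Cmd.WritesInt])
      (by simp [Cmd.WritesInt])
  · refine ⟨?_, ?_, ?_⟩
    · rw [setReal_ints, hr2.keeps.ints 7 (by simp [forLoop, copyBody, Cmd.WritesInt])]
      exact hW1.len
    · rw [setReal_ints, hr2.keeps.ints 8 (by simp [forLoop, copyBody, Cmd.WritesInt])]
      exact hW1.idx
    · intro w hw
      rw [fiber_net hw]
      exact hsk w hw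
  · exact hred.net hnet hδl hl.le (lt_of_failure hF hred hnet hfail)
  · simp
  · simpa using e15

theorem runs_prune (hκ : 1 ≤ κ) (hd : 0 < d) (hl : 0 < l) {s : Store σ}
    (hF : ∃ P, IsClustering F P) (hred : Reduced F x W rep δ)
    (hs : Clustered F x ε W rep (l / 8) s) (hδ : 64 * δ ≤ l)
    (hopt : (optRadius F x : ℝ) ≤ 4 * (l / 64) + δ)
    (h6 : s.reals 6 [] = δ) (h15 : s.ints 15 [] = 0) :
    ∃ s', Runs F κ (filterCmd pruneTest) s s' (10 * W.length + 7) ∧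
      Searching F x ε (pruned W (netCenter x (l / 8) W)) rep δ s' := by
  have hnet := isNet_netCenter (x := x) hd (r := l / 8) (by positivity) W
  obtain ⟨s1, hr1, hin1, hf1, hW1⟩ := runs_filter (p := pruneTest)
    (keep := fun w => decide (2 ≤ (W.filter fun v =>
      decide (netCenter x (l / 8) W v = netCenter x (l / 8) W w)).length))
    hκ hs.input hs.fresh hs.holds
    (by
      intro s' hk w hw h3
      have h1 : s'.ints 1 [pt w] = pt (netCenter x (l / 8) W w) := by
        rw [hk.ints 1 (by simp [filterCmd, forLoop, filterBody, Cmd.WritesInt]), hs.cen w hw]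
      have h10 := hs.count _ (hnet.cen_mem w hw)
      rw [← hk.ints 10 (by simp [filterCmd, forLoop, filterBody, Cmd.WritesInt])] at h10
      simp only [pruneTest, Expr.eval, ia_eval, iv_eval, h3, h1, h10, decide_eq_true_eq]
      exact Int.ofNat_le (m := 2))
  refine ⟨s1, hr1, hin1, hf1, hW1, hred.prune hF hnet hδ hl hopt, ?_, ?_⟩
  · rw [hr1.keeps.reals 6 (by simp [filterCmd, forLoop, filterBody, Cmd.WritesReal]), h6]
  · rw [hr1.keeps.ints 15 (by simp [filterCmd, forLoop, filterBody, Cmd.WritesInt]), h15]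

/-- One round of the search, after the choice of a random point. -/
noncomputable def round (d : ℕ) : Cmd :=
  .seq (nearestCmd d) (.seq (clusterAt d (rv 5))
    (.ite (.intLe (iv 11) (.intLit 0)) toNet
      (.seq (clusterAt d (.realDiv (rv 5) (.ofInt (.intLit 64))))
        (.ite (.and (.intLe (.intLit 1) (iv 11))
            (.realLe (.realMul (.ofInt (.intLit 64)) (rv 6)) (rv 5)))
          (.seq (clusterAt d (.realDiv (rv 5) (.ofInt (.intLit 8)))) (filterCmd pruneTest))
          (.seq (.intSet (V 15) (.intLit 1))
            (.realSet (V 7) (.realDiv (rv 5) (.ofInt (.intLit 1024)))))))))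

/-- The search has found a lower bound `r₀` for the radius that is tight up to a constant factor. -/
structure Found (F : SketchableFamily (Fin n) σ) (x : Fin n → EuclideanSpace ℝ (Fin d))
    (ε r₀ : ℝ) (s : Store σ) : Prop where
  input : HasInput F x ε s
  fresh : Fresh s
  pos : 0 < r₀
  le : r₀ ≤ optRadius F x
  ge : (optRadius F x : ℝ) ≤ 6000 * r₀

/-- Failure at `l` leads to the net. Success at `l / 64` together with `64 * δ ≤ l` shows that `l`
is much too large and permits pruning. Otherwise `l` has the right order of magnitude. Which
shrinking step applies is not known in advance, so the bound on the new length uses the smaller rank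
of the chosen point. -/
theorem runs_round (hκ : 1 ≤ κ) (hd : 0 < d) (hF : ∃ P, IsClustering F P)
    (hx : Function.Injective x) {s : Store σ} (hs : HasInput F x ε s) (hf : Fresh s)
    (hW : HoldsList F W rep s) (hred : Reduced F x W rep δ) (h6 : s.reals 6 [] = δ)
    (h15 : s.ints 15 [] = 0) {nn : Fin n → ℝ} (hnn : IsNearest x W nn) {v : ℕ}
    (hv : v < W.length) (h14 : s.ints 14 [] = v) :
    ∃ s', Runs F κ (round d) s s' ((3 * clusterTime d + 50) * (W.length + 1)) ∧
      ((∃ W' rep' δ', Searching F x ε W' rep' δ' s' ∧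
        min (W.toFinset.filter fun q => nn q ≤ nn W[v]).card
          (W.toFinset.filter fun q => nn W[v] ≤ nn q).card + 2 * W'.length ≤ 2 * W.length) ∨
      ∃ r₀, Found F x ε r₀ s' ∧ s'.ints 15 [] = 1 ∧ s'.reals 7 [] = r₀) := by
  set l := nn W[v] with hl_def
  have hpW : W[v] ∈ W := List.getElem_mem hv
  have hl : 0 < l := hnn.pos hx hpW
  -- The separation invariant, applied to the chosen point and its nearest neighbour.
  have hδl : 3 * δ ≤ 4 * l := by
    obtain ⟨u, hu, hne, hd⟩ := (hnn _ hpW).2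
    rw [hl_def, ← hd]
    exact hred.sep _ hpW u hu hne.symm
  have hδ0 := hred.nonneg
  have hδo := hred.le_opt
  obtain ⟨s1, hr1, h5⟩ := runs_nearestCmd hκ hs hW hnn hv h14
  have hin1 : HasInput F x ε s1 := hs.of_keeps hr1.keeps
    (by simp [nearestCmd, forLoop, nearestBody, Cmd.WritesInt])
    (by simp [nearestCmd, forLoop, nearestBody, Cmd.WritesReal])
    (by simp [nearestCmd, forLoop, nearestBody, Cmd.WritesReal])
    (by simp [nearestCmd, forLoop, nearestBody, Cmd.WritesSketch])
    (by simp [nearestCmd, forLoop, nearestBody, Cmd.WritesSketch])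
  have hf1 : Fresh s1 := hf.of_keeps hr1.keeps
    (by simp [nearestCmd, forLoop, nearestBody, Cmd.WritesInt])
    (by simp [nearestCmd, forLoop, nearestBody, Cmd.WritesInt])
  have hW1 : HoldsList F W rep s1 := hW.of_keeps hr1.keeps
    (by simp [nearestCmd, forLoop, nearestBody, Cmd.WritesInt])
    (by simp [nearestCmd, forLoop, nearestBody, Cmd.WritesInt])
    (by simp [nearestCmd, forLoop, nearestBody, Cmd.WritesSketch])
  have e6 : s1.reals 6 [] = δ := by
    rw [hr1.keeps.reals 6 (by simp [nearestCmd, forLoop, nearestBody, Cmd.WritesReal]), h6]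
  have e15 : s1.ints 15 [] = 0 := by
    rw [hr1.keeps.ints 15 (by simp [nearestCmd, forLoop, nearestBody, Cmd.WritesInt]), h15]
  obtain ⟨s2, hr2, hc2, -⟩ := runs_clusterAt (F := F) (x := x) (r := l) hκ hd hl hred.nodup hin1 hW1
    hf1 (e := rv 5) (by rw [rv_eval, h5])
  have h5' : s2.reals 5 [] = l := by rw [hr2.keeps.reals 5 (by simp), h5]
  have e6' : s2.reals 6 [] = δ := by rw [hr2.keeps.reals 6 (by simp), e6]
  have e15' : s2.ints 15 [] = 0 := by rw [hr2.keeps.ints 15 (by simp), e15]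
  by_cases hok : Succeeds F x W rep l
  · have h11 : 0 < s2.ints 11 [] := hc2.ok.2 hok
    have hup := optRadius_le_of_success hred (isNet_netCenter hd hl W) hl.le hok
    have hl64 : 0 < l / 64 := by positivity
    obtain ⟨s3, hr3, hc3, -⟩ := runs_clusterAt (F := F) (x := x) (r := l / 64) hκ hd hl64 hred.nodup
      hc2.input hc2.holds hc2.fresh (e := .realDiv (rv 5) (.ofInt (.intLit 64)))
      (by simp [Expr.eval, h5'])
    have h5'' : s3.reals 5 [] = l := by rw [hr3.keeps.reals 5 (by simp), h5']
    have e6'' : s3.reals 6 [] = δ := by rw [hr3.keeps.reals 6 (by simp), e6']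
    have e15'' : s3.ints 15 [] = 0 := by rw [hr3.keeps.ints 15 (by simp), e15']
    by_cases hcond : Succeeds F x W rep (l / 64) ∧ 64 * δ ≤ l
    · have hup' := optRadius_le_of_success hred (isNet_netCenter hd hl64 W) hl64.le hcond.1
      have hl8 : 0 < l / 8 := by positivity
      obtain ⟨s4, hr4, hc4, -⟩ := runs_clusterAt (F := F) (x := x) (r := l / 8) hκ hd hl8 hred.nodup
        hc3.input hc3.holds hc3.fresh (e := .realDiv (rv 5) (.ofInt (.intLit 8)))
        (by simp [Expr.eval, h5''])
      obtain ⟨s5, hr5, hs5⟩ := runs_prune hκ hd hl hF hred hc4 hcond.2 hup'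
        (by rw [hr4.keeps.reals 6 (by simp), e6'']) (by rw [hr4.keeps.ints 15 (by simp), e15''])
      refine ⟨s5, Runs.mono (hr1.seq hκ (hr2.seq hκ (Runs.ite_neg hκ ?_ (hr3.seq hκ
        (Runs.ite_pos hκ ?_ (hr4.seq hκ hr5)))))) ?_, Or.inl ⟨_, _, _, hs5, ?_⟩⟩
      · simpa [Expr.eval] using h11
      · have := hc3.ok.2 hcond.1
        simp only [Expr.eval, iv_eval, rv_eval, h5'', e6'']
        exact ⟨(by omega : (1 : ℤ) ≤ s3.ints 11 []), by simpa using hcond.2⟩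
      · ring_nf; omega
      · have h := card_add_length_pruned hred.nodup hnn hl
          (isNet_netCenter (x := x) hd hl8 W)
        have h' := min_le_right (W.toFinset.filter fun q => nn q ≤ l).card
          (W.toFinset.filter fun q => l ≤ nn q).card
        have h'' : (pruned W (netCenter x (l / 8) W)).length ≤ W.length :=
          List.length_filter_le _ _
        omega
    · have hr4 : Runs F κ (.intSet (V 15) (.intLit 1)) s3 (s3.setInt (V 15) 1) 1 :=
        Runs.intSet hκ (by simp [Expr.eval])
      have hr5 : Runs F κ (.realSet (V 7) (.realDiv (rv 5) (.ofInt (.intLit 1024))))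
          (s3.setInt (V 15) 1) ((s3.setInt (V 15) 1).setReal (V 7) (l / 1024)) 1 :=
        Runs.realSet hκ (by simp [Expr.eval, h5''])
      refine ⟨_, Runs.mono (hr1.seq hκ (hr2.seq hκ (Runs.ite_neg hκ ?_ (hr3.seq hκ
        (Runs.ite_neg hκ ?_ (hr4.seq hκ hr5)))))) ?_,
        Or.inr ⟨l / 1024, ⟨?_, ?_, by positivity, ?_, ?_⟩, by simp, by simp⟩⟩
      · simpa [Expr.eval] using h11
      · simp only [Expr.eval, iv_eval, rv_eval, h5'', e6'']
        rintro ⟨h1, h2⟩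
        exact hcond ⟨hc3.ok.1 (Int.lt_iff_add_one_le.2 h1), by simpa using h2⟩
      · ring_nf; omega
      · exact (hc3.input.of_keeps hr4.keeps (by simp [Cmd.WritesInt]) (by simp [Cmd.WritesReal])
          (by simp [Cmd.WritesReal]) (by simp [Cmd.WritesSketch])
          (by simp [Cmd.WritesSketch])).of_keeps hr5.keeps (by simp [Cmd.WritesInt])
          (by simp [Cmd.WritesReal]) (by simp [Cmd.WritesReal]) (by simp [Cmd.WritesSketch])
          (by simp [Cmd.WritesSketch])
      · exact (hc3.fresh.of_keeps hr4.keeps (by simp [Cmd.WritesInt])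
          (by simp [Cmd.WritesInt])).of_keeps hr5.keeps (by simp [Cmd.WritesInt])
          (by simp [Cmd.WritesInt])
      -- If `64 * δ ≤ l`, failure at `l / 64` gives `l < 128 * opt`. Otherwise `l < 64 * δ ≤ 64 * 16
      -- * opt`, whence the divisor `1024`.
      · by_cases h64 : 64 * δ ≤ l
        · have hf64 : ¬ Succeeds F x W rep (l / 64) := fun h => hcond ⟨h, h64⟩
          have := lt_of_failure hF hred (isNet_netCenter hd hl64 W) hf64
          linarith
        · linarith
      -- Success at `l` gives `opt ≤ 4 * l + δ ≤ 16 * l / 3`, and `1024 * 16 / 3 < 6000`.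
      · linarith
  · obtain ⟨s3, hr3, rep', δ', hs3⟩ := runs_toNet hκ hd hl hF hred hc2 hok hδl h5' e6' e15'
    refine ⟨s3, Runs.mono (hr1.seq hκ (hr2.seq hκ (Runs.ite_pos hκ ?_ hr3))) ?_,
      Or.inl ⟨_, _, _, hs3, ?_⟩⟩
    · simpa [Expr.eval] using fun h => hok (hc2.ok.1 h)
    · ring_nf; omega
    · have h := card_add_length_netList hred.nodup hnn hl.le (isNet_netCenter (x := x) hd hl W)
      have h' := min_le_left (W.toFinset.filter fun q => nn q ≤ l).card
          (W.toFinset.filter fun q => l ≤ nn q).card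
      omega

end SketchRAM

namespace SketchRAM

open MinMaxClustering

variable {d n : ℕ} {σ : Type*} {F : SketchableFamily (Fin n) σ}
  {x : Fin n → EuclideanSpace ℝ (Fin d)} {ε r δ l : ℝ} {κ : ℕ}
  {W : List (Fin n)} {rep : Fin n → Fin n}

/-! ### The search for the scale of the optimal radius -/

/-- Net and prune: repeat rounds with random points. -/
noncomputable def searchLoop (d : ℕ) : Cmd :=
  .while (.and (.intLe (.intLit 2) (iv 7)) (.intLe (iv 15) (.intLit 0)))
    (.seq (.draw (V 14) (iv 7)) (round d))

/-- What holds after the search. -/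
def SearchEnd (F : SketchableFamily (Fin n) σ) (x : Fin n → EuclideanSpace ℝ (Fin d)) (ε : ℝ)
    (s : Store σ) : Prop :=
  (∃ W rep δ, Searching F x ε W rep δ s ∧ W.length ≤ 1) ∨
    ∃ r₀, Found F x ε r₀ s ∧ s.ints 15 [] = 1 ∧ s.reals 7 [] = r₀

/-- The expected time of the search is at most proportional to this number and the number of
points. -/
noncomputable def searchTime (d : ℕ) : ℕ := 12 * (2 * (3 * clusterTime d + 50) + 3)

/-- A round that continues leaves `W'` with `12 * W'.length ≤ 12 * W.length - 6 * g v`. By the rank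
estimate the average of the right side is at most `11 * W.length`. The subtraction is not truncated,
since `g v ≤ W.length`. -/
theorem sum_expected_sizes_le (hW : W.Nodup) (nn : Fin n → ℝ) (g : ℕ → ℕ)
    (hg : ∀ (v : ℕ) (h : v < W.length), g v =
      min (W.toFinset.filter fun q => nn q ≤ nn W[v]).card
        (W.toFinset.filter fun q => nn W[v] ≤ nn q).card) :
    ∑ v ∈ Finset.range W.length, (12 * W.length - 6 * g v) ≤ 11 * W.length ^ 2 := by
  have hcard : W.toFinset.card = W.length := List.toFinset_card_of_nodup hW
  have h1 := sq_card_le_six_mul_sum_min W.toFinset nn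
  rw [hcard, List.sum_toFinset _ hW, ← Fin.sum_univ_fun_getElem,
    ← Finset.sum_congr rfl (fun (v : Fin W.length) _ => hg v v.2), ← Finset.sum_range,
    Finset.mul_sum] at h1
  have h2 : ∑ v ∈ Finset.range W.length, (12 * W.length - 6 * g v) +
      ∑ v ∈ Finset.range W.length, 6 * g v = 12 * W.length ^ 2 := by
    rw [← Finset.sum_add_distrib]
    have : ∀ v ∈ Finset.range W.length, 12 * W.length - 6 * g v + 6 * g v = 12 * W.length := by
      intro v hv
      have h3 : g v ≤ W.length := by
        rw [hg v (Finset.mem_range.1 hv)]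
        exact ((min_le_left _ _).trans (Finset.card_filter_le _ _)).trans hcard.le
      omega
    rw [Finset.sum_congr rfl this, Finset.sum_const, Finset.card_range, smul_eq_mul]
    ring
  omega

/-- Strong induction on the length, with a potential proportional to the length: on average a
twelfth of it is released in each round and pays for the linear cost of that round. `B` bounds the
time after the loop. -/
theorem wp_searchLoop (hκ : 1 ≤ κ) (hd : 0 < d) (hF : ∃ P, IsClustering F P)
    (hx : Function.Injective x) {k : List Cmd} {Q : Store σ → Prop} {B : ℕ}
    (hB : ∀ s, SearchEnd F x ε s → WP F κ (k, s) Q (B : ℝ≥0∞)) {s : Store σ}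
    (hs : Searching F x ε W rep δ s) :
    WP F κ (searchLoop d :: k, s) Q ((B + κ * (searchTime d * W.length) + κ : ℕ) : ℝ≥0∞) := by
  classical
  have hend : ∀ s, SearchEnd F x ε s →
      ¬ (Expr.and (.intLe (.intLit 2) (iv 7)) (.intLe (iv 15) (.intLit 0))).eval s →
      WP F κ (searchLoop d :: k, s) Q ((B + κ : ℕ) : ℝ≥0∞) := by
    intro s hs hg
    refine (WP.of_pure hκ (c' := (k, s)) ?_ (hB s hs)).mono (by push_cast; exact le_rfl)
    rw [searchLoop, step, if_neg hg]
  induction hm : W.length using Nat.strong_induction_on generalizing W rep δ s with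
  | _ m ih =>
  by_cases h2 : W.length ≤ 1
  · refine (hend s (Or.inl ⟨W, rep, δ, hs, h2⟩) ?_).mono ?_
    · simp only [Expr.eval, iv_eval, hs.holds.len]
      rintro ⟨h, -⟩
      have h' : (2 : ℤ) ≤ (W.length : ℤ) := h
      omega
    · norm_cast; omega
  · obtain ⟨nn, hnn⟩ := exists_isNearest x hs.reduced.nodup (by omega)
    set g : ℕ → ℕ := fun v => if h : v < W.length then
      min (W.toFinset.filter fun q => nn q ≤ nn W[v]).card
        (W.toFinset.filter fun q => nn W[v] ≤ nn q).card else 0 with hg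
    have hgv : ∀ (v : ℕ) (h : v < W.length), g v =
      min (W.toFinset.filter fun q => nn q ≤ nn W[v]).card
        (W.toFinset.filter fun q => nn W[v] ≤ nn q).card := fun v h => by simp [hg, h]
    -- The chosen point counts in both ranks, so the list becomes strictly shorter whatever is
    -- drawn; the induction needs this.
    have hg1 : ∀ v < W.length, 1 ≤ g v := by
      intro v hv
      have hmem : W[v] ∈ W.toFinset := by simp
      rw [hgv v hv]
      refine le_min (Finset.card_pos.2 ⟨W[v], ?_⟩) (Finset.card_pos.2 ⟨W[v], ?_⟩) <;>
        simp
    set T := (3 * clusterTime d + 50) * (W.length + 1) with hT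
    set a := 2 * (3 * clusterTime d + 50) + 3 with ha
    have hround : ∀ v < W.length, WP F κ (round d :: searchLoop d :: k, s.setInt (V 14) (v : ℤ)) Q
        ((B + κ + κ * T + κ * (a * (12 * W.length - 6 * g v)) : ℕ) : ℝ≥0∞) := by
      intro v hv
      have hk : Keeps (.intSet (V 14) (.intLit 0)) s (s.setInt (V 14) (v : ℤ)) := keeps_setInt rfl
      obtain ⟨s', hr, hs'⟩ := runs_round (s := s.setInt (V 14) (v : ℤ)) hκ hd hF hx
        (hs.input.of_keeps hk (by simp [Cmd.WritesInt]) (by simp [Cmd.WritesReal])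
          (by simp [Cmd.WritesReal]) (by simp [Cmd.WritesSketch]) (by simp [Cmd.WritesSketch]))
        (hs.fresh.of_keeps hk (by simp [Cmd.WritesInt]) (by simp [Cmd.WritesInt]))
        (hs.holds.of_keeps hk (by simp [Cmd.WritesInt]) (by simp [Cmd.WritesInt])
          (by simp [Cmd.WritesSketch])) hs.reduced (by simpa using hs.drift)
        (by simpa using hs.going) hnn hv (by simp)
      rcases hs' with ⟨W', rep', δ', hs', hle⟩ | ⟨r₀, hfound, h15, h7⟩
      · rw [← hgv v hv] at hle
        have h1 := hg1 v hv
        have := hr.wp _ _ _ (ih W'.length (by omega) hs' rfl)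
        refine this.mono ?_
        rw [← hT]
        norm_cast
        have h3 : 12 * W'.length ≤ 12 * W.length - 6 * g v := by omega
        have h4 : searchTime d * W'.length ≤ a * (12 * W.length - 6 * g v) := by
          calc searchTime d * W'.length = a * (12 * W'.length) := by rw [searchTime]; ring
            _ ≤ _ := Nat.mul_le_mul_left a h3
        have h5 := Nat.mul_le_mul_left κ h4
        omega
      · have := hr.wp _ _ _ (hend s' (Or.inr ⟨r₀, hfound, h15, h7⟩) (by
          simp only [Expr.eval, iv_eval, h15]
          rintro ⟨-, h⟩
          exact absurd h (by norm_num)))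
        refine this.mono ?_
        rw [← hT]
        norm_cast
        omega
    have hdraw := WP.draw (F := F) (l := V 14) (p := iv 7) (s := s) hκ (by omega : 0 < W.length)
      (by simpa using hs.holds.len) hround
    have h1 := WP.of_pure (F := F) (c := .seq (.draw (V 14) (iv 7)) (round d))
      (k := searchLoop d :: k) (s := s) hκ rfl hdraw
    have h3 : step F (searchLoop d :: k, s) =
        PMF.pure (.seq (.draw (V 14) (iv 7)) (round d) :: searchLoop d :: k, s) := by
      rw [searchLoop, step, if_pos]
      simp only [Expr.eval, iv_eval, hs.holds.len, hs.going]
      exact ⟨(by omega : (2 : ℤ) ≤ (W.length : ℤ)), le_refl (0 : ℤ)⟩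
    refine (WP.of_pure hκ h3 h1).mono ?_
    have hsum := sum_expected_sizes_le hs.reduced.nodup nn g hgv
    have hnat : ∑ v ∈ Finset.range W.length, (B + κ + κ * T + κ * (a * (12 * W.length - 6 * g v))) ≤
        (B + κ + κ * T + κ * (a * (11 * W.length))) * W.length := by
      rw [Finset.sum_add_distrib, Finset.sum_const, Finset.card_range, smul_eq_mul,
        ← Finset.mul_sum, ← Finset.mul_sum]
      calc _ ≤ W.length * (B + κ + κ * T) + κ * (a * (11 * W.length ^ 2)) := by gcongr
        _ = _ := by ring
    have hdiv : (∑ v ∈ Finset.range W.length,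
        ((B + κ + κ * T + κ * (a * (12 * W.length - 6 * g v)) : ℕ) : ℝ≥0∞)) / (W.length : ℝ≥0∞) ≤
        ((B + κ + κ * T + κ * (a * (11 * W.length)) : ℕ) : ℝ≥0∞) := by
      refine ENNReal.div_le_of_le_mul ?_
      exact_mod_cast hnat
    calc _ ≤ (κ : ℝ≥0∞) + ((B + κ + κ * T + κ * (a * (11 * W.length)) : ℕ) : ℝ≥0∞) + κ + κ := by
          gcongr
      _ ≤ _ := by
        norm_cast
        -- The released twelfth of the potential covers the round and three bookkeeping steps: loop
        -- test, sequencing and draw.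
        have h4 : T + 3 ≤ a * W.length := by
          rw [hT, ha]
          have : 1 ≤ W.length := by omega
          nlinarith
        have h5 := Nat.mul_le_mul_left κ h4
        have h6 : κ * (searchTime d * m) = κ * (a * (11 * W.length)) + κ * (a * W.length) := by
          rw [searchTime, ← hm]; ring
        rw [h6]
        ring_nf at h5 ⊢
        omega

/-! ### The final approximation -/

theorem univ_mem (hF : ∃ P, IsClustering F P) (hn : 0 < n) :
    (Finset.univ : Finset (Fin n)) ∈ F.family := by
  obtain ⟨P, hP⟩ := hF
  obtain ⟨S, hS, -⟩ := P.exists_mem (Finset.mem_univ (⟨0, hn⟩ : Fin n))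
  exact F.upwardClosed S (hP S hS) _ (Finset.subset_univ _)

/-- Take all the points, with their input sketches. -/
def initBody : Cmd := .seq (.intSet (A 8 (iv 2)) (iv 2)) (.copy (A 1 (iv 2)) (A 0 (iv 2)))

def initCmd : Cmd := .seq (.intSet (V 7) (iv 0)) (forLoop 2 7 initBody)

theorem runs_initCmd (hκ : 1 ≤ κ) {s : Store σ} (hs : HasInput F x ε s) (hf : Fresh s) :
    ∃ s', Runs F κ initCmd s s' (6 * n + 5) ∧ HasInput F x ε s' ∧ Fresh s' ∧
      HoldsList F (List.finRange n) id s' := by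
  have hr1 : Runs F κ (.intSet (V 7) (iv 0)) s (s.setInt (V 7) n) 1 :=
    Runs.intSet hκ (by simp [hs.card])
  have hin1 : HasInput F x ε (s.setInt (V 7) n) := hs.of_keeps hr1.keeps (by simp [Cmd.WritesInt])
    (by simp [Cmd.WritesReal]) (by simp [Cmd.WritesReal]) (by simp [Cmd.WritesSketch])
    (by simp [Cmd.WritesSketch])
  obtain ⟨s2, hr2, h8, hsk⟩ := Runs.forLoop (F := F) (s := s.setInt (V 7) n) hκ
    (body := initBody) (v := 2) (b := 7) (m := n)
    (by simp [initBody, Cmd.LoopFree]) (by simp [initBody, Cmd.WritesInt])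
    (by simp [initBody, Cmd.WritesInt]) (by norm_num) (by simp)
    (fun i s' => (∀ j < i, s'.ints 8 [((j : ℕ) : ℤ)] = (j : ℤ)) ∧
      ∀ w : Fin n, (w : ℕ) < i → s'.sketches 1 [pt w] = F.sketch {w})
    (by
      intro i s' z h
      simpa using h)
    (by simp)
    (by
      rintro i hi s' hk hv ⟨h8, hsk⟩
      have h0 : s'.sketches 0 = s.sketches 0 := by
        rw [hk.sketches 0 (by simp [forLoop, initBody, Cmd.WritesSketch])]; simp
      constructor
      · intro j hj
        by_cases hji : j = i
        · simp [initBody, run, hv, hji]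
        · simpa [initBody, run, hv, hji] using h8 j (by omega)
      · intro w hw
        by_cases hwi : (w : ℕ) = i
        · have : (i : ℤ) = pt w := by simp [pt, hwi]
          simp [initBody, run, hv, this, h0, hs.sketch]
        · have : pt w ≠ (i : ℤ) := by simpa [pt] using hwi
          simpa [initBody, run, hv, this] using hsk w (by omega))
  have hsize : initBody.size = 3 := rfl
  refine ⟨s2, Runs.mono (hr1.seq hκ hr2) (by rw [hsize]; omega), ?_, ?_, ?_, ?_, ?_⟩
  · exact hin1.of_keeps hr2.keeps (by simp [forLoop, initBody, Cmd.WritesInt])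
      (by simp [forLoop, initBody, Cmd.WritesReal]) (by simp [forLoop, initBody, Cmd.WritesReal])
      (by simp [forLoop, initBody, Cmd.WritesSketch])
      (by simp [forLoop, initBody, Cmd.WritesSketch])
  · exact (hf.of_keeps hr1.keeps (by simp [Cmd.WritesInt]) (by simp [Cmd.WritesInt])).of_keeps
      hr2.keeps (by simp [forLoop, initBody, Cmd.WritesInt])
      (by simp [forLoop, initBody, Cmd.WritesInt])
  · rw [hr2.keeps.ints 7 (by simp [forLoop, initBody, Cmd.WritesInt])]
    simp
  · intro i hi
    rw [h8 i (by simpa using hi)]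
    simp [pt]
  · intro w _
    rw [hsk w w.2]
    congr 1
    ext q
    simp

/-- Increase the radius slightly until the oracle accepts all clusters. -/
noncomputable def retryLoop (d : ℕ) : Cmd :=
  .while (.intLe (iv 11) (.intLit 0)) (clusterAt d (.realMul (rv 3)
    (.realAdd (.ofInt (.intLit 1)) (.realDiv (rv 0) (.ofInt (.intLit 4))))))

/-- On the original points the error is zero, so failure means `r < opt`, and the next radius is at
most `(1 + ε / 4) * opt`. Here `j` bounds the number of increases after which `r` would reach the
optimum. -/
theorem runs_retryLoop (hκ : 1 ≤ κ) (hd : 0 < d) (hn : 0 < n) (hF : ∃ P, IsClustering F P)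
    (hε : 0 < ε) (j : ℕ) {s : Store σ} (hr0 : 0 < r)
    (hs : Clustered F x ε (List.finRange n) id r s) (h3 : s.reals 3 [] = r)
    (hr : r ≤ (1 + ε / 4) * optRadius F x) (hj : (optRadius F x : ℝ) ≤ (1 + ε / 4) ^ j * r) :
    ∃ s' r', Runs F κ (retryLoop d) s s' ((clusterTime d * (n + 1) + 3) * j + 1) ∧ 0 < r' ∧
      Clustered F x ε (List.finRange n) id r' s' ∧ Succeeds F x (List.finRange n) id r' ∧
      s'.reals 3 [] = r' ∧ r' ≤ (1 + ε / 4) * optRadius F x := by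
  have hred := reduced_initial (x := x) (univ_mem hF hn)
  induction j generalizing s r with
  | zero =>
    by_cases hok : Succeeds F x (List.finRange n) id r
    · refine ⟨s, r, Runs.mono (Runs.while_neg hκ ?_) (by omega), hr0, hs, hok, h3, hr⟩
      simpa [Expr.eval] using hs.ok.2 hok
    · have := lt_of_failure hF hred (isNet_netCenter hd hr0 _) hok
      rw [pow_zero, one_mul] at hj
      linarith
  | succ j ih =>
    by_cases hok : Succeeds F x (List.finRange n) id r
    · refine ⟨s, r, Runs.mono (Runs.while_neg hκ ?_) (by omega), hr0, hs, hok, h3, hr⟩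
      simpa [Expr.eval] using hs.ok.2 hok
    · have hlt := lt_of_failure hF hred (isNet_netCenter hd hr0 _) hok
      have hr1 : 0 < r * (1 + ε / 4) := by positivity
      obtain ⟨s1, hrun1, hs1, h31⟩ := runs_clusterAt (F := F) (x := x) (r := r * (1 + ε / 4)) hκ hd
        hr1 (List.nodup_finRange n) hs.input hs.holds hs.fresh (e := .realMul (rv 3)
          (.realAdd (.ofInt (.intLit 1)) (.realDiv (rv 0) (.ofInt (.intLit 4)))))
        (by simp [Expr.eval, h3, hs.input.eps])
      have hle : r * (1 + ε / 4) ≤ (1 + ε / 4) * optRadius F x := by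
        rw [mul_comm]
        have : r ≤ optRadius F x := by linarith
        gcongr
      obtain ⟨s2, r', hrun2, h⟩ := ih hr1 hs1 h31 hle (by rw [pow_succ] at hj; linarith)
      refine ⟨s2, r', Runs.mono (Runs.while_pos hκ ?_ hrun1 hrun2) ?_, h⟩
      · simpa [Expr.eval] using fun h => hok (hs.ok.1 h)
      · rw [List.length_finRange]
        ring_nf
        omega

noncomputable def finalCmd (d : ℕ) : Cmd :=
  .seq initCmd (.seq (clusterAt d (rv 7)) (.seq (retryLoop d)
    (.realSet (V 2) (.realMul (.ofInt (.intLit 4)) (rv 3)))))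

/-- The memory holds a correct output. -/
def Correct (F : SketchableFamily (Fin n) σ) (x : Fin n → EuclideanSpace ℝ (Fin d)) (ε : ℝ)
    (s : Store σ) : Prop :=
  ∃ (center : Fin n → Fin n) (R : ℝ), Outputs s center R ∧ IsApproxClustering F x ε center R

theorem runs_finalCmd (hκ : 1 ≤ κ) (hd : 0 < d) (hn : 0 < n) (hF : ∃ P, IsClustering F P)
    (hε : 0 < ε) {J : ℕ} (hJ : 6000 ≤ (1 + ε / 4) ^ J) {r₀ : ℝ} {s : Store σ}
    (hs : Found F x ε r₀ s) (h7 : s.reals 7 [] = r₀) :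
    ∃ s', Runs F κ (finalCmd d) s s' ((clusterTime d + 9) * (n + 1) * (J + 2)) ∧
      Correct F x ε s' := by
  obtain ⟨s1, hr1, hin1, hf1, hW1⟩ := runs_initCmd hκ hs.input hs.fresh
  obtain ⟨s2, hr2, hs2, h32⟩ := runs_clusterAt (F := F) (x := x) (r := r₀) hκ hd hs.pos
    (List.nodup_finRange n) hin1 hW1 hf1 (e := rv 7)
    (by rw [rv_eval, hr1.keeps.reals 7 (by simp [initCmd, forLoop, initBody, Cmd.WritesReal]), h7])
  have hopt : (0 : ℝ) ≤ optRadius F x := NNReal.coe_nonneg _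
  obtain ⟨s3, r, hr3, hr0, hs3, hok, h33, hr⟩ := runs_retryLoop hκ hd hn hF hε J hs.pos hs2 h32
    (hs.le.trans (le_mul_of_one_le_left hopt (by linarith)))
    (hs.ge.trans (mul_le_mul_of_nonneg_right hJ hs.pos.le))
  have hr4 : Runs F κ (.realSet (V 2) (.realMul (.ofInt (.intLit 4)) (rv 3))) s3
      (s3.setReal (V 2) (4 * r)) 1 := Runs.realSet hκ (by simp [Expr.eval, h33])
  have hnet := isNet_netCenter (x := x) hd hr0 (List.finRange n)
  refine ⟨_, Runs.mono (hr1.seq hκ (hr2.seq hκ (hr3.seq hκ hr4))) ?_,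
    netCenter x r (List.finRange n), 4 * r, ⟨?_, by simp⟩, ⟨?_, ?_, ?_, ?_⟩⟩
  · rw [List.length_finRange]
    nlinarith [Nat.zero_le (n * J), Nat.zero_le J, Nat.zero_le n]
  · intro i
    exact hs3.cen i (List.mem_finRange i)
  · exact fun i => hnet.cen_cen i (List.mem_finRange i)
  · intro i
    simpa [agg] using hok i (List.mem_finRange i)
  · exact fun i => hnet.dist_le i (List.mem_finRange i)
  · linarith

/-! ### The whole algorithm -/

/-- Query the oracle for the singletons. -/
def testBody : Cmd :=
  .seq (.query (V 12) (A 0 (iv 2)))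
    (.ite (.intLe (iv 12) (.intLit 0)) (.intSet (V 11) (.intLit 0)) .skip)

/-- Min-max clustering by net and prune. -/
noncomputable def clusteringProgram (d : ℕ) : Cmd :=
  .seq (.intSet (V 11) (.intLit 1)) (.seq (forLoop 2 0 testBody)
    (.ite (.intLe (.intLit 1) (iv 11)) (forLoop 2 0 (.intSet (A 1 (iv 2)) (iv 2)))
      (.seq initCmd (.seq (searchLoop d) (.seq
        (.ite (.intLe (iv 15) (.intLit 0))
          (.realSet (V 7) (.realDiv (rv 6) (.ofInt (.intLit 16)))) .skip)
        (finalCmd d))))))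

open Classical in
theorem runs_testLoop (hκ : 1 ≤ κ) {s : Store σ} (hs : HasInput F x ε s)
    (h11 : s.ints 11 [] = 1) :
    ∃ s', Runs F κ (forLoop 2 0 testBody) s s' (8 * n + 3) ∧
      s'.ints 11 [] = if ∀ i : Fin n, {i} ∈ F.family then 1 else 0 := by
  obtain ⟨s', hr, h⟩ := Runs.forLoop (F := F) hκ (body := testBody) (v := 2) (b := 0)
    (by simp [testBody, Cmd.LoopFree]) (by simp [testBody, Cmd.WritesInt])
    (by simp [testBody, Cmd.WritesInt]) (by norm_num) hs.card
    (fun i s' => s'.ints 11 [] = if ∀ j : Fin n, (j : ℕ) < i → {j} ∈ F.family then 1 else 0)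
    (by
      intro i s' z h
      simpa using h)
    (by simpa using h11)
    (by
      intro i hi s' hk hv h
      set w : Fin n := ⟨i, hi⟩ with hw
      have hpt : (i : ℤ) = pt w := by simp [pt, hw]
      have h0 : s'.sketches 0 [(i : ℤ)] = F.sketch {w} := by
        rw [hk.sketches 0 (by simp [forLoop, testBody, Cmd.WritesSketch]), hpt, hs.sketch]
      have hor := F.oracle_sketch {w}
      have hall : (∀ j : Fin n, (j : ℕ) < i + 1 → {j} ∈ F.family) ↔
          (∀ j : Fin n, (j : ℕ) < i → {j} ∈ F.family) ∧ {w} ∈ F.family := by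
        constructor
        · exact fun h => ⟨fun j hj => h j (by omega), h w (by simp [hw])⟩
        · rintro ⟨h1, h2⟩ j hj
          rcases Nat.lt_succ_iff_lt_or_eq.1 hj with hj | hj
          · exact h1 j hj
          · have : j = w := Fin.ext hj
            rwa [this]
      simp only [hall]
      by_cases hm : {w} ∈ F.family
      · simp [testBody, run, Expr.eval, hv, h0, hor.2 hm, h, hm]
      · have h4 : ¬ F.oracle (F.sketch {w}) = true := fun h' => hm (hor.1 h')
        simp [testBody, run, Expr.eval, hv, h0, h4, hm])
  have hsize : testBody.size = 5 := rfl
  rw [hsize] at hr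
  exact ⟨s', hr, by simpa using h⟩

theorem runs_identityLoop (hκ : 1 ≤ κ) {s : Store σ} (hs : HasInput F x ε s) :
    ∃ s', Runs F κ (forLoop 2 0 (.intSet (A 1 (iv 2)) (iv 2))) s s' (4 * n + 3) ∧
      ∀ i : Fin n, s'.ints 1 [pt i] = pt i := by
  obtain ⟨s', hr, h⟩ := Runs.forLoop (F := F) hκ (body := .intSet (A 1 (iv 2)) (iv 2)) (v := 2)
    (b := 0) (by simp [Cmd.LoopFree]) (by simp [Cmd.WritesInt])
    (by simp [Cmd.WritesInt]) (by norm_num) hs.card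
    (fun i s' => ∀ j : Fin n, (j : ℕ) < i → s'.ints 1 [pt j] = pt j)
    (by
      intro i s' z h
      simpa using h)
    (by simp)
    (by
      intro i hi s' hk hv h j hj
      by_cases hji : (j : ℕ) = i
      · have : (i : ℤ) = pt j := by simp [pt, hji]
        simp [run, hv, this]
      · have : pt j ≠ (i : ℤ) := by simpa [pt] using hji
        simpa [run, hv, this] using h j (by omega))
  exact ⟨s', hr, fun i => h i i.2⟩

theorem hasInput_input (F : SketchableFamily (Fin n) σ) (x : Fin n → EuclideanSpace ℝ (Fin d))
    (ε : ℝ) : HasInput F x ε (input F x ε) := by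
  refine ⟨by simp [input], by simp [input], fun i j => ?_, fun i => ?_, by simp [input]⟩
  · simp [input, pt]
  · simp [input, pt]

theorem WP.seq {cfg : List Cmd} (hκ : 1 ≤ κ) {c₁ c₂ : Cmd} {s : Store σ} {Q : Store σ → Prop}
    {T : ℕ} (h : WP F κ (c₁ :: c₂ :: cfg, s) Q (T : ℝ≥0∞)) :
    WP F κ (.seq c₁ c₂ :: cfg, s) Q ((T + κ : ℕ) : ℝ≥0∞) := by
  refine (WP.of_pure hκ rfl h).mono (by push_cast; exact le_rfl)

theorem Runs.wp_nat {cfg : List Cmd} {c : Cmd} {s s' : Store σ} {Q : Store σ → Prop}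
    {T U : ℕ} (hr : Runs F κ c s s' T) (h : WP F κ (cfg, s') Q (U : ℝ≥0∞)) :
    WP F κ (c :: cfg, s) Q ((U + κ * T : ℕ) : ℝ≥0∞) :=
  (hr.wp _ _ _ h).mono (by push_cast; exact le_rfl)

/-- The case `d = 0` needs a bound without `J`, because there the claimed time does not depend on
`ε`. Distinct points then mean a single point, whose singleton is in the family, so the program
stops after the initial test. -/
theorem wp_clusteringProgram (hκ : 1 ≤ κ) (hn : 0 < n) (hF : ∃ P, IsClustering F P)
    (hx : Function.Injective x) (hε : 0 < ε) {J : ℕ} (hJ : 6000 ≤ (1 + ε / 4) ^ J) :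
    WP F κ ([clusteringProgram d], input F x ε) (Correct F x ε)
      ((κ * (n * (2 * (clusterTime d + 9) * (J + 2) + searchTime d + 50)) : ℕ) : ℝ≥0∞) ∧
    (d = 0 → WP F κ ([clusteringProgram d], input F x ε) (Correct F x ε)
      ((κ * (n * 50) : ℕ) : ℝ≥0∞)) := by
  classical
  have hin := hasInput_input F x ε
  set s := input F x ε with hs
  have hr1 : Runs F κ (.intSet (V 11) (.intLit 1)) s (s.setInt (V 11) 1) 1 :=
    Runs.intSet hκ (by simp [Expr.eval])
  have hin1 : HasInput F x ε (s.setInt (V 11) 1) := hin.of_keeps hr1.keeps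
    (by simp [Cmd.WritesInt]) (by simp [Cmd.WritesReal]) (by simp [Cmd.WritesReal])
    (by simp [Cmd.WritesSketch]) (by simp [Cmd.WritesSketch])
  obtain ⟨s2, hr2, h11⟩ := runs_testLoop hκ hin1 (by simp)
  have hin2 : HasInput F x ε s2 := hin1.of_keeps hr2.keeps
    (by simp [forLoop, testBody, Cmd.WritesInt]) (by simp [forLoop, testBody, Cmd.WritesReal])
    (by simp [forLoop, testBody, Cmd.WritesReal]) (by simp [forLoop, testBody, Cmd.WritesSketch])
    (by simp [forLoop, testBody, Cmd.WritesSketch])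
  by_cases hall : ∀ i : Fin n, {i} ∈ F.family
  · rw [if_pos hall] at h11
    obtain ⟨s3, hr3, h1⟩ := runs_identityLoop hκ hin2
    have hcorrect : Correct F x ε s3 := by
      -- The radius `0` is correct without being written: real variable `2` still has its initial
      -- value.
      refine ⟨id, 0, ⟨h1, ?_⟩, ⟨fun i => rfl, fun i => ?_, fun i => by simp, by positivity⟩⟩
      · rw [hr3.keeps.reals 2 (by simp [forLoop, Cmd.WritesReal]),
          hr2.keeps.reals 2 (by simp [forLoop, testBody, Cmd.WritesReal])]
        simp [hs, input]
      · have : (Finset.univ.filter fun j => id j = id i) = {i} := by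
          ext q
          simp
        rw [this]
        exact hall i
    have hrun := hr1.seq hκ (hr2.seq hκ (Runs.ite_pos (p := .intLe (.intLit 1) (iv 11))
      (c₂ := (.seq initCmd (.seq (searchLoop d) (.seq
        (.ite (.intLe (iv 15) (.intLit 0))
          (.realSet (V 7) (.realDiv (rv 6) (.ofInt (.intLit 16)))) .skip)
        (finalCmd d))))) hκ (by simp [Expr.eval, h11]) hr3))
    have hw : WP F κ ([clusteringProgram d], s) (Correct F x ε) ((κ * (n * 50) : ℕ) : ℝ≥0∞) := by
      refine (hrun.wp [] _ _ (WP.nil hcorrect)).mono ?_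
      rw [zero_add]
      norm_cast
      exact Nat.mul_le_mul_left κ (by omega)
    refine ⟨hw.mono ?_, fun _ => hw⟩
    norm_cast
    exact Nat.mul_le_mul_left κ (Nat.mul_le_mul_left n (by omega))
  · rw [if_neg hall] at h11
    push Not at hall
    obtain ⟨i₀, hi₀⟩ := hall
    have hopt := optRadius_pos hF hx hi₀
    have hd : 0 < d := by
      rcases Nat.eq_zero_or_pos d with rfl | h
      · exfalso
        refine hi₀ ?_
        have : ({i₀} : Finset (Fin n)) = Finset.univ := by
          ext q
          simp [hx (Subsingleton.elim (x q) (x i₀))]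
        rw [this]
        exact univ_mem hF hn
      · exact h
    refine ⟨?_, fun h => absurd h hd.ne'⟩
    have hf2 : Fresh s2 := by
      intro t _ k
      rw [hr2.keeps.ints 9 (by simp [forLoop, testBody, Cmd.WritesInt])]
      simp [hs, input]
    obtain ⟨s3, hr3, hin3, hf3, hW3⟩ := runs_initCmd hκ hin2 hf2
    have hsearch : Searching F x ε (List.finRange n) id 0 s3 := by
      refine ⟨hin3, hf3, hW3, reduced_initial (univ_mem hF hn), ?_, ?_⟩
      · rw [hr3.keeps.reals 6 (by simp [initCmd, forLoop, initBody, Cmd.WritesReal]),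
          hr2.keeps.reals 6 (by simp [forLoop, testBody, Cmd.WritesReal])]
        simp [hs, input]
      · rw [hr3.keeps.ints 15 (by simp [initCmd, forLoop, initBody, Cmd.WritesInt]),
          hr2.keeps.ints 15 (by simp [forLoop, testBody, Cmd.WritesInt])]
        simp [hs, input]
    set B := κ * ((clusterTime d + 9) * (n + 1) * (J + 2) + 3) with hB
    have hpost : ∀ s', SearchEnd F x ε s' → WP F κ ([.seq
        (.ite (.intLe (iv 15) (.intLit 0))
          (.realSet (V 7) (.realDiv (rv 6) (.ofInt (.intLit 16)))) .skip)
        (finalCmd d)], s') (Correct F x ε) (B : ℝ≥0∞) := by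
      intro s' hs'
      obtain ⟨s'', r₀, hr, hfound, h7⟩ : ∃ s'' r₀, Runs F κ (.ite (.intLe (iv 15) (.intLit 0))
          (.realSet (V 7) (.realDiv (rv 6) (.ofInt (.intLit 16)))) .skip) s' s'' 2 ∧
          Found F x ε r₀ s'' ∧ s''.reals 7 [] = r₀ := by
        rcases hs' with ⟨W, rep, δ, hs', hW⟩ | ⟨r₀, hfound, h15, h7⟩
        · have h1 := hs'.reduced.optRadius_le_of_length_le_one hW
          have h2 := hs'.reduced.le_opt
          have hr : Runs F κ (.realSet (V 7) (.realDiv (rv 6) (.ofInt (.intLit 16)))) s'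
              (s'.setReal (V 7) (δ / 16)) 1 := Runs.realSet hκ (by simp [Expr.eval, hs'.drift])
          -- When at most one point is left, `opt ≤ δ ≤ 16 * opt`, so `δ / 16` is the required lower
          -- bound; it is positive because `opt` is.
          refine ⟨_, δ / 16, Runs.ite_pos hκ (by simp [Expr.eval, hs'.going]) hr,
            ⟨?_, ?_, by linarith, by linarith, by linarith⟩, by simp⟩
          · exact hs'.input.of_keeps hr.keeps (by simp [Cmd.WritesInt]) (by simp [Cmd.WritesReal])
              (by simp [Cmd.WritesReal]) (by simp [Cmd.WritesSketch]) (by simp [Cmd.WritesSketch])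
          · exact hs'.fresh.of_keeps hr.keeps (by simp [Cmd.WritesInt]) (by simp [Cmd.WritesInt])
        · exact ⟨s', r₀, Runs.ite_neg hκ (by simp [Expr.eval, h15])
            (Runs.of_loopFree hκ (c := .skip) trivial s'), hfound, h7⟩
      obtain ⟨s4, hr4, hcorrect⟩ := runs_finalCmd hκ hd hn hF hε hJ hfound h7
      refine ((hr.seq hκ hr4).wp [] _ _ (WP.nil hcorrect)).mono ?_
      rw [zero_add, hB]
      norm_cast
      exact Nat.mul_le_mul_left κ (by omega)
    have hw := wp_searchLoop (d := d) hκ hd hF hx hpost hsearch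
    have hw2 := WP.seq hκ (hr3.wp_nat (WP.seq hκ hw))
    have hstep : step F ([.ite (.intLe (.intLit 1) (iv 11))
        (forLoop 2 0 (.intSet (A 1 (iv 2)) (iv 2)))
        (.seq initCmd (.seq (searchLoop d) (.seq
          (.ite (.intLe (iv 15) (.intLit 0))
            (.realSet (V 7) (.realDiv (rv 6) (.ofInt (.intLit 16)))) .skip)
          (finalCmd d))))], s2) = PMF.pure ([.seq initCmd (.seq (searchLoop d) (.seq
          (.ite (.intLe (iv 15) (.intLit 0))
            (.realSet (V 7) (.realDiv (rv 6) (.ofInt (.intLit 16)))) .skip)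
          (finalCmd d)))], s2) := by
      rw [step, if_neg]
      simp [Expr.eval, h11]
    have hw3 := WP.of_pure hκ hstep hw2
    have hw4 := hr2.wp _ _ _ hw3
    have hw5 := WP.of_pure (c := .seq (forLoop 2 0 testBody) _) hκ rfl hw4
    have hw6 := hr1.wp _ _ _ hw5
    refine (WP.of_pure hκ rfl hw6).mono ?_
    norm_cast
    rw [hB, List.length_finRange]
    have h1 : (clusterTime d + 9) * (n + 1) * (J + 2) + 3 + searchTime d * n + 14 * n + 15 ≤
        n * (2 * (clusterTime d + 9) * (J + 2) + searchTime d + 50) := by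
      have h2 : (clusterTime d + 9) * (n + 1) * (J + 2) ≤
          (clusterTime d + 9) * (n + n) * (J + 2) := by gcongr; omega
      calc _ ≤ (clusterTime d + 9) * (n + n) * (J + 2) + searchTime d * n + 50 * n := by omega
        _ = _ := by ring
    refine le_trans (le_of_eq ?_) (Nat.mul_le_mul_left κ h1)
    ring

/-- The constant in the bound for the expected running time. -/
noncomputable def timeConstant (d κ : ℕ) : ℝ :=
  κ * (2 * (clusterTime d + 9) * 24003 + searchTime d + 50)

theorem approximatesWithin_clusteringProgram (hκ : 1 ≤ κ) (hn : 0 < n)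
    (hF : ∃ P, IsClustering F P) (hx : Function.Injective x) (hε : 0 < ε) :
    ApproximatesWithin (clusteringProgram d) κ F x ε
      (ENNReal.ofReal (timeConstant d κ * n * (max 1 (1 / ε)) ^ d)) := by
  set M := max 1 (1 / ε) with hM
  have hM1 : 1 ≤ M := le_max_left _ _
  have hMε : 1 ≤ M * ε := by
    have h1 : 1 / ε ≤ M := le_max_right _ _
    rwa [div_le_iff₀ hε] at h1
  -- Chosen for Bernoulli's inequality: `J * (ε / 4) ≥ 6000 * M * ε ≥ 6000`.
  set J := ⌈24000 * M⌉₊ with hJd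
  have hJ1 : 24000 * M ≤ J := Nat.le_ceil _
  have hJ2 : (J : ℝ) + 2 ≤ 24003 * M := by
    have := Nat.ceil_lt_add_one (a := 24000 * M) (by positivity)
    linarith
  have hJ : 6000 ≤ (1 + ε / 4) ^ J := by
    refine le_trans ?_ (one_add_mul_le_pow (by linarith) J)
    have h1 : 24000 * M * (ε / 4) ≤ J * (ε / 4) := by gcongr
    linarith
  obtain ⟨hw, hw0⟩ := wp_clusteringProgram (d := d) hκ hn hF hx hε hJ
  have hct : (0 : ℝ) ≤ clusterTime d := Nat.cast_nonneg _
  have hst : (0 : ℝ) ≤ searchTime d := Nat.cast_nonneg _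
  have hnat : ∀ N : ℕ, (N : ℝ) ≤ timeConstant d κ * n * M ^ d →
      (N : ℝ≥0∞) ≤ ENNReal.ofReal (timeConstant d κ * n * M ^ d) := by
    intro N hN
    rw [← ENNReal.ofReal_natCast]
    exact ENNReal.ofReal_le_ofReal hN
  rcases Nat.eq_zero_or_pos d with hd | hd
  · refine (hw0 hd).mono (hnat _ ?_)
    rw [timeConstant, hd]
    push_cast
    rw [pow_zero, mul_one, mul_assoc, mul_comm (n : ℝ)]
    gcongr
    subst hd
    linarith
  · refine hw.mono (hnat _ ?_)
    rw [timeConstant]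
    push_cast
    -- The program takes time proportional to `n * M`; only for `d ≥ 1` is this below `n * M ^ d`.
    have hMd : M ≤ M ^ d := le_self_pow₀ hM1 hd.ne'
    have hMd1 : 1 ≤ M ^ d := hM1.trans hMd
    calc (κ : ℝ) * (n * (2 * (clusterTime d + 9) * (J + 2) + searchTime d + 50))
        ≤ κ * (n * (2 * (clusterTime d + 9) * (24003 * M ^ d) + searchTime d * M ^ d +
          50 * M ^ d)) := by
          gcongr
          · exact hJ2.trans (by gcongr)
          · exact le_mul_of_one_le_right hst hMd1
          · linarith
      _ = _ := by ring

theorem exists_isClustering_lowerBoundFamily {k : ℕ} (hn : 0 < n) (hk : k ≤ n) :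
    ∃ P, IsClustering (lowerBoundFamily n k) P := by
  have hne : (Finset.univ : Finset (Fin n)) ≠ ⊥ := by
    rw [Finset.bot_eq_empty, ← Finset.nonempty_iff_ne_empty]
    exact ⟨⟨0, hn⟩, Finset.mem_univ _⟩
  refine ⟨Finpartition.indiscrete hne, fun S hS => ?_⟩
  have hS' : S = Finset.univ := by simpa using hS
  simp [lowerBoundFamily, hS', hk]

end SketchRAM

theorem mainTheorem9 (d κ : ℕ) (hκ : 1 ≤ κ) :
    ∃ (prog : SketchRAM.Cmd) (C : ℝ),
      (∀ (σ : Type*) (n : ℕ) (F : SketchableFamily (Fin n) σ)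
          (x : Fin n → EuclideanSpace ℝ (Fin d)) (ε : ℝ),
        0 < n → Function.Injective x → 0 < ε →
        (∃ P, MinMaxClustering.IsClustering F P) →
        SketchRAM.ApproximatesWithin prog κ F x ε
          (ENNReal.ofReal (C * n * (max 1 (1 / ε)) ^ d))) ∧
      (∀ (n k : ℕ) (x : Fin n → EuclideanSpace ℝ (Fin d)) (ε : ℝ),
        0 < n → Function.Injective x → 0 < ε → k ≤ n →
        SketchRAM.ApproximatesWithin prog κ (lowerBoundFamily n k) x ε
          (ENNReal.ofReal (C * n * (max 1 (1 / ε)) ^ d))) :=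
  ⟨SketchRAM.clusteringProgram d, SketchRAM.timeConstant d κ,
    fun _ _ _ _ _ hn hx hε hF =>
      SketchRAM.approximatesWithin_clusteringProgram hκ hn hF hx hε,
    fun _ _ _ _ hn hx hε hk => SketchRAM.approximatesWithin_clusteringProgram hκ hn
      (SketchRAM.exists_isClustering_lowerBoundFamily hn hk) hx hε⟩
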